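/- All algebras are over $\mathbb{Q}$ and differentials have degree $+1$. A commutative DGA $A=\bigoplus_{i\ge 0}A^i$ is graded commutative and concentrated in degrees $\ge 0$; it is connected if $A^0=\mathbb{Q}$, and $A^+=\bigoplus_{i>0}A^i$. An algebraic fibration over $A$ is an inclusion of commutative DGAs $\iota\colon (A,d)\hookrightarrow (A\otimes\Lambda V,d)$, where $\Lambda V$ is the free graded commutative algebra on a graded vector space $V=\bigoplus_{k\ge1}V^k$ that is the union of graded subspaces $V(0)\subseteq V(1)\subseteq\cdots$ with $d(V(0))\subseteq A$ and $d(V(n))\subseteq A\otimes\Lambda V(n-1)$ for $n\ge1$. For connected $A$ its fiber is $\mathbb{Q}\otimes_A(A\otimes\Lambda V)=\Lambda V$ with the induced differential; the fiber has finite cohomological dimension if its cohomology vanishes in all sufficiently large degrees. Let $\mathrm{ann}(A)\subseteq H^\bullet(A)$ be the set of classes $a$ for which there is an algebraic fibration $\iota$ over $A$ whose fiber has finite cohomological dimension and such that $\iota_*(a)=0$. An MC-product data $\lambda$ consists of a central extension $0\to Z\to\widetilde L\xrightarrow{\pi}L\to0$ of nilpotent differential graded Lie algebras concentrated in nonpositive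 degrees, with $Z\subseteq\ker\tilde d_L$ and $\operatorname{Im}\tilde d_L\cap Z=0$, together with an isomorphism of $Z$ with a copy of $\mathbb{Q}$ placed in a degree $q\le0$. On $A\otimes L$ use the bracket $[b_1\otimes w_1,b_2\otimes w_2]=(-1)^{|w_1||b_2|}b_1b_2\otimes[w_1,w_2]$ and the differential $d(b\otimes w)=db\otimes w+(-1)^{|b|}b\otimes d_Lw$, and put $F(\alpha)=d\alpha+\tfrac12[\alpha,\alpha]$. A defining system is an element $\alpha\in A^+\otimes L$ of degree $1$ with $F(\alpha)=0$; if $\tilde\alpha\in A^+\otimes\widetilde L$ is a lift of $\alpha$ of degree $1$, then $F(\tilde\alpha)\in A^+\otimes Z\cong A^+$ is a cocycle, whose class $m(\alpha)\in H^{2-q}(A)$ does not depend on the lift. Let $MP_\lambda(A)$ be the set of all $m(\alpha)$. **Theorem 4.2.** Let $A$ be a connected commutative DGA. Then $\mathrm{ann}(A)$ is a homogeneous ideal of $H^\bullet(A)$ and $$\mathrm{ann}(A)=\bigoplus_{k>0}H^{2k}(A)+\bigcup_\lambda MP_\lambda(A),$$ where $\lambda$ runs through all MC-product data, in the following sense: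 a homogeneous class lies in $\mathrm{ann}(A)$ if and only if it is the sum of an element of $\bigoplus_{k>0}H^{2k}(A)$ and a single element of $\bigcup_\lambda MP_\lambda(A)$; and the ideal $\mathrm{ann}(A)$ is the linear span of $\bigoplus_{k>0}H^{2k}(A)$ and $\bigcup_\lambda MP_\lambda(A)$. -/

import Mathlib

open scoped TensorProduct DirectSum

universe u v w

noncomputable section

/-! ### Graded vector spaces -/

/-- The linear endomorphism of a graded vector space that multiplies the component of degree `i`
by the scalar `c i`. -/
def gradedScale {ι : Type*} [DecidableEq ι] {M : Type*} [AddCommGroup M] [Module ℚ M]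
    (ℳ : ι → Submodule ℚ M) [DirectSum.Decomposition ℳ] (c : ι → ℚ) : M →ₗ[ℚ] M :=
  (DirectSum.toModule ℚ ι M fun i => c i • (ℳ i).subtype) ∘ₗ
    (DirectSum.decomposeLinearEquiv ℳ).toLinearMap

theorem gradedScale_apply {ι : Type*} [DecidableEq ι] {M : Type*} [AddCommGroup M] [Module ℚ M]
    (ℳ : ι → Submodule ℚ M) [DirectSum.Decomposition ℳ] (c : ι → ℚ) {i : ι} {x : M}
    (hx : x ∈ ℳ i) : gradedScale ℳ c x = c i • x := by
  simp only [gradedScale, LinearMap.comp_apply, LinearEquiv.coe_coe,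
    DirectSum.decomposeLinearEquiv_apply, DirectSum.decompose_of_mem ℳ hx]
  erw [DirectSum.toModule_lof]
  simp

/-! ### Commutative differential graded algebras -/

/-- A commutative differential graded algebra over `ℚ`, concentrated in degrees `≥ 0`, with a
differential of degree `+1`. -/
structure CDGA where
  carrier : Type u
  [ring : Ring carrier]
  [algebra : Algebra ℚ carrier]
  /-- the subspace of elements of degree `n` -/
  deg : ℕ → Submodule ℚ carrier
  [graded : GradedAlgebra deg]
  d : carrier →ₗ[ℚ] carrier
  d_mem : ∀ {n : ℕ} {a : carrier}, a ∈ deg n → d a ∈ deg (n + 1)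
  d_d : ∀ a : carrier, d (d a) = 0
  comm : ∀ {m n : ℕ} {a b : carrier}, a ∈ deg m → b ∈ deg n →
    a * b = ((-1 : ℚ) ^ (m * n)) • (b * a)
  leibniz : ∀ {m : ℕ} {a : carrier} (b : carrier), a ∈ deg m →
    d (a * b) = d a * b + ((-1 : ℚ) ^ m) • (a * d b)

namespace CDGA

instance : CoeSort CDGA.{u} (Type u) := ⟨CDGA.carrier⟩

attribute [instance] CDGA.ring CDGA.algebra CDGA.graded

/-- `A` is connected if `A⁰ = ℚ`. -/
def IsConnected (A : CDGA.{u}) : Prop :=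
  Nontrivial A ∧ ∀ a ∈ A.deg 0, ∃ r : ℚ, algebraMap ℚ A r = a

variable (A : CDGA.{u})

theorem d_one : A.d 1 = 0 := by
  have h := A.leibniz (m := 0) (a := 1) 1 (SetLike.one_mem_graded A.deg)
  simpa using h

theorem d_mul_of_d_eq_zero_right (a : A) {b : A} (hb : A.d b = 0) : A.d (a * b) = A.d a * b := by
  induction a using DirectSum.Decomposition.inductionOn A.deg with
  | zero => simp
  | homogeneous a => rw [A.leibniz b a.2, hb]; simp
  | add x y hx hy => rw [add_mul, map_add, map_add, hx, hy, add_mul]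

/-- The homogeneous components of `d a` are the differentials of those of `a`. -/
theorem decompose_d (a : A) (n : ℕ) :
    (DirectSum.decompose A.deg (A.d a) (n + 1) : A) = A.d (DirectSum.decompose A.deg a n) := by
  induction a using DirectSum.Decomposition.inductionOn A.deg with
  | zero => simp
  | @homogeneous i a =>
    rcases eq_or_ne i n with rfl | h
    · rw [DirectSum.decompose_of_mem_same _ (A.d_mem a.2), DirectSum.decompose_of_mem_same _ a.2]
    · rw [DirectSum.decompose_of_mem_ne _ (A.d_mem a.2) (by omega),
        DirectSum.decompose_of_mem_ne _ a.2 h, map_zero]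
  | add x y hx hy => simp [hx, hy]

/-- The algebra of cocycles. -/
def cocycles : Subalgebra ℚ A where
  carrier := {a | A.d a = 0}
  mul_mem' {a b} ha hb := by
    change A.d (a * b) = 0
    rw [A.d_mul_of_d_eq_zero_right a hb, show A.d a = 0 from ha, zero_mul]
  add_mem' {a b} ha hb := by
    change A.d (a + b) = 0
    rw [map_add, show A.d a = 0 from ha, show A.d b = 0 from hb, add_zero]
  algebraMap_mem' r := by
    change A.d (algebraMap ℚ A r) = 0
    rw [Algebra.algebraMap_eq_smul_one, map_smul, A.d_one, smul_zero]

theorem mem_cocycles {a : A} : a ∈ A.cocycles ↔ A.d a = 0 := Iff.rfl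

theorem exists_d_eq_cocycle_mul {a : A} (ha : A.d a = 0) (b : A) :
    ∃ y, A.d y = a * A.d b := by
  classical
  have key : ∀ n, ∃ y, A.d y = (DirectSum.decompose A.deg a n : A) * A.d b := fun n => by
    have hn : A.d (DirectSum.decompose A.deg a n) = 0 := by
      rw [← A.decompose_d, ha]; simp
    refine ⟨((-1 : ℚ) ^ n) • ((DirectSum.decompose A.deg a n : A) * b), ?_⟩
    rw [map_smul, A.leibniz b (DirectSum.decompose A.deg a n).2, hn, zero_mul, zero_add,
      smul_smul, ← mul_pow]
    simp
  choose y hy using key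
  refine ⟨∑ n ∈ (DirectSum.decompose A.deg a).support, y n, ?_⟩
  conv_rhs => rw [← DirectSum.sum_support_decompose A.deg a]
  rw [map_sum, Finset.sum_mul]
  exact Finset.sum_congr rfl fun n _ => hy n

/-- The ideal of coboundaries in the algebra of cocycles. -/
def coboundaries : Ideal A.cocycles where
  carrier := {z | ∃ y, A.d y = z}
  add_mem' := by
    rintro a b ⟨x, hx⟩ ⟨y, hy⟩
    exact ⟨x + y, by simp [hx, hy]⟩
  zero_mem' := ⟨0, by simp⟩
  smul_mem' := by
    rintro c z ⟨y, hy⟩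
    obtain ⟨t, ht⟩ := A.exists_d_eq_cocycle_mul c.2 y
    exact ⟨t, by simp [ht, hy]⟩

instance : A.coboundaries.IsTwoSided where
  mul_mem_of_left := by
    rintro z c ⟨y, hy⟩
    refine ⟨y * c, ?_⟩
    rw [A.d_mul_of_d_eq_zero_right y c.2, hy]
    rfl

/-- The cohomology algebra `H^•(A)`. -/
abbrev Cohomology : Type u := A.cocycles ⧸ A.coboundaries

/-- The cohomology class of a cocycle. -/
abbrev cls (z : A.cocycles) : A.Cohomology := Ideal.Quotient.mk A.coboundaries z

/-- The subspace `Hⁿ(A)` of `H^•(A)`. -/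
def H (n : ℕ) : Submodule ℚ A.Cohomology :=
  ((A.deg n).comap A.cocycles.val.toLinearMap).map
    (Ideal.Quotient.mkₐ ℚ A.coboundaries).toLinearMap

/-- The subspace `⨁_{k > 0} H^{2k}(A)` of `H^•(A)`. -/
def evenCohomology : Submodule ℚ A.Cohomology :=
  ⨆ (k : ℕ) (_ : 0 < k), A.H (2 * k)

/-- Morphisms of commutative DGAs. -/
structure Hom (A : CDGA.{u}) (B : CDGA.{v}) where
  toAlgHom : A →ₐ[ℚ] B
  map_deg : ∀ {n : ℕ} {a : A}, a ∈ A.deg n → toAlgHom a ∈ B.deg n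
  map_d : ∀ a : A, toAlgHom (A.d a) = B.d (toAlgHom a)

namespace Hom

variable {A : CDGA.{u}} {B : CDGA.{v}} (f : Hom A B)

/-- The restriction of a morphism to cocycles. -/
def onCocycles : A.cocycles →ₐ[ℚ] B.cocycles :=
  (f.toAlgHom.comp A.cocycles.val).codRestrict B.cocycles fun z => by
    rw [mem_cocycles]
    change B.d (f.toAlgHom z) = 0
    rw [← f.map_d, show A.d z = 0 from z.2, map_zero]

/-- The map induced by a morphism on cohomology. -/
def onCohomology : A.Cohomology →ₐ[ℚ] B.Cohomology :=
  Ideal.quotientMapₐ B.coboundaries f.onCocycles (by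
    rintro z ⟨y, hy⟩
    refine ⟨f.toAlgHom y, ?_⟩
    rw [← f.map_d, hy]
    rfl)

end Hom

end CDGA

/-! ### Free graded commutative algebras and algebraic fibrations -/

/-- The relations `v w = (-1)^{|v||w|} w v`, for homogeneous `v`, `w` in `V`, imposed on the tensor
algebra of a graded vector space `V`. -/
inductive FreeGradedComm.Rel {V : Type w} [AddCommGroup V] [Module ℚ V]
    (𝒱 : ℕ → Submodule ℚ V) : TensorAlgebra ℚ V → TensorAlgebra ℚ V → Prop
  | swap {i j : ℕ} {v w : V} (hv : v ∈ 𝒱 i) (hw : w ∈ 𝒱 j) :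
      FreeGradedComm.Rel 𝒱 (TensorAlgebra.ι ℚ v * TensorAlgebra.ι ℚ w)
        (((-1 : ℚ) ^ (i * j)) • (TensorAlgebra.ι ℚ w * TensorAlgebra.ι ℚ v))

/-- The free graded commutative algebra `ΛV` on a graded vector space `V`. -/
abbrev FreeGradedComm {V : Type w} [AddCommGroup V] [Module ℚ V]
    (𝒱 : ℕ → Submodule ℚ V) : Type w :=
  RingQuot (FreeGradedComm.Rel 𝒱)

/-- The algebra morphism `ΛV → E` to (the underlying algebra of) a commutative DGA that extends a
degree-preserving linear map `V → E`. -/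
def FreeGradedComm.lift {V : Type w} [AddCommGroup V] [Module ℚ V]
    (𝒱 : ℕ → Submodule ℚ V) {E : CDGA.{u}} (g : V →ₗ[ℚ] E)
    (hg : ∀ {k : ℕ} {v : V}, v ∈ 𝒱 k → g v ∈ E.deg k) : FreeGradedComm 𝒱 →ₐ[ℚ] E :=
  RingQuot.liftAlgHom ℚ ⟨TensorAlgebra.lift ℚ g, by
    rintro _ _ ⟨hv, hw⟩
    simp only [map_mul, map_smul, TensorAlgebra.lift_ι_apply]
    exact E.comm (hg hv) (hg hw)⟩

theorem FreeGradedComm.lift_ι {V : Type w} [AddCommGroup V] [Module ℚ V]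
    (𝒱 : ℕ → Submodule ℚ V) {E : CDGA.{u}} (g : V →ₗ[ℚ] E)
    (hg : ∀ {k : ℕ} {v : V}, v ∈ 𝒱 k → g v ∈ E.deg k) (v : V) :
    FreeGradedComm.lift 𝒱 g hg (RingQuot.mkAlgHom ℚ _ (TensorAlgebra.ι ℚ v)) = g v := by
  simp [FreeGradedComm.lift]

/-- An algebraic fibration `(A, d) ↪ (A ⊗ ΛV, d)`.  The total space is a commutative DGA `E` with a
morphism `A → E` and a degree-preserving map `V → E` such that multiplication
`A ⊗ ΛV → E` is bijective.  Since `E` is graded commutative, this says that `E` is `A ⊗ ΛV` as a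
graded algebra, with `A ↪ E` the inclusion `a ↦ a ⊗ 1`. -/
structure AlgebraicFibration (A : CDGA.{u}) where
  /-- the graded vector space `V`, in degrees `≥ 1` -/
  V : Type w
  [addCommGroup : AddCommGroup V]
  [module : Module ℚ V]
  degV : ℕ → Submodule ℚ V
  [decomposition : DirectSum.Decomposition degV]
  degV_zero : degV 0 = ⊥
  total : CDGA.{max u w}
  incl : CDGA.Hom A total
  gen : V →ₗ[ℚ] total
  gen_mem : ∀ {k : ℕ} {v : V}, v ∈ degV k → gen v ∈ total.deg k
  bijective : Function.Bijective
    (TensorProduct.lift ((LinearMap.mul ℚ total).compl₁₂ incl.toAlgHom.toLinearMap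
      (FreeGradedComm.lift degV gen gen_mem).toLinearMap) :
        A ⊗[ℚ] FreeGradedComm degV →ₗ[ℚ] total)
  /-- the exhausting filtration `V(0) ⊆ V(1) ⊆ ⋯` by graded subspaces -/
  filt : ℕ → Submodule ℚ V
  filt_mono : Monotone filt
  filt_graded : ∀ (n : ℕ) {v : V}, v ∈ filt n →
    ∀ k, (DirectSum.decompose degV v k : V) ∈ filt n
  filt_exhausts : ∀ v : V, ∃ n, v ∈ filt n
  d_filt_zero : ∀ v ∈ filt 0, total.d (gen v) ∈ incl.toAlgHom.range
  /-- `d` maps `V(n+1)` to `A ⊗ ΛV(n)`, the subalgebra generated by `A` and `V(n)` -/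
  d_filt_succ : ∀ (n : ℕ), ∀ v ∈ filt (n + 1), total.d (gen v) ∈
    Algebra.adjoin ℚ ((incl.toAlgHom.range : Set total) ∪ gen '' (filt n : Set V))

namespace AlgebraicFibration

attribute [instance] AlgebraicFibration.addCommGroup AlgebraicFibration.module
  AlgebraicFibration.decomposition

variable {A : CDGA.{u}} (F : AlgebraicFibration.{u, w} A)

/-- The subspace `A⁺ · (A ⊗ ΛV)` of the total space. -/
def baseIdeal : Submodule ℚ F.total :=
  Submodule.span ℚ {x | ∃ (n : ℕ) (a : A) (y : F.total), 0 < n ∧ a ∈ A.deg n ∧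
    x = F.incl.toAlgHom a * y}

theorem baseIdeal_le_comap_d : F.baseIdeal ≤ F.baseIdeal.comap F.total.d := by
  refine Submodule.span_le.2 ?_
  rintro _ ⟨n, a, y, hn, ha, rfl⟩
  change F.total.d _ ∈ F.baseIdeal
  rw [F.total.leibniz y (F.incl.map_deg ha), ← F.incl.map_d]
  exact F.baseIdeal.add_mem
    (Submodule.subset_span ⟨n + 1, A.d a, y, n.succ_pos, A.d_mem ha, rfl⟩)
    (F.baseIdeal.smul_mem _ (Submodule.subset_span ⟨n, a, F.total.d y, hn, ha, rfl⟩))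

/-- The algebraic fiber `(A ⊗ ΛV) / A⁺ · (A ⊗ ΛV)`.  For connected `A` it is
`ℚ ⊗_A (A ⊗ ΛV) = ΛV`, with the induced differential. -/
abbrev Fiber : Type (max u w) := F.total ⧸ F.baseIdeal

/-- The differential of the fiber. -/
def fiberD : F.Fiber →ₗ[ℚ] F.Fiber :=
  F.baseIdeal.mapQ F.baseIdeal F.total.d F.baseIdeal_le_comap_d

/-- The elements of degree `n` of the fiber. -/
def fiberDeg (n : ℕ) : Submodule ℚ F.Fiber :=
  (F.total.deg n).map F.baseIdeal.mkQ

/-- The fiber has finite cohomological dimension: its cohomology vanishes in all sufficiently large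
degrees. -/
def FiberHasFiniteCohomologicalDimension : Prop :=
  ∃ N : ℕ, ∀ k, N < k → ∀ x ∈ F.fiberDeg k, F.fiberD x = 0 → ∃ y, F.fiberD y = x

end AlgebraicFibration

/-- `ann(A)`: the classes in `H^•(A)` that are annihilated by some algebraic fibration whose fiber
has finite cohomological dimension. -/
def ann (A : CDGA.{u}) : Set A.Cohomology :=
  {a | ∃ F : AlgebraicFibration.{u, w} A,
    F.FiberHasFiniteCohomologicalDimension ∧ F.incl.onCohomology a = 0}

/-! ### Differential graded Lie algebras -/

/-- A differential graded Lie algebra over `ℚ`, with a differential of degree `+1`. -/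
structure DGLA where
  carrier : Type v
  [addCommGroup : AddCommGroup carrier]
  [module : Module ℚ carrier]
  /-- the subspace of elements of degree `n` -/
  deg : ℤ → Submodule ℚ carrier
  [decomposition : DirectSum.Decomposition deg]
  bracket : carrier →ₗ[ℚ] carrier →ₗ[ℚ] carrier
  d : carrier →ₗ[ℚ] carrier
  bracket_mem : ∀ {i j : ℤ} {x y : carrier}, x ∈ deg i → y ∈ deg j → bracket x y ∈ deg (i + j)
  d_mem : ∀ {i : ℤ} {x : carrier}, x ∈ deg i → d x ∈ deg (i + 1)
  antisymm : ∀ {i j : ℤ} {x y : carrier}, x ∈ deg i → y ∈ deg j →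
    bracket x y = -(((-1 : ℚ) ^ (i * j)) • bracket y x)
  jacobi : ∀ {i j : ℤ} {x y : carrier} (z : carrier), x ∈ deg i → y ∈ deg j →
    bracket x (bracket y z) =
      bracket (bracket x y) z + ((-1 : ℚ) ^ (i * j)) • bracket y (bracket x z)
  d_d : ∀ x : carrier, d (d x) = 0
  leibniz : ∀ {i : ℤ} {x : carrier} (y : carrier), x ∈ deg i →
    d (bracket x y) = bracket (d x) y + ((-1 : ℚ) ^ i) • bracket x (d y)

namespace DGLA

instance : CoeSort DGLA.{v} (Type v) := ⟨DGLA.carrier⟩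

attribute [instance] DGLA.addCommGroup DGLA.module DGLA.decomposition

/-- The lower central series `L ⊇ [L, L] ⊇ [L, [L, L]] ⊇ ⋯`. -/
def lowerCentralSeries (L : DGLA.{v}) : ℕ → Submodule ℚ L
  | 0 => ⊤
  | n + 1 => Submodule.map₂ L.bracket ⊤ (L.lowerCentralSeries n)

/-- `L` is nilpotent. -/
def IsNilpotent (L : DGLA.{v}) : Prop := ∃ n, L.lowerCentralSeries n = ⊥

/-- `L` is concentrated in nonpositive degrees. -/
def IsNonpositive (L : DGLA.{v}) : Prop := ∀ i : ℤ, 0 < i → L.deg i = ⊥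

/-- Morphisms of DGLAs. -/
structure Hom (L M : DGLA.{v}) where
  toLinearMap : L →ₗ[ℚ] M
  map_deg : ∀ {i : ℤ} {x : L}, x ∈ L.deg i → toLinearMap x ∈ M.deg i
  map_bracket : ∀ x y : L, toLinearMap (L.bracket x y) = M.bracket (toLinearMap x) (toLinearMap y)
  map_d : ∀ x : L, toLinearMap (L.d x) = M.d (toLinearMap x)

/-! #### The DGLA `A ⊗ L` -/

variable (A : CDGA.{u}) (L : DGLA.{v})

/-- The bracket of `A ⊗ L`,
`[b₁ ⊗ w₁, b₂ ⊗ w₂] = (-1)^{|w₁||b₂|} b₁ b₂ ⊗ [w₁, w₂]`: there is no sign on the part where `b₂` has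
even degree, and the sign `(-1)^{|w₁|}` on the part where `b₂` has odd degree. -/
def tensorBracket : (A ⊗[ℚ] L) →ₗ[ℚ] (A ⊗[ℚ] L) →ₗ[ℚ] (A ⊗[ℚ] L) :=
  (TensorProduct.map₂ (LinearMap.mul ℚ A) L.bracket).compl₂
      ((gradedScale A.deg fun n => if Even n then 1 else 0).rTensor L) +
  (TensorProduct.map₂ (LinearMap.mul ℚ A) L.bracket).compl₁₂
      ((gradedScale L.deg fun i => (-1 : ℚ) ^ i).lTensor A)
      ((gradedScale A.deg fun n => if Even n then 0 else 1).rTensor L)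

theorem tensorBracket_tmul {m : ℕ} {i : ℤ} (b₁ : A) {w₁ : L} {b₂ : A} (w₂ : L)
    (hw₁ : w₁ ∈ L.deg i) (hb₂ : b₂ ∈ A.deg m) :
    tensorBracket A L (b₁ ⊗ₜ w₁) (b₂ ⊗ₜ w₂) =
      ((-1 : ℚ) ^ (i * (m : ℤ))) • ((b₁ * b₂) ⊗ₜ[ℚ] L.bracket w₁ w₂) := by
  rcases Nat.even_or_odd m with h | h
  · have h' : Even (i * (m : ℤ)) := (Int.even_coe_nat m |>.2 h).mul_left i
    simp [tensorBracket, gradedScale_apply _ _ hb₂, gradedScale_apply _ _ hw₁, h, h'.neg_one_zpow]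
  · have h' : ((-1 : ℚ) ^ (i * (m : ℤ))) = (-1) ^ i := by
      rw [mul_comm, zpow_mul, zpow_natCast, h.neg_one_pow]
    simp [tensorBracket, gradedScale_apply _ _ hb₂, gradedScale_apply _ _ hw₁,
      Nat.not_even_iff_odd.2 h, h', TensorProduct.smul_tmul']

/-- The differential of `A ⊗ L`, `d (b ⊗ w) = d b ⊗ w + (-1)^{|b|} b ⊗ d w`. -/
def tensorD : (A ⊗[ℚ] L) →ₗ[ℚ] (A ⊗[ℚ] L) :=
  A.d.rTensor L + TensorProduct.map (gradedScale A.deg fun n => (-1 : ℚ) ^ n) L.d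

theorem tensorD_tmul {m : ℕ} {b : A} (w : L) (hb : b ∈ A.deg m) :
    tensorD A L (b ⊗ₜ w) = A.d b ⊗ₜ w + ((-1 : ℚ) ^ m) • (b ⊗ₜ[ℚ] L.d w) := by
  simp [tensorD, gradedScale_apply _ _ hb, TensorProduct.smul_tmul']

/-- The subspace of elements of degree `n` of `A⁺ ⊗ L ⊆ A ⊗ L`, where `A⁺ = ⨁_{i > 0} Aⁱ`. -/
def posTensorDeg (n : ℤ) : Submodule ℚ (A ⊗[ℚ] L) :=
  Submodule.span ℚ {x | ∃ (i : ℕ) (j : ℤ) (b : A) (w : L), 0 < i ∧ (i : ℤ) + j = n ∧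
    b ∈ A.deg i ∧ w ∈ L.deg j ∧ x = b ⊗ₜ[ℚ] w}

/-- `F(α) = d α + ½ [α, α]`. -/
def curvature (α : A ⊗[ℚ] L) : A ⊗[ℚ] L :=
  tensorD A L α + (1 / 2 : ℚ) • tensorBracket A L α α

/-- A Maurer–Cartan element of `A⁺ ⊗ L`. -/
def IsMaurerCartan (α : A ⊗[ℚ] L) : Prop :=
  α ∈ posTensorDeg A L 1 ∧ curvature A L α = 0

end DGLA

/-! ### Maurer–Cartan higher products -/

/-- MC-product data: a central extension `0 → Z → L̃ → L → 0` of nilpotent DGLAs in nonpositive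
degrees, with `Z ⊆ Ker d̃` and `Im d̃ ∩ Z = 0`, and an isomorphism of graded vector spaces of
`Z = Ker π` with a copy of `ℚ` placed in a degree `q ≤ 0`. -/
structure MCProductData where
  Ltilde : DGLA.{v}
  L : DGLA.{v}
  π : DGLA.Hom Ltilde L
  surjective : Function.Surjective π.toLinearMap
  nilpotent_Ltilde : Ltilde.IsNilpotent
  nilpotent_L : L.IsNilpotent
  nonpositive_Ltilde : Ltilde.IsNonpositive
  nonpositive_L : L.IsNonpositive
  central : ∀ z ∈ LinearMap.ker π.toLinearMap, ∀ x, Ltilde.bracket z x = 0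
  Z_le_ker_d : LinearMap.ker π.toLinearMap ≤ LinearMap.ker Ltilde.d
  range_d_inf_Z : LinearMap.range Ltilde.d ⊓ LinearMap.ker π.toLinearMap = ⊥
  q : ℤ
  q_nonpos : q ≤ 0
  isoZ : ℚ ≃ₗ[ℚ] LinearMap.ker π.toLinearMap
  isoZ_mem : (isoZ 1 : Ltilde) ∈ Ltilde.deg q

/-- `x` is the MC higher product `m(α)` of the defining system `α`, i.e. of a Maurer–Cartan element
`α` of `A⁺ ⊗ L`: there is a lift `α̃` of `α` of degree one in `A⁺ ⊗ L̃` such that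
`x ∈ H^{2-q}(A)` is the class of `F(α̃) ∈ A⁺ ⊗ Z ≅ A⁺`.  (This class does not depend on the
lift.) -/
def IsMCHigherProduct (lam : MCProductData.{v}) (A : CDGA.{u}) (α : A ⊗[ℚ] lam.L)
    (x : A.Cohomology) : Prop :=
  DGLA.IsMaurerCartan A lam.L α ∧
  ∃ αt ∈ DGLA.posTensorDeg A lam.Ltilde 1, lam.π.toLinearMap.lTensor A αt = α ∧
    ∃ z : A.cocycles, (z : A) ∈ A.deg (2 - lam.q).toNat ∧
      DGLA.curvature A lam.Ltilde αt = (z : A) ⊗ₜ[ℚ] (lam.isoZ 1 : lam.Ltilde) ∧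
      A.cls z = x

/-- The set `MP_λ(A)` of the MC higher products `m(α)`, where `α` runs through all defining systems
with respect to `λ`. -/
def MP (lam : MCProductData.{v}) (A : CDGA.{u}) : Set A.Cohomology :=
  {x | ∃ α : A ⊗[ℚ] lam.L, IsMCHigherProduct lam A α x}

end

/-!
The two inclusions between `ann(A)` and the span of the even classes and the Maurer–Cartan products
are proved separately; the ideal property and homogeneity then follow, since kernels of algebra
morphisms are ideals and since fibrations respect degrees.

*Even classes and Maurer–Cartan products are annihilated* (`span_even_union_MP_subset_ann`). All
fibrations used are bounded: they arise by adjoining finitely many odd generators, so that the fiber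
vanishes in large degrees, and they can be enlarged further. An even cocycle `b` of positive degree
is killed by a generator `p` with `d p = b`. Let now `α` be a lift of a defining system, with
curvature `z ⊗ ζ`, where `ζ` spans the central subspace `Z`. If `z` is even, there is nothing to do.
If `z` is odd, the part of `α` with even coefficients is pushed down the filtration of `L` by the
lower central series (joined with `Z`), by gauge transformations over larger and larger fibrations
(`IsBounded.exists_over_evenPart_mem`). At each step, the curvature equation says that modulo the
next step the even part consists of an element of `A ⊗ d L`, which a gauge transformation removes,
and of terms `b ⊗ w` with `b` an even cocycle (`exists_dRight_add_closedEven`). These are removed by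
a gauge transformation once `b` is exact, that is, after adjoining an odd generator. In the end the
even part is `e ⊗ ζ`, and comparison of odd parts in the curvature, with `Im d ∩ Z = 0`, gives `d e
= z`.

*Annihilated classes are even or Maurer–Cartan products* (`exists_cls_mem_MP_of_odd`). Let `z` be a
cocycle of odd degree `n`, the degrees `0` and `1` being elementary, and let `y` be an element of an
algebraic fibration with `d y = z`. Since the fiber has finite cohomological dimension, there is a
largest `p` for which `yᵖ` is not exact in the fiber. Finitely many elements of `A ⊗ ΛV` lie in the
`A`-span of a finite frame, that is, of homogeneous elements of `ΛV` for which the differential is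
given by a strictly triangular matrix `X` over `A` (`IsTriangular.exists_frame`); as `d² = 0`, the
curvature of `X` vanishes (`Frame.exists_matrix`). The equations `d yʲ = j z yʲ⁻¹` for `j ≤ p + 1`,
where `yᵖ⁺¹` is corrected by a coboundary to lie in `A⁺ ⊗ ΛV`, allow to enlarge `X` to a strictly
triangular matrix whose curvature is zero but for one entry, where it is `z` (`powerMatrix`). Its
component in degree `0` is a rational matrix `T` with `T² = 0`. The other components form an element
of `A⁺ ⊗ L̃`, where `L̃` is a truncation of the Lie algebra of strictly triangular matrices with the
differential `[T, -]`, and `Z` is spanned by the elementary matrix of the corner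
(`exists_cls_mem_MP_of_matrix`). That this matrix is not a coboundary in `L̃` is what the choice of
`p` ensures.
-/

noncomputable section

/-! ### Gradings -/

/-- A grading of a vector space, given by the projections onto the homogeneous components. -/
@[reducible]
def decompositionOfProj {ι : Type*} [DecidableEq ι] {M : Type*} [AddCommGroup M] [Module ℚ M]
    (ℳ : ι → Submodule ℚ M) (pr : ι → M →ₗ[ℚ] M) (hmem : ∀ n x, pr n x ∈ ℳ n)
    (hsame : ∀ n, ∀ x ∈ ℳ n, pr n x = x) (hne : ∀ m n, m ≠ n → ∀ x ∈ ℳ m, pr n x = 0)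
    (hsum : ∀ x, ∃ s : Finset ι, x = ∑ n ∈ s, pr n x) : DirectSum.Decomposition ℳ :=
  DirectSum.IsInternal.chooseDecomposition ℳ (by
    have key : ∀ (u : ⨁ i, ℳ i) (n : ι),
        pr n (DirectSum.coeAddMonoidHom ℳ u) = (u n : M) := by
      intro u n
      induction u using DirectSum.induction_on with
      | zero => simp
      | of i x =>
        rw [DirectSum.coeAddMonoidHom_of]
        rcases eq_or_ne i n with rfl | h
        · rw [DirectSum.of_eq_same, hsame _ _ x.2]
        · rw [DirectSum.of_eq_of_ne _ _ _ h.symm, hne _ _ h _ x.2]; rfl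
      | add x y hx hy => simp [hx, hy]
    constructor
    · intro u u' h
      ext n
      rw [← key, ← key, h]
    · intro x
      obtain ⟨s, hs⟩ := hsum x
      refine ⟨∑ n ∈ s, DirectSum.of (fun i => ℳ i) n ⟨pr n x, hmem n x⟩, ?_⟩
      rw [map_sum]
      conv_rhs => rw [hs]
      exact Finset.sum_congr rfl fun n _ => DirectSum.coeAddMonoidHom_of _ _ _)

section Graded

variable {ι : Type*} [DecidableEq ι] {M : Type*} [AddCommGroup M] [Module ℚ M]
  (ℳ : ι → Submodule ℚ M) [DirectSum.Decomposition ℳ]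

/-- The projection of a graded vector space onto the component of degree `n`. -/
def gradedProj (n : ι) : M →ₗ[ℚ] M := gradedScale ℳ fun i => if i = n then 1 else 0

theorem gradedProj_same {n : ι} {x : M} (hx : x ∈ ℳ n) : gradedProj ℳ n x = x := by
  simp [gradedProj, gradedScale_apply ℳ _ hx]

theorem gradedProj_ne {m n : ι} (h : m ≠ n) {x : M} (hx : x ∈ ℳ m) : gradedProj ℳ n x = 0 := by
  simp [gradedProj, gradedScale_apply ℳ _ hx, h]

/-- Induction on a graded vector space, through homogeneous elements. -/
@[elab_as_elim]
theorem graded_induction {p : M → Prop} (x : M) (h0 : p 0) (hh : ∀ i, ∀ x ∈ ℳ i, p x)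
    (ha : ∀ x y, p x → p y → p (x + y)) : p x :=
  DirectSum.Decomposition.inductionOn ℳ h0 (fun {i} m => hh i m m.2) ha x

theorem gradedProj_eq_decompose (n : ι) (x : M) :
    gradedProj ℳ n x = (DirectSum.decompose ℳ x n : M) := by
  refine graded_induction ℳ x (by simp) (fun i x hx => ?_) (fun x y hx hy => by simp [hx, hy])
  rcases eq_or_ne i n with rfl | h
  · rw [gradedProj_same ℳ hx, DirectSum.decompose_of_mem_same _ hx]
  · rw [gradedProj_ne ℳ h hx, DirectSum.decompose_of_mem_ne _ hx h]

theorem gradedProj_mem (n : ι) (x : M) : gradedProj ℳ n x ∈ ℳ n := by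
  rw [gradedProj_eq_decompose]; exact SetLike.coe_mem _

theorem exists_sum_gradedProj (x : M) : ∃ s : Finset ι, x = ∑ n ∈ s, gradedProj ℳ n x := by
  classical
  refine ⟨(DirectSum.decompose ℳ x).support, ?_⟩
  conv_lhs => rw [← DirectSum.sum_support_decompose ℳ x]
  simp [gradedProj_eq_decompose]

theorem exists_sum_gradedProj_of_subset (x : M) :
    ∃ s : Finset ι, ∀ t, s ⊆ t → x = ∑ n ∈ t, gradedProj ℳ n x := by
  classical
  refine ⟨(DirectSum.decompose ℳ x).support, fun t ht => ?_⟩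
  conv_lhs => rw [← DirectSum.sum_support_decompose ℳ x]
  rw [Finset.sum_subset ht]
  · simp [gradedProj_eq_decompose]
  · intro n _ hn
    simpa using hn

end Graded

theorem neg_one_zpow_eq {a b : ℤ} (c : ℤ) (h : a = b + 2 * c) : (-1 : ℚ) ^ a = (-1) ^ b := by
  rw [h, zpow_add₀ (by norm_num), zpow_mul]
  simp

theorem neg_one_zpow_eq_neg {a b : ℤ} (c : ℤ) (h : a = b + 2 * c + 1) :
    (-1 : ℚ) ^ a = -(-1) ^ b := by
  rw [h, zpow_add_one₀ (by norm_num), neg_one_zpow_eq c rfl, mul_neg_one]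

namespace CDGA

variable (A : CDGA.{u})

/-- The sign automorphism `a ↦ (-1)^{|a|} a`. -/
def sgn : A →ₗ[ℚ] A := gradedScale A.deg fun n => (-1 : ℚ) ^ n

variable {A}

theorem sgn_apply {n : ℕ} {a : A} (ha : a ∈ A.deg n) : A.sgn a = ((-1 : ℚ) ^ n) • a :=
  gradedScale_apply _ _ ha

theorem sgn_mem {n : ℕ} {a : A} (ha : a ∈ A.deg n) : A.sgn a ∈ A.deg n := by
  rw [sgn_apply ha]; exact Submodule.smul_mem _ _ ha

theorem mul_mem_deg {m n k : ℕ} {a b : A} (ha : a ∈ A.deg m) (hb : b ∈ A.deg n) (h : m + n = k) :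
    a * b ∈ A.deg k := h ▸ SetLike.mul_mem_graded ha hb

theorem one_mem_deg : (1 : A) ∈ A.deg 0 := SetLike.one_mem_graded A.deg

theorem pow_mem_deg {m : ℕ} {a : A} (ha : a ∈ A.deg m) (k : ℕ) : a ^ k ∈ A.deg (k * m) := by
  simpa using SetLike.pow_mem_graded k ha

theorem sgn_mul (a b : A) : A.sgn (a * b) = A.sgn a * A.sgn b := by
  refine graded_induction A.deg a (by simp) (fun m a ha => ?_)
    (fun x y hx hy => by simp only [add_mul, map_add, hx, hy])
  refine graded_induction A.deg b (by simp) (fun n b hb => ?_)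
    (fun x y hx hy => by simp only [mul_add, map_add, hx, hy])
  rw [sgn_apply ha, sgn_apply hb, sgn_apply (SetLike.mul_mem_graded ha hb), pow_add,
    smul_mul_smul_comm]

theorem sgn_one : A.sgn 1 = 1 := by rw [sgn_apply one_mem_deg]; simp

theorem sgn_sgn (a : A) : A.sgn (A.sgn a) = a := by
  refine graded_induction A.deg a (by simp) (fun m a ha => ?_)
    (fun x y hx hy => by simp only [map_add, hx, hy])
  rw [sgn_apply ha, map_smul, sgn_apply ha, smul_smul, ← mul_pow]
  simp

theorem sgn_d (a : A) : A.sgn (A.d a) = -A.d (A.sgn a) := by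
  refine graded_induction A.deg a (by simp) (fun m a ha => ?_)
    (fun x y hx hy => by simp only [map_add, hx, hy, neg_add])
  rw [sgn_apply ha, sgn_apply (A.d_mem ha), map_smul, pow_succ, mul_neg_one, neg_smul]

theorem d_mul (a b : A) : A.d (a * b) = A.d a * b + A.sgn a * A.d b := by
  refine graded_induction A.deg a (by simp) (fun m a ha => ?_)
    (fun x y hx hy => by simp only [add_mul, map_add, hx, hy]; abel)
  rw [A.leibniz b ha, sgn_apply ha, smul_mul_assoc]

theorem mul_comm_of_even {m : ℕ} (hm : Even m) {a : A} (ha : a ∈ A.deg m) (b : A) :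
    a * b = b * a := by
  refine graded_induction A.deg b (by simp) (fun n b hb => ?_)
    (fun x y hx hy => by simp only [mul_add, add_mul, hx, hy])
  rw [A.comm ha hb, (hm.mul_right n).neg_one_pow, one_smul]

theorem mul_comm_of_odd {m : ℕ} (hm : Odd m) {a : A} (ha : a ∈ A.deg m) (b : A) :
    a * b = A.sgn b * a := by
  refine graded_induction A.deg b (by simp) (fun n b hb => ?_)
    (fun x y hx hy => by simp only [mul_add, add_mul, map_add, hx, hy])
  rw [A.comm ha hb, sgn_apply hb, pow_mul, hm.neg_one_pow, smul_mul_assoc]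

theorem mul_self_of_odd {m : ℕ} (hm : Odd m) {a : A} (ha : a ∈ A.deg m) : a * a = 0 := by
  have h := mul_comm_of_odd hm ha a
  rw [sgn_apply ha, hm.neg_one_pow, neg_one_smul, neg_mul] at h
  have h2 : (2 : ℚ) • (a * a) = 0 := by
    rw [two_smul]; nth_rewrite 1 [h]; simp
  simpa using h2

theorem gradedProj_d (n : ℕ) (a : A) :
    gradedProj A.deg (n + 1) (A.d a) = A.d (gradedProj A.deg n a) := by
  rw [gradedProj_eq_decompose, gradedProj_eq_decompose, A.decompose_d]

theorem gradedProj_mul_left {m n : ℕ} {a : A} (ha : a ∈ A.deg m) (b : A) :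
    gradedProj A.deg (m + n) (a * b) = a * gradedProj A.deg n b := by
  refine graded_induction A.deg b (by simp) (fun k b hb => ?_)
    (fun x y hx hy => by simp only [mul_add, map_add, hx, hy])
  rcases eq_or_ne k n with rfl | h
  · rw [gradedProj_same _ hb, gradedProj_same _ (SetLike.mul_mem_graded ha hb)]
  · rw [gradedProj_ne _ h hb,
      gradedProj_ne _ (m := m + k) (by omega) (SetLike.mul_mem_graded ha hb),
      mul_zero]

theorem gradedProj_mul_left_of_lt {m n : ℕ} (h : n < m) {a : A} (ha : a ∈ A.deg m) (b : A) :
    gradedProj A.deg n (a * b) = 0 := by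
  refine graded_induction A.deg b (by simp) (fun k b hb => ?_)
    (fun x y hx hy => by simp only [mul_add, map_add, hx, hy, add_zero])
  exact gradedProj_ne _ (by omega : m + k ≠ n) (SetLike.mul_mem_graded ha hb)

namespace Hom

variable {B : CDGA.{v}} {C : CDGA.{w}}

theorem gradedScale_comm (f : Hom A B) (c : ℕ → ℚ) (a : A) :
    gradedScale B.deg c (f.toAlgHom a) = f.toAlgHom (gradedScale A.deg c a) := by
  refine graded_induction A.deg a (by simp) (fun m a ha => ?_)
    (fun x y hx hy => by simp only [map_add, hx, hy])
  rw [gradedScale_apply _ _ ha, gradedScale_apply _ _ (f.map_deg ha), map_smul]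

theorem sgn_comm (f : Hom A B) (a : A) : B.sgn (f.toAlgHom a) = f.toAlgHom (A.sgn a) :=
  f.gradedScale_comm _ a

theorem gradedProj_comm (f : Hom A B) (n : ℕ) (a : A) :
    gradedProj B.deg n (f.toAlgHom a) = f.toAlgHom (gradedProj A.deg n a) :=
  f.gradedScale_comm _ a

/-- The identity morphism. -/
def id (A : CDGA.{u}) : Hom A A where
  toAlgHom := AlgHom.id ℚ A
  map_deg h := h
  map_d _ := rfl

/-- Composition of morphisms. -/
def comp (g : Hom B C) (f : Hom A B) : Hom A C where
  toAlgHom := g.toAlgHom.comp f.toAlgHom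
  map_deg h := g.map_deg (f.map_deg h)
  map_d a := by simp [f.map_d, g.map_d]

theorem onCohomology_cls (f : Hom A B) (z : A.cocycles) :
    f.onCohomology (A.cls z) = B.cls (f.onCocycles z) := rfl

end Hom

theorem cls_eq_zero_iff {z : A.cocycles} : A.cls z = 0 ↔ ∃ y, A.d y = z :=
  Ideal.Quotient.eq_zero_iff_mem

theorem Hom.onCohomology_cls_eq_zero_iff {B : CDGA.{v}} (f : Hom A B) {z : A.cocycles} :
    f.onCohomology (A.cls z) = 0 ↔ ∃ y, B.d y = f.toAlgHom z := by
  rw [f.onCohomology_cls, cls_eq_zero_iff]; rfl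

theorem mem_H_iff {n : ℕ} {x : A.Cohomology} :
    x ∈ A.H n ↔ ∃ z : A.cocycles, (z : A) ∈ A.deg n ∧ A.cls z = x := Iff.rfl

end CDGA

/-! ### Adjoining an odd generator to a commutative DGA -/

/-- The free module `E ⊕ E p` on which the algebra `E ⊗ Λ(p)`, for a generator `p` of odd degree,
is modelled; the pair `⟨x, y⟩` stands for `x + y p`. -/
@[ext] structure AdjoinOdd (E : CDGA.{u}) : Type u where
  fst : E
  snd : E

namespace AdjoinOdd

variable {E : CDGA.{u}}

variable (E) in
/-- The coordinates of `x + y p`. -/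
def equivProd : AdjoinOdd E ≃ E × E where
  toFun s := (s.fst, s.snd)
  invFun s := ⟨s.1, s.2⟩
  left_inv _ := rfl
  right_inv _ := rfl

instance : AddCommGroup (AdjoinOdd E) := (equivProd E).addCommGroup
instance : Module ℚ (AdjoinOdd E) := (equivProd E).module ℚ

variable (E) in
/-- The coordinates of `x + y p`, as a linear equivalence. -/
def linearEquivProd : AdjoinOdd E ≃ₗ[ℚ] E × E := (equivProd E).linearEquiv ℚ

/-- The product `(x + y p) (x' + y' p) = x x' + (x y' + y σ(x')) p`, where `p x' = σ(x') p` for the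
sign automorphism `σ`, and `p² = 0`. -/
instance : Mul (AdjoinOdd E) := ⟨fun s t => ⟨s.1 * t.1, s.1 * t.2 + s.2 * E.sgn t.1⟩⟩
instance : One (AdjoinOdd E) := ⟨⟨1, 0⟩⟩

@[simp] theorem fst_mul (s t : AdjoinOdd E) : (s * t).1 = s.1 * t.1 := rfl
@[simp] theorem snd_mul (s t : AdjoinOdd E) : (s * t).2 = s.1 * t.2 + s.2 * E.sgn t.1 := rfl
@[simp] theorem fst_one : (1 : AdjoinOdd E).1 = 1 := rfl
@[simp] theorem snd_one : (1 : AdjoinOdd E).2 = 0 := rfl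
@[simp] theorem fst_add (s t : AdjoinOdd E) : (s + t).1 = s.1 + t.1 := rfl
@[simp] theorem snd_add (s t : AdjoinOdd E) : (s + t).2 = s.2 + t.2 := rfl
@[simp] theorem fst_zero : (0 : AdjoinOdd E).1 = 0 := rfl
@[simp] theorem snd_zero : (0 : AdjoinOdd E).2 = 0 := rfl
@[simp] theorem fst_smul (r : ℚ) (s : AdjoinOdd E) : (r • s).1 = r • s.1 := rfl
@[simp] theorem snd_smul (r : ℚ) (s : AdjoinOdd E) : (r • s).2 = r • s.2 := rfl

instance : Ring (AdjoinOdd E) where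
  __ : AddCommGroup (AdjoinOdd E) := inferInstance
  left_distrib a b c := by ext <;> simp [mul_add]; abel
  right_distrib a b c := by ext <;> simp [add_mul]; abel
  zero_mul a := by ext <;> simp
  mul_zero a := by ext <;> simp
  mul_assoc a b c := by ext <;> simp [mul_assoc, mul_add, add_mul, CDGA.sgn_mul, add_assoc]
  one_mul a := by ext <;> simp
  mul_one a := by ext <;> simp [CDGA.sgn_one]

instance : Algebra ℚ (AdjoinOdd E) :=
  Algebra.ofModule (fun r s t => by ext <;> simp) (fun r s t => by ext <;> simp)

variable (E) in
/-- The inclusion `E ⊆ E ⊗ Λ(p)`. -/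
def inl : E →ₐ[ℚ] AdjoinOdd E :=
  AlgHom.ofLinearMap ((linearEquivProd E).symm.toLinearMap ∘ₗ LinearMap.inl ℚ E E) rfl
    (fun x y => by
      ext
      · rfl
      · change (0 : E) = x * 0 + 0 * _
        simp)

@[simp] theorem fst_inl (x : E) : (inl E x).1 = x := rfl
@[simp] theorem snd_inl (x : E) : (inl E x).2 = 0 := rfl

/-- The generator `p`. -/
def p : AdjoinOdd E := ⟨0, 1⟩

@[simp] theorem fst_p : (p : AdjoinOdd E).1 = 0 := rfl
@[simp] theorem snd_p : (p : AdjoinOdd E).2 = 1 := rfl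

theorem eq_inl_add_inl_mul_p (s : AdjoinOdd E) : s = inl E s.1 + inl E s.2 * p := by
  ext <;> simp

variable (E) in
/-- The elements `y` for which `y p` has degree `k`, where `p` has degree `m`. -/
def shiftDeg (m k : ℕ) : Submodule ℚ E := if m ≤ k then E.deg (k - m) else ⊥

theorem mem_shiftDeg {m k : ℕ} {y : E} :
    y ∈ shiftDeg E m k ↔ y = 0 ∨ ∃ j, k = j + m ∧ y ∈ E.deg j := by
  unfold shiftDeg
  split_ifs with h
  · constructor
    · exact fun hy => Or.inr ⟨k - m, by omega, hy⟩
    · rintro (rfl | ⟨j, rfl, hy⟩)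
      · exact zero_mem _
      · simpa using hy
  · rw [Submodule.mem_bot]
    refine ⟨Or.inl, ?_⟩
    rintro (rfl | ⟨j, rfl, hy⟩)
    · rfl
    · omega

variable (E) in
/-- The elements of degree `k` of `E ⊗ Λ(p)`, where `p` has degree `m`. -/
def deg (m k : ℕ) : Submodule ℚ (AdjoinOdd E) where
  carrier := {s | s.fst ∈ E.deg k ∧ s.snd ∈ shiftDeg E m k}
  add_mem' hs ht := ⟨add_mem hs.1 ht.1, add_mem hs.2 ht.2⟩
  zero_mem' := ⟨zero_mem _, zero_mem _⟩
  smul_mem' r _ hs := ⟨Submodule.smul_mem _ r hs.1, Submodule.smul_mem _ r hs.2⟩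

/-- The projection of `E` onto the part of degree `k - m`. -/
def shiftProj (E : CDGA.{u}) (m k : ℕ) : E →ₗ[ℚ] E :=
  if m ≤ k then gradedProj E.deg (k - m) else 0

@[reducible]
def decomposition (m : ℕ) : DirectSum.Decomposition (deg E m) :=
  decompositionOfProj _ (fun k => (linearEquivProd E).symm.toLinearMap ∘ₗ
      (gradedProj E.deg k).prodMap (shiftProj E m k) ∘ₗ (linearEquivProd E).toLinearMap)
    (by
      intro k s
      refine ⟨gradedProj_mem _ _ _, ?_⟩
      change shiftProj E m k s.2 ∈ shiftDeg E m k
      unfold shiftProj shiftDeg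
      split_ifs
      · exact gradedProj_mem _ _ _
      · simp)
    (by
      rintro k s ⟨h1, h2⟩
      ext
      · exact gradedProj_same _ h1
      · change shiftProj E m k s.2 = s.2
        obtain h | ⟨j, rfl, hj⟩ := mem_shiftDeg.1 h2
        · rw [h]; simp
        · simp [shiftProj, gradedProj_same _ hj])
    (by
      rintro k l hkl s ⟨h1, h2⟩
      ext
      · exact gradedProj_ne _ hkl h1
      · change shiftProj E m l s.2 = 0
        obtain h | ⟨j, rfl, hj⟩ := mem_shiftDeg.1 h2
        · rw [h]; simp
        · unfold shiftProj
          split_ifs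
          · exact gradedProj_ne _ (by omega) hj
          · rfl)
    (by
      intro s
      obtain ⟨t1, h1⟩ := exists_sum_gradedProj_of_subset E.deg s.1
      obtain ⟨t2, h2⟩ := exists_sum_gradedProj E.deg s.2
      refine ⟨t1 ∪ t2.image (· + m), ?_⟩
      have e2 : s.2 = ∑ k ∈ t1 ∪ t2.image (· + m), shiftProj E m k s.2 := by
        have hz : ∀ k, k ∉ t2.image (· + m) → shiftProj E m k s.2 = 0 := by
          intro k hk
          unfold shiftProj
          split_ifs with hmk
          · have : k - m ∉ t2 := fun hh => hk (Finset.mem_image.2 ⟨_, hh, by omega⟩)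
            rw [h2, map_sum]
            refine Finset.sum_eq_zero fun n hn => ?_
            exact gradedProj_ne _ (fun e : n = k - m => this (e ▸ hn)) (gradedProj_mem _ _ _)
          · rfl
        rw [← Finset.sum_subset Finset.subset_union_right fun k _ hk => hz k hk,
          Finset.sum_image (fun a _ b _ h => by simpa using h)]
        conv_lhs => rw [h2]
        exact Finset.sum_congr rfl fun n _ => by simp [shiftProj]
      have e1 := h1 (t1 ∪ t2.image (· + m)) Finset.subset_union_left
      apply (linearEquivProd E).injective
      rw [map_sum]
      exact Prod.ext (by rw [Prod.fst_sum]; exact e1) (by rw [Prod.snd_sum]; exact e2))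

theorem mul_mem_deg {m k l : ℕ} {s t : AdjoinOdd E} (hs : s ∈ deg E m k) (ht : t ∈ deg E m l) :
    s * t ∈ deg E m (k + l) := by
  obtain ⟨s1, s2⟩ := hs
  obtain ⟨t1, t2⟩ := ht
  refine ⟨CDGA.mul_mem_deg s1 t1 rfl, Submodule.add_mem _ ?_ ?_⟩
  · obtain h | ⟨j, rfl, hj⟩ := mem_shiftDeg.1 t2
    · rw [h]; simp
    · exact mem_shiftDeg.2 (Or.inr ⟨k + j, by omega, CDGA.mul_mem_deg s1 hj rfl⟩)
  · obtain h | ⟨j, rfl, hj⟩ := mem_shiftDeg.1 s2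
    · rw [h]; simp
    · exact mem_shiftDeg.2 (Or.inr ⟨j + l, by omega, CDGA.mul_mem_deg hj (CDGA.sgn_mem t1) rfl⟩)

/-- The differential `d (x + y p) = (d x + σ(y) b) + d y p`, so that `d p = b`. -/
def d (b : E) : AdjoinOdd E →ₗ[ℚ] AdjoinOdd E :=
  (linearEquivProd E).symm.toLinearMap ∘ₗ
    ((E.d.coprod ((LinearMap.mulRight ℚ b).comp E.sgn)).prod (E.d.comp (LinearMap.snd ℚ E E))) ∘ₗ
      (linearEquivProd E).toLinearMap

@[simp] theorem fst_d (b : E) (s : AdjoinOdd E) : (d b s).1 = E.d s.1 + E.sgn s.2 * b := rfl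
@[simp] theorem snd_d (b : E) (s : AdjoinOdd E) : (d b s).2 = E.d s.2 := rfl

theorem sgn_snd {m k : ℕ} (hm : Odd m) {y : E} (hy : y ∈ shiftDeg E m k) :
    E.sgn y = -((-1 : ℚ) ^ k • y) := by
  obtain rfl | ⟨j, rfl, hj⟩ := mem_shiftDeg.1 hy
  · simp
  · rw [CDGA.sgn_apply hj, pow_add, hm.neg_one_pow]; simp

end AdjoinOdd

/-- The commutative DGA `E ⊗ Λ(p)` with `p` of odd degree `m` and `d p = b`, for a cocycle `b` of
`E`. -/
def CDGA.adjoinOdd (E : CDGA.{u}) {m : ℕ} (hm : Odd m) {b : E} (hb : b ∈ E.deg (m + 1))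
    (hdb : E.d b = 0) : CDGA.{u} where
  carrier := AdjoinOdd E
  deg := AdjoinOdd.deg E m
  graded :=
    { AdjoinOdd.decomposition m with
      one_mem := ⟨CDGA.one_mem_deg, zero_mem _⟩
      mul_mem := fun _ _ _ _ => AdjoinOdd.mul_mem_deg }
  d := AdjoinOdd.d b
  d_mem := by
    rintro n s ⟨h1, h2⟩
    obtain h | ⟨j, rfl, hj⟩ := AdjoinOdd.mem_shiftDeg.1 h2
    · exact ⟨by simpa [h] using E.d_mem h1, by simp [h]⟩
    · refine ⟨Submodule.add_mem _ (E.d_mem h1) ?_, ?_⟩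
      · exact CDGA.mul_mem_deg (CDGA.sgn_mem hj) hb (by omega)
      · exact AdjoinOdd.mem_shiftDeg.2 (Or.inr ⟨j + 1, by omega, E.d_mem hj⟩)
  d_d s := by
    ext
    · simp [E.d_d, CDGA.d_mul, hdb, CDGA.sgn_d]
    · simp [E.d_d]
  comm := by
    rintro k l s t ⟨s1, s2⟩ ⟨t1, t2⟩
    have hmm : (-1 : ℚ) ^ m = -1 := hm.neg_one_pow
    ext
    · exact E.comm s1 t1
    · simp only [AdjoinOdd.snd_mul, AdjoinOdd.snd_smul, smul_add]
      rw [add_comm]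
      congr 1
      · obtain h | ⟨j, rfl, hj⟩ := AdjoinOdd.mem_shiftDeg.1 s2
        · simp [h]
        · rw [E.comm hj (CDGA.sgn_mem t1), CDGA.sgn_apply t1, smul_mul_assoc, smul_smul,
            add_mul, pow_add, pow_mul _ m, hmm]
      · obtain h | ⟨j, rfl, hj⟩ := AdjoinOdd.mem_shiftDeg.1 t2
        · simp [h]
        · rw [E.comm s1 hj, CDGA.sgn_apply s1, mul_smul_comm, smul_smul, mul_add, mul_comm k m,
            pow_add, pow_mul _ m, hmm, mul_assoc, ← mul_pow]
          simp
  leibniz := by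
    rintro k s t ⟨s1, s2⟩
    have hs1 := CDGA.sgn_apply s1
    have hs2 := AdjoinOdd.sgn_snd hm s2
    have hs2' : (-1 : ℚ) ^ k • s.2 = -E.sgn s.2 := by rw [hs2, neg_neg]
    have hev : Even (m + 1) := hm.add_one
    have hbs : E.sgn b = b := by rw [CDGA.sgn_apply hb, hev.neg_one_pow, one_smul]
    ext
    · simp only [AdjoinOdd.fst_d, AdjoinOdd.fst_mul, AdjoinOdd.snd_mul, AdjoinOdd.fst_add,
        AdjoinOdd.fst_smul, CDGA.d_mul, map_add, CDGA.sgn_mul, CDGA.sgn_sgn, add_mul, mul_add,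
        ← smul_mul_assoc, ← hs1]
      rw [mul_assoc (E.sgn s.2) b, CDGA.mul_comm_of_even hev hb t.1]
      simp only [mul_assoc]
      abel
    · simp only [AdjoinOdd.snd_d, AdjoinOdd.fst_d, AdjoinOdd.snd_mul,
        AdjoinOdd.snd_add, AdjoinOdd.snd_smul, AdjoinOdd.fst_smul, CDGA.d_mul, map_add,
        CDGA.sgn_mul, CDGA.sgn_sgn,
        add_mul, mul_add, ← smul_mul_assoc, ← hs1, hs2', CDGA.sgn_d, hbs]
      rw [mul_assoc (E.sgn s.2) b, CDGA.mul_comm_of_even hev hb t.2]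
      simp only [neg_mul, mul_neg, neg_neg]
      abel

/-- The inclusion of `E` into `E ⊗ Λ(p)`. -/
def CDGA.adjoinOddIncl (E : CDGA.{u}) {m : ℕ} (hm : Odd m) {b : E} (hb : b ∈ E.deg (m + 1))
    (hdb : E.d b = 0) : CDGA.Hom E (E.adjoinOdd hm hb hdb) where
  toAlgHom := AdjoinOdd.inl E
  map_deg h := ⟨h, zero_mem _⟩
  map_d a := by
    change AdjoinOdd.inl E _ = AdjoinOdd.d b (AdjoinOdd.inl E a)
    ext <;> simp

/-- The generator `p` of `E ⊗ Λ(p)`. -/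
def CDGA.adjoinOddGen (E : CDGA.{u}) {m : ℕ} (hm : Odd m) {b : E} (hb : b ∈ E.deg (m + 1))
    (hdb : E.d b = 0) : E.adjoinOdd hm hb hdb := (AdjoinOdd.p : AdjoinOdd E)

theorem CDGA.adjoinOddGen_mem (E : CDGA.{u}) {m : ℕ} (hm : Odd m) {b : E} (hb : b ∈ E.deg (m + 1))
    (hdb : E.d b = 0) : E.adjoinOddGen hm hb hdb ∈ (E.adjoinOdd hm hb hdb).deg m :=
  ⟨zero_mem _, AdjoinOdd.mem_shiftDeg.2 (Or.inr ⟨0, by omega, CDGA.one_mem_deg⟩)⟩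

theorem CDGA.adjoinOdd_d_gen (E : CDGA.{u}) {m : ℕ} (hm : Odd m) {b : E} (hb : b ∈ E.deg (m + 1))
    (hdb : E.d b = 0) : (E.adjoinOdd hm hb hdb).d (E.adjoinOddGen hm hb hdb) =
      (E.adjoinOddIncl hm hb hdb).toAlgHom b := by
  change AdjoinOdd.d b AdjoinOdd.p = AdjoinOdd.inl E b
  ext <;> simp [CDGA.sgn_one, E.d_one]

/-! ### Fibrations with an additional generator of odd degree -/

namespace FreeGradedComm

variable {V : Type w} [AddCommGroup V] [Module ℚ V] (𝒱 : ℕ → Submodule ℚ V)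

/-- The inclusion `V ⊆ ΛV`. -/
def of : V →ₗ[ℚ] FreeGradedComm 𝒱 :=
  (RingQuot.mkAlgHom ℚ (Rel 𝒱)).toLinearMap ∘ₗ TensorAlgebra.ι ℚ

variable {𝒱}

theorem of_mul_of {i j : ℕ} {v w : V} (hv : v ∈ 𝒱 i) (hw : w ∈ 𝒱 j) :
    of 𝒱 v * of 𝒱 w = ((-1 : ℚ) ^ (i * j)) • (of 𝒱 w * of 𝒱 v) := by
  have := RingQuot.mkAlgHom_rel ℚ (Rel.swap hv hw)
  simpa [of] using this

theorem eq_top_of_of_mem {S : Subalgebra ℚ (FreeGradedComm 𝒱)} (h : ∀ v, of 𝒱 v ∈ S) : S = ⊤ := by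
  rw [eq_top_iff]
  rintro x -
  obtain ⟨t, rfl⟩ := RingQuot.mkAlgHom_surjective ℚ (Rel 𝒱) x
  have : (⊤ : Subalgebra ℚ (TensorAlgebra ℚ V)) ≤ S.comap (RingQuot.mkAlgHom ℚ (Rel 𝒱)) := by
    rw [← TensorAlgebra.adjoin_range_ι, Algebra.adjoin_le_iff]
    rintro _ ⟨v, rfl⟩
    exact h v
  exact this (show t ∈ ⊤ from trivial)

theorem lift_of {E : CDGA.{u}} (g : V →ₗ[ℚ] E)
    (hg : ∀ {k : ℕ} {v : V}, v ∈ 𝒱 k → g v ∈ E.deg k) (v : V) : lift 𝒱 g hg (of 𝒱 v) = g v :=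
  lift_ι 𝒱 g hg v

/-- The algebra morphism `ΛV → ΛW` induced by a degree-preserving linear map `V → W`. -/
def map {W : Type v} [AddCommGroup W] [Module ℚ W] {𝒲 : ℕ → Submodule ℚ W} (f : V →ₗ[ℚ] W)
    (hf : ∀ k, ∀ v ∈ 𝒱 k, f v ∈ 𝒲 k) : FreeGradedComm 𝒱 →ₐ[ℚ] FreeGradedComm 𝒲 :=
  RingQuot.liftAlgHom ℚ ⟨TensorAlgebra.lift ℚ (of 𝒲 ∘ₗ f), by
    rintro _ _ ⟨hv, hw⟩
    simp only [map_mul, map_smul, TensorAlgebra.lift_ι_apply]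
    exact of_mul_of (hf _ _ hv) (hf _ _ hw)⟩

theorem map_of {W : Type v} [AddCommGroup W] [Module ℚ W] {𝒲 : ℕ → Submodule ℚ W} (f : V →ₗ[ℚ] W)
    (hf : ∀ k, ∀ v ∈ 𝒱 k, f v ∈ 𝒲 k) (v : V) : map f hf (of 𝒱 v) = of 𝒲 (f v) := by
  simp [map, of]

variable (𝒱) in
/-- The augmentation `ΛV → ℚ`. -/
def augmentation : FreeGradedComm 𝒱 →ₐ[ℚ] ℚ :=
  RingQuot.liftAlgHom ℚ ⟨TensorAlgebra.lift ℚ (0 : V →ₗ[ℚ] ℚ), by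
    rintro _ _ ⟨hv, hw⟩
    simp⟩

/-- The grading of `V × ℚ` with the second summand in degree `m`. -/
def prodDeg (𝒱 : ℕ → Submodule ℚ V) (m k : ℕ) : Submodule ℚ (V × ℚ) :=
  (𝒱 k).prod (if k = m then ⊤ else ⊥)

theorem inl_mem_prodDeg {m k : ℕ} {v : V} (hv : v ∈ 𝒱 k) : (v, (0 : ℚ)) ∈ prodDeg 𝒱 m k :=
  ⟨hv, zero_mem _⟩

/-- The inclusion `ΛV ⊆ Λ(V ⊕ ℚ p)`. -/
def inl (𝒱 : ℕ → Submodule ℚ V) (m : ℕ) : FreeGradedComm 𝒱 →ₐ[ℚ] FreeGradedComm (prodDeg 𝒱 m) :=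
  map (LinearMap.inl ℚ V ℚ) fun _ _ => inl_mem_prodDeg

theorem inl_of (m : ℕ) (v : V) : inl 𝒱 m (of 𝒱 v) = of (prodDeg 𝒱 m) (v, 0) :=
  map_of _ _ v

theorem inr_mem_prodDeg (m : ℕ) (r : ℚ) : ((0 : V), r) ∈ prodDeg 𝒱 m m :=
  ⟨zero_mem _, by simp⟩

@[reducible]
def prodDegDecomposition (𝒱 : ℕ → Submodule ℚ V) [DirectSum.Decomposition 𝒱] (m : ℕ) :
    DirectSum.Decomposition (prodDeg 𝒱 m) :=
  decompositionOfProj _ (fun k => (gradedProj 𝒱 k).prodMap (if k = m then LinearMap.id else 0))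
    (by
      intro k x
      refine ⟨gradedProj_mem _ _ _, ?_⟩
      by_cases h : k = m <;> simp [h])
    (by
      rintro k ⟨v, r⟩ ⟨h1, h2⟩
      refine Prod.ext (gradedProj_same _ h1) ?_
      by_cases h : k = m
      · simp [h]
      · simpa [h, eq_comm] using h2)
    (by
      rintro k l hkl ⟨v, r⟩ ⟨h1, h2⟩
      refine Prod.ext (gradedProj_ne _ hkl h1) ?_
      by_cases h : k = m
      · subst h
        simp [hkl.symm]
      · have : r = 0 := by simpa [h] using h2
        simp [this])
    (by
      rintro ⟨v, r⟩
      obtain ⟨s, hs⟩ := exists_sum_gradedProj_of_subset 𝒱 v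
      refine ⟨insert m s, Prod.ext ?_ ?_⟩
      · rw [Prod.fst_sum]
        exact hs _ (Finset.subset_insert _ _)
      · rw [Prod.snd_sum]
        rw [Finset.sum_eq_single m] <;> simp +contextual)

/-- `Λ(V ⊕ ℚ p)` is spanned by `ΛV` and `ΛV · p` if `p` has odd degree. -/
theorem exists_eq_map_add_map_mul [DirectSum.Decomposition 𝒱] {m : ℕ} (hm : Odd m)
    (x : FreeGradedComm (prodDeg 𝒱 m)) :
    ∃ y z : FreeGradedComm 𝒱,
      x = inl 𝒱 m y + inl 𝒱 m z * of (prodDeg 𝒱 m) (0, 1) := by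
  set i := inl 𝒱 m with hi
  set q := of (prodDeg 𝒱 m) (0, 1) with hq
  have hqq : q * q = 0 := by
    have h := of_mul_of (inr_mem_prodDeg (𝒱 := 𝒱) m 1) (inr_mem_prodDeg m 1)
    rw [← hq, (hm.mul hm).neg_one_pow] at h
    replace h := h.trans (neg_one_smul ℚ (q * q))
    have h2 : (2 : ℚ) • (q * q) = 0 := by
      rw [two_smul]; nth_rewrite 1 [h]; simp
    simpa using h2
  -- `p` can be moved past every element of `ΛV`
  have hcomm : ∀ x, ∃ x', q * i x = i x' * q := by
    let S : Subalgebra ℚ (FreeGradedComm 𝒱) :=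
      { carrier := {x | ∃ x', q * i x = i x' * q}
        mul_mem' := by
          rintro a b ⟨a', ha⟩ ⟨b', hb⟩
          exact ⟨a' * b', by rw [map_mul, ← mul_assoc, ha, mul_assoc, hb, map_mul, mul_assoc]⟩
        add_mem' := by
          rintro a b ⟨a', ha⟩ ⟨b', hb⟩
          exact ⟨a' + b', by rw [map_add, mul_add, ha, hb, map_add, add_mul]⟩
        algebraMap_mem' := fun r => ⟨algebraMap ℚ _ r, by
          rw [AlgHom.commutes, Algebra.commutes]⟩ }
    have hS : S = ⊤ := eq_top_of_of_mem fun v => by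
      refine graded_induction 𝒱 v ?_ (fun k v hv => ?_) (fun x y hx hy => ?_)
      · rw [map_zero]; exact zero_mem _
      · refine ⟨((-1 : ℚ) ^ (m * k)) • of 𝒱 v, ?_⟩
        rw [map_smul, hi, inl_of, hq, of_mul_of (inr_mem_prodDeg m 1) (inl_mem_prodDeg hv),
          smul_mul_assoc]
      · rw [map_add]; exact add_mem hx hy
    intro x
    have : x ∈ S := hS ▸ trivial
    exact this
  let S : Subalgebra ℚ (FreeGradedComm (prodDeg 𝒱 m)) :=
    { carrier := {x | ∀ y z, ∃ y' z', x * (i y + i z * q) = i y' + i z' * q}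
      mul_mem' := by
        intro a b ha hb y z
        obtain ⟨y', z', h⟩ := hb y z
        obtain ⟨y'', z'', h'⟩ := ha y' z'
        exact ⟨y'', z'', by rw [mul_assoc, h, h']⟩
      add_mem' := by
        intro a b ha hb y z
        obtain ⟨y', z', h⟩ := hb y z
        obtain ⟨y'', z'', h'⟩ := ha y z
        exact ⟨y'' + y', z'' + z', by
          rw [add_mul, h, h', map_add, map_add, add_mul]; abel⟩
      algebraMap_mem' := fun r y z => ⟨r • y, r • z, by
        rw [← Algebra.smul_def, map_smul, map_smul, smul_add, smul_mul_assoc]⟩ }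
  have hS : S = ⊤ := eq_top_of_of_mem fun ⟨v, r⟩ y z => by
    obtain ⟨y', hy⟩ := hcomm y
    obtain ⟨z', hz⟩ := hcomm z
    have hv : of (prodDeg 𝒱 m) (v, r) = i (of 𝒱 v) + r • q := by
      rw [hi, inl_of, hq, ← map_smul, ← map_add]
      simp
    refine ⟨of 𝒱 v * y, of 𝒱 v * z + r • y', ?_⟩
    have hzq : q * (i z * q) = 0 := by rw [← mul_assoc, hz, mul_assoc, hqq, mul_zero]
    rw [hv, add_mul, mul_add, smul_mul_assoc, mul_add, hzq, hy, add_zero, map_mul, map_add,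
      map_mul, map_smul, add_mul, smul_mul_assoc, mul_assoc, add_assoc]
  have hx : x ∈ S := hS ▸ trivial
  obtain ⟨y, z, h⟩ := hx 1 0
  exact ⟨y, z, by simpa using h⟩

end FreeGradedComm

namespace AlgebraicFibration

variable {A : CDGA.{u}} (F : AlgebraicFibration.{u, w} A)

/-- The multiplication map `A ⊗ ΛV → E`. -/
abbrev mulMap : A ⊗[ℚ] FreeGradedComm F.degV →ₗ[ℚ] F.total :=
  TensorProduct.lift ((LinearMap.mul ℚ F.total).compl₁₂ F.incl.toAlgHom.toLinearMap
    (FreeGradedComm.lift F.degV F.gen F.gen_mem).toLinearMap)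

/-- The subalgebra of the total space generated by `A` and `V(n)`. -/
abbrev stage (n : ℕ) : Subalgebra ℚ F.total :=
  Algebra.adjoin ℚ ((F.incl.toAlgHom.range : Set F.total) ∪ F.gen '' (F.filt n : Set F.V))

theorem stage_mono : Monotone F.stage := fun _ _ h =>
  Algebra.adjoin_mono (Set.union_subset_union_right _ (Set.image_mono (F.filt_mono h)))

theorem incl_mem_stage (a : A) (n : ℕ) : F.incl.toAlgHom a ∈ F.stage n :=
  Algebra.subset_adjoin (Or.inl ⟨a, rfl⟩)

theorem gen_mem_stage {n : ℕ} {v : F.V} (hv : v ∈ F.filt n) : F.gen v ∈ F.stage n :=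
  Algebra.subset_adjoin (Or.inr ⟨v, hv, rfl⟩)

theorem exists_mem_stage (x : F.total) : ∃ n, x ∈ F.stage n := by
  suffices h : x ∈ ⨆ n, F.stage n by
    rw [← SetLike.mem_coe, Subalgebra.coe_iSup_of_directed F.stage_mono.directed_le] at h
    simpa using h
  obtain ⟨t, rfl⟩ := F.bijective.2 x
  induction t with
  | zero => rw [map_zero]; exact zero_mem _
  | add x y hx hy => rw [map_add]; exact add_mem hx hy
  | tmul a g =>
    refine mul_mem ?_ ?_
    · exact le_iSup F.stage 0 (F.incl_mem_stage a 0)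
    · have : (⨆ n, F.stage n).comap (FreeGradedComm.lift F.degV F.gen F.gen_mem) = ⊤ := by
        refine FreeGradedComm.eq_top_of_of_mem fun v => ?_
        rw [Subalgebra.mem_comap, FreeGradedComm.lift_of]
        obtain ⟨n, hn⟩ := F.filt_exhausts v
        exact le_iSup F.stage n (F.gen_mem_stage hn)
      have hg : g ∈ (⨆ n, F.stage n).comap (FreeGradedComm.lift F.degV F.gen F.gen_mem) :=
        this ▸ trivial
      exact hg

variable {m : ℕ} (hm : Odd m) {b : F.total} (hb : b ∈ F.total.deg (m + 1))
  (hdb : F.total.d b = 0)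

/-- The map `V ⊕ ℚ p → E ⊗ Λ(p)`. -/
def adjoinGen : F.V × ℚ →ₗ[ℚ] F.total.adjoinOdd hm hb hdb :=
  ((F.total.adjoinOddIncl hm hb hdb).toAlgHom.toLinearMap ∘ₗ F.gen).coprod
    (LinearMap.toSpanSingleton ℚ _ (F.total.adjoinOddGen hm hb hdb))

theorem adjoinGen_mem {k : ℕ} {x : F.V × ℚ} (hx : x ∈ FreeGradedComm.prodDeg F.degV m k) :
    F.adjoinGen hm hb hdb x ∈ (F.total.adjoinOdd hm hb hdb).deg k := by
  refine add_mem ((F.total.adjoinOddIncl hm hb hdb).map_deg (F.gen_mem hx.1)) ?_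
  have h2 := hx.2
  by_cases h : k = m
  · subst h
    exact Submodule.smul_mem _ _ (F.total.adjoinOddGen_mem hm hb hdb)
  · have : x.2 = 0 := by simpa [h] using h2
    rw [LinearMap.comp_apply, LinearMap.snd_apply, this, map_zero]
    exact zero_mem _

theorem adjoinGen_inl (v : F.V) : F.adjoinGen hm hb hdb (v, 0) =
    (F.total.adjoinOddIncl hm hb hdb).toAlgHom (F.gen v) := by
  simp [adjoinGen]

theorem adjoinGen_inr (r : ℚ) : F.adjoinGen hm hb hdb (0, r) =
    r • F.total.adjoinOddGen hm hb hdb := by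
  simp [adjoinGen]

theorem lift_adjoinGen_map (g : FreeGradedComm F.degV) :
    FreeGradedComm.lift (FreeGradedComm.prodDeg F.degV m) (F.adjoinGen hm hb hdb)
      (F.adjoinGen_mem hm hb hdb) (FreeGradedComm.inl F.degV m g) =
    (F.total.adjoinOddIncl hm hb hdb).toAlgHom
      (FreeGradedComm.lift F.degV F.gen F.gen_mem g) := by
  let S := AlgHom.equalizer
    ((FreeGradedComm.lift (FreeGradedComm.prodDeg F.degV m) (F.adjoinGen hm hb hdb)
      (F.adjoinGen_mem hm hb hdb)).comp (FreeGradedComm.inl F.degV m))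
    ((F.total.adjoinOddIncl hm hb hdb).toAlgHom.comp
      (FreeGradedComm.lift F.degV F.gen F.gen_mem))
  have hS : S = ⊤ := FreeGradedComm.eq_top_of_of_mem fun v => by
    rw [AlgHom.mem_equalizer]
    rw [AlgHom.comp_apply, AlgHom.comp_apply, FreeGradedComm.inl_of, FreeGradedComm.lift_of,
      FreeGradedComm.lift_of]
    exact F.adjoinGen_inl hm hb hdb v
  have hg : g ∈ S := hS ▸ trivial
  exact hg

theorem adjoin_bijective : Function.Bijective
    (TensorProduct.lift ((LinearMap.mul ℚ (F.total.adjoinOdd hm hb hdb)).compl₁₂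
      ((F.total.adjoinOddIncl hm hb hdb).comp F.incl).toAlgHom.toLinearMap
      (FreeGradedComm.lift (FreeGradedComm.prodDeg F.degV m) (F.adjoinGen hm hb hdb)
        (F.adjoinGen_mem hm hb hdb)).toLinearMap) :
      A ⊗[ℚ] FreeGradedComm (FreeGradedComm.prodDeg F.degV m) →ₗ[ℚ]
        F.total.adjoinOdd hm hb hdb) := by
  set Φ := TensorProduct.lift ((LinearMap.mul ℚ (F.total.adjoinOdd hm hb hdb)).compl₁₂
      ((F.total.adjoinOddIncl hm hb hdb).comp F.incl).toAlgHom.toLinearMap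
      (FreeGradedComm.lift (FreeGradedComm.prodDeg F.degV m) (F.adjoinGen hm hb hdb)
        (F.adjoinGen_mem hm hb hdb)).toLinearMap) with hΦ
  set i := FreeGradedComm.inl F.degV m with hi
  set q := FreeGradedComm.of (FreeGradedComm.prodDeg F.degV m) (0, 1) with hq
  -- `A ⊗ Λ(V ⊕ ℚ p)` is the image of two copies of `A ⊗ ΛV`
  let Ψ1 := i.toLinearMap.lTensor A
  let Ψ2 := ((LinearMap.mulRight ℚ q) ∘ₗ i.toLinearMap).lTensor A
  have hΨ : ∀ x, ∃ s t, x = Ψ1 s + Ψ2 t := by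
    intro x
    induction x with
    | zero => exact ⟨0, 0, by simp⟩
    | add x y hx hy =>
      obtain ⟨s, t, rfl⟩ := hx
      obtain ⟨s', t', rfl⟩ := hy
      exact ⟨s + s', t + t', by rw [map_add, map_add]; abel⟩
    | tmul a g =>
      obtain ⟨y, z, rfl⟩ := FreeGradedComm.exists_eq_map_add_map_mul hm g
      exact ⟨a ⊗ₜ y, a ⊗ₜ z, by simp [Ψ1, Ψ2, TensorProduct.tmul_add, hi, hq]⟩
  have h1 : ∀ s, Φ (Ψ1 s) = (F.total.adjoinOddIncl hm hb hdb).toAlgHom (F.mulMap s) := by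
    intro s
    induction s with
    | zero => simp
    | add x y hx hy => simp only [map_add, hx, hy]
    | tmul a g =>
      simp only [hΦ, Ψ1, LinearMap.lTensor_tmul, TensorProduct.lift.tmul, LinearMap.compl₁₂_apply,
        LinearMap.mul_apply', AlgHom.toLinearMap_apply, map_mul]
      rw [hi, F.lift_adjoinGen_map hm hb hdb]
      rfl
  have h2 : ∀ s, Φ (Ψ2 s) = (F.total.adjoinOddIncl hm hb hdb).toAlgHom (F.mulMap s) *
      F.total.adjoinOddGen hm hb hdb := by
    intro s
    induction s with
    | zero => simp
    | add x y hx hy => simp only [map_add, hx, hy, add_mul]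
    | tmul a g =>
      simp only [hΦ, Ψ2, LinearMap.lTensor_tmul, TensorProduct.lift.tmul, LinearMap.compl₁₂_apply,
        LinearMap.mul_apply', AlgHom.toLinearMap_apply, map_mul, LinearMap.comp_apply,
        LinearMap.mulRight_apply]
      rw [hi, F.lift_adjoinGen_map hm hb hdb, hq, FreeGradedComm.lift_of,
        F.adjoinGen_inr hm hb hdb, one_smul, mul_assoc]
      rfl
  have h3 : ∀ s t, Φ (Ψ1 s + Ψ2 t) = (⟨F.mulMap s, F.mulMap t⟩ : AdjoinOdd F.total) := by
    intro s t
    rw [map_add, h1, h2]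
    exact (AdjoinOdd.eq_inl_add_inl_mul_p (⟨F.mulMap s, F.mulMap t⟩ : AdjoinOdd F.total)).symm
  constructor
  · intro x x' h
    obtain ⟨s, t, rfl⟩ := hΨ x
    obtain ⟨s', t', rfl⟩ := hΨ x'
    rw [h3, h3] at h
    have e := AdjoinOdd.ext_iff.1 h
    rw [F.bijective.1 e.1, F.bijective.1 e.2]
  · intro e
    obtain ⟨s, hs⟩ := F.bijective.2 (AdjoinOdd.fst e)
    obtain ⟨t, ht⟩ := F.bijective.2 (AdjoinOdd.snd e)
    exact ⟨Ψ1 s + Ψ2 t, (h3 s t).trans (AdjoinOdd.ext hs ht)⟩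

/-- The fibration `A ⊗ Λ(V ⊕ ℚ p)` with an additional generator `p` of odd degree whose differential
is a given cocycle `b`. -/
def adjoin : AlgebraicFibration.{u, w} A :=
  letI n₀ := (F.exists_mem_stage b).choose
  { V := F.V × ℚ
    degV := FreeGradedComm.prodDeg F.degV m
    decomposition := FreeGradedComm.prodDegDecomposition F.degV m
    degV_zero := by
      have : (0 : ℕ) ≠ m := fun h => by subst h; simp at hm
      simp [FreeGradedComm.prodDeg, F.degV_zero, this]
    total := F.total.adjoinOdd hm hb hdb
    incl := (F.total.adjoinOddIncl hm hb hdb).comp F.incl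
    gen := F.adjoinGen hm hb hdb
    gen_mem := F.adjoinGen_mem hm hb hdb
    bijective := F.adjoin_bijective hm hb hdb
    filt := fun n => (F.filt n).prod (if n₀ < n then ⊤ else ⊥)
    filt_mono := by
      intro n n' h
      refine Submodule.prod_mono (F.filt_mono h) ?_
      split_ifs
      · rfl
      · omega
      · exact bot_le
      · rfl
    filt_graded := by
      let := FreeGradedComm.prodDegDecomposition F.degV m
      rintro n ⟨v, r⟩ ⟨h1, h2⟩ k
      have key : ∀ x : F.V × ℚ, (DirectSum.decompose (FreeGradedComm.prodDeg F.degV m) x k :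
          F.V × ℚ) = (gradedProj F.degV k x.1, if k = m then x.2 else 0) := by
        intro x
        refine graded_induction (FreeGradedComm.prodDeg F.degV m) x ?_ (fun l x hx => ?_)
          (fun x y hx hy => ?_)
        · rw [DirectSum.decompose_zero]
          simp [Prod.zero_eq_mk]
        · rcases eq_or_ne l k with rfl | h
          · rw [DirectSum.decompose_of_mem_same _ hx]
            refine Prod.ext (gradedProj_same _ hx.1).symm ?_
            have := hx.2
            by_cases h : l = m
            · simp [h]
            · simpa [h] using this
          · rw [DirectSum.decompose_of_mem_ne _ hx h]
            refine Prod.ext (gradedProj_ne _ h hx.1).symm ?_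
            have := hx.2
            by_cases h' : k = m
            · have hl : l ≠ m := fun e => h (e.trans h'.symm)
              simp only [hl, if_false] at this
              simpa [h'] using (show x.2 = 0 from this).symm
            · simp [h']
        · rw [DirectSum.decompose_add, DirectSum.add_apply, Submodule.coe_add, hx, hy]
          refine Prod.ext (by simp) ?_
          by_cases h' : k = m <;> simp [h']
      rw [key]
      refine ⟨?_, ?_⟩
      · change gradedProj F.degV k v ∈ F.filt n
        rw [gradedProj_eq_decompose]
        exact F.filt_graded n h1 k
      · change (if k = m then r else 0) ∈ _
        by_cases h : k = m
        · rw [if_pos h]; exact h2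
        · rw [if_neg h]; exact zero_mem _
    filt_exhausts := by
      rintro ⟨v, r⟩
      obtain ⟨n, hn⟩ := F.filt_exhausts v
      exact ⟨n + n₀ + 1, F.filt_mono (by omega) hn, by simp [show n₀ < n + n₀ + 1 by omega]⟩
    d_filt_zero := by
      rintro ⟨v, r⟩ ⟨h1, h2⟩
      have : r = 0 := by simpa using h2
      rw [this, F.adjoinGen_inl, ← CDGA.Hom.map_d]
      obtain ⟨a, ha⟩ := F.d_filt_zero v h1
      exact ⟨a, by rw [← ha]; rfl⟩
    d_filt_succ := by
      rintro n ⟨v, r⟩ ⟨h1, h2⟩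
      have hst : ∀ l, n₀ ≤ l ∨ l ≤ n → ∀ x ∈ F.stage l, l ≤ n →
          (F.total.adjoinOddIncl hm hb hdb).toAlgHom x ∈ Algebra.adjoin ℚ
            ((((F.total.adjoinOddIncl hm hb hdb).comp F.incl).toAlgHom.range :
              Set (F.total.adjoinOdd hm hb hdb)) ∪ F.adjoinGen hm hb hdb ''
              (((F.filt n).prod (if n₀ < n then ⊤ else ⊥) : Submodule ℚ (F.V × ℚ)) :
                Set (F.V × ℚ))) := by
        intro l _ x hx hl
        have : F.stage l ≤ Subalgebra.comap (F.total.adjoinOddIncl hm hb hdb).toAlgHom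
            (Algebra.adjoin ℚ
            ((((F.total.adjoinOddIncl hm hb hdb).comp F.incl).toAlgHom.range :
              Set (F.total.adjoinOdd hm hb hdb)) ∪ F.adjoinGen hm hb hdb ''
              (((F.filt n).prod (if n₀ < n then ⊤ else ⊥) : Submodule ℚ (F.V × ℚ)) :
                Set (F.V × ℚ)))) := by
          rw [Algebra.adjoin_le_iff]
          rintro _ (⟨a, rfl⟩ | ⟨v, hv, rfl⟩)
          · exact Algebra.subset_adjoin (Or.inl ⟨a, rfl⟩)
          · refine Algebra.subset_adjoin (Or.inr ⟨(v, 0), ⟨F.filt_mono hl hv, zero_mem _⟩, ?_⟩)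
            exact F.adjoinGen_inl hm hb hdb v
        exact this hx
      have hvr : F.adjoinGen hm hb hdb (v, r) =
          (F.total.adjoinOddIncl hm hb hdb).toAlgHom (F.gen v) +
            r • F.total.adjoinOddGen hm hb hdb := by
        rw [← F.adjoinGen_inl, ← F.adjoinGen_inr, ← map_add]; simp
      rw [hvr, map_add, map_smul, F.total.adjoinOdd_d_gen, ← CDGA.Hom.map_d]
      refine add_mem (hst n (Or.inr le_rfl) _ (F.d_filt_succ n v h1) le_rfl) ?_
      by_cases h : n₀ < n + 1
      · exact Subalgebra.smul_mem _ (hst n₀ (Or.inl le_rfl) _ (F.exists_mem_stage b).choose_spec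
          (by omega)) r
      · have : r = 0 := by simpa [h] using h2
        rw [this, zero_smul]
        exact zero_mem _ }

end AlgebraicFibration

/-! ### Bounded fibrations -/

namespace AlgebraicFibration

variable {A : CDGA.{u}} (F : AlgebraicFibration.{u, w} A)

/-- The fiber vanishes in all sufficiently large degrees: every element of large degree of the total
space lies in `A⁺ · (A ⊗ ΛV)`. -/
def IsBounded : Prop := ∃ N : ℕ, ∀ k, N < k → F.total.deg k ≤ F.baseIdeal

variable {F} in
theorem IsBounded.fiberHasFiniteCohomologicalDimension (h : F.IsBounded) :
    F.FiberHasFiniteCohomologicalDimension := by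
  obtain ⟨N, hN⟩ := h
  refine ⟨N, fun k hk x hx _ => ⟨0, ?_⟩⟩
  obtain ⟨e, he, rfl⟩ := hx
  rw [map_zero, eq_comm]
  exact (Submodule.Quotient.mk_eq_zero _).2 (hN k hk he)

theorem incl_mul_mem_baseIdeal {n : ℕ} (hn : 0 < n) {a : A} (ha : a ∈ A.deg n) (y : F.total) :
    F.incl.toAlgHom a * y ∈ F.baseIdeal :=
  Submodule.subset_span ⟨n, a, y, hn, ha, rfl⟩

theorem mul_mem_baseIdeal {x : F.total} (hx : x ∈ F.baseIdeal) (y : F.total) :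
    x * y ∈ F.baseIdeal := by
  induction hx using Submodule.span_induction with
  | mem x h =>
    obtain ⟨n, a, z, hn, ha, rfl⟩ := h
    rw [mul_assoc]
    exact F.incl_mul_mem_baseIdeal hn ha _
  | zero => rw [zero_mul]; exact zero_mem _
  | add x x' _ _ hx hx' => rw [add_mul]; exact add_mem hx hx'
  | smul r x _ hx => rw [smul_mul_assoc]; exact Submodule.smul_mem _ _ hx

/-- A morphism over `A` of total spaces of fibrations. -/
structure Over (F F' : AlgebraicFibration.{u, w} A) where
  hom : CDGA.Hom F.total F'.total
  comm : ∀ a : A, hom.toAlgHom (F.incl.toAlgHom a) = F'.incl.toAlgHom a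

/-- The identity morphism over `A`. -/
def Over.id (F : AlgebraicFibration.{u, w} A) : Over F F := ⟨CDGA.Hom.id _, fun _ => rfl⟩

/-- Composition of morphisms over `A`. -/
def Over.comp {F F' F'' : AlgebraicFibration.{u, w} A} (g : Over F' F'') (f : Over F F') :
    Over F F'' :=
  ⟨g.hom.comp f.hom, fun a => (congrArg g.hom.toAlgHom (f.comm a)).trans (g.comm a)⟩

theorem Over.baseIdeal_le {F F' : AlgebraicFibration.{u, w} A} (f : Over F F') {x : F.total}
    (hx : x ∈ F.baseIdeal) : f.hom.toAlgHom x ∈ F'.baseIdeal := by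
  induction hx using Submodule.span_induction with
  | mem x h =>
    obtain ⟨n, a, z, hn, ha, rfl⟩ := h
    rw [map_mul, f.comm]
    exact F'.incl_mul_mem_baseIdeal hn ha _
  | zero => rw [map_zero]; exact zero_mem _
  | add x x' _ _ hx hx' => rw [map_add]; exact add_mem hx hx'
  | smul r x _ hx => rw [map_smul]; exact Submodule.smul_mem _ _ hx

theorem Over.onCohomology_eq_zero {F F' : AlgebraicFibration.{u, w} A} (f : Over F F')
    {x : A.Cohomology} (hx : F.incl.onCohomology x = 0) : F'.incl.onCohomology x = 0 := by
  obtain ⟨z, rfl⟩ := Ideal.Quotient.mk_surjective x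
  rw [CDGA.Hom.onCohomology_cls_eq_zero_iff] at hx ⊢
  obtain ⟨y, hy⟩ := hx
  exact ⟨f.hom.toAlgHom y, by rw [← f.hom.map_d, hy, f.comm]⟩

/-- Every positive-degree cocycle of even degree of the total space of a bounded fibration becomes
exact in a larger bounded fibration. -/
theorem IsBounded.exists_over_exact {F : AlgebraicFibration.{u, w} A} (hF : F.IsBounded) {n : ℕ}
    (hn : Even n) (hn0 : 0 < n) {b : F.total} (hb : b ∈ F.total.deg n) (hdb : F.total.d b = 0) :
    ∃ (F' : AlgebraicFibration.{u, w} A) (f : Over F F'), F'.IsBounded ∧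
      ∃ p ∈ F'.total.deg (n - 1), F'.total.d p = f.hom.toAlgHom b := by
  obtain ⟨m, rfl⟩ : ∃ m, n = m + 1 := ⟨n - 1, by omega⟩
  have hm : Odd m := by
    rcases Nat.even_or_odd m with h | h
    · exact absurd hn (Nat.not_even_iff_odd.2 h.add_one)
    · exact h
  obtain ⟨N, hN⟩ := hF
  let f : Over F (F.adjoin hm hb hdb) := ⟨F.total.adjoinOddIncl hm hb hdb, fun _ => rfl⟩
  refine ⟨F.adjoin hm hb hdb, f, ⟨N + m, fun k hk e he => ?_⟩,
    F.total.adjoinOddGen hm hb hdb, F.total.adjoinOddGen_mem hm hb hdb,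
    F.total.adjoinOdd_d_gen hm hb hdb⟩
  have h1 : AdjoinOdd.fst e ∈ F.baseIdeal := hN k (by omega) he.1
  have h2 : AdjoinOdd.snd e ∈ F.baseIdeal := by
    obtain h | ⟨j, hj, h⟩ := AdjoinOdd.mem_shiftDeg.1 he.2
    · rw [h]; exact zero_mem _
    · exact hN j (by omega) h
  let p : (F.adjoin hm hb hdb).total := F.total.adjoinOddGen hm hb hdb
  have e1 : e = f.hom.toAlgHom (AdjoinOdd.fst e) + f.hom.toAlgHom (AdjoinOdd.snd e) * p :=
    AdjoinOdd.eq_inl_add_inl_mul_p e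
  rw [e1]
  exact add_mem (f.baseIdeal_le h1) (mul_mem_baseIdeal _ (f.baseIdeal_le h2) _)

end AlgebraicFibration

/-- A copy of a commutative DGA in a larger universe. -/
def CDGA.ulift (A : CDGA.{u}) : CDGA.{max u w} where
  carrier := ULift.{w} A
  deg n := (A.deg n).comap (ULift.moduleEquiv : ULift.{w} A ≃ₗ[ℚ] A).toLinearMap
  graded :=
    { decompositionOfProj _
        (fun n => (ULift.moduleEquiv : ULift.{w} A ≃ₗ[ℚ] A).symm.toLinearMap ∘ₗ
          gradedProj A.deg n ∘ₗ (ULift.moduleEquiv : ULift.{w} A ≃ₗ[ℚ] A).toLinearMap)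
        (fun n x => gradedProj_mem A.deg n x.down)
        (fun n x hx => ULift.ext _ _ (gradedProj_same A.deg hx))
        (fun m n h x hx => ULift.ext _ _ (gradedProj_ne A.deg h hx))
        (fun x => by
          obtain ⟨s, hs⟩ := exists_sum_gradedProj A.deg x.down
          refine ⟨s, (ULift.moduleEquiv : ULift.{w} A ≃ₗ[ℚ] A).injective ?_⟩
          rw [map_sum]
          exact hs) with
      one_mem := CDGA.one_mem_deg (A := A)
      mul_mem := fun _ _ _ _ hx hy => CDGA.mul_mem_deg (A := A) hx hy rfl }
  d := (ULift.moduleEquiv : ULift.{w} A ≃ₗ[ℚ] A).symm.toLinearMap ∘ₗ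
    A.d ∘ₗ (ULift.moduleEquiv : ULift.{w} A ≃ₗ[ℚ] A).toLinearMap
  d_mem h := A.d_mem h
  d_d a := ULift.ext _ _ (A.d_d a.down)
  comm ha hb := ULift.ext _ _ (A.comm ha hb)
  leibniz b ha := ULift.ext _ _ (A.leibniz b.down ha)

/-- The canonical isomorphism from a commutative DGA to its copy. -/
def CDGA.toULift (A : CDGA.{u}) : CDGA.Hom A (CDGA.ulift.{u, w} A) where
  toAlgHom := (ULift.algEquiv (R := ℚ) (A := A)).symm.toAlgHom
  map_deg h := h
  map_d _ := rfl

namespace AlgebraicFibration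

variable (A : CDGA.{u})

theorem trivial_gen_mem {k : ℕ} {v : PUnit.{w + 1}}
    (_ : v ∈ (fun _ => ⊥ : ℕ → Submodule ℚ PUnit.{w + 1}) k) :
    (0 : PUnit.{w + 1} →ₗ[ℚ] CDGA.ulift.{u, w} A) v ∈ (CDGA.ulift.{u, w} A).deg k := zero_mem _

theorem trivial_bijective : Function.Bijective
    (TensorProduct.lift ((LinearMap.mul ℚ (CDGA.ulift.{u, w} A)).compl₁₂
      (CDGA.toULift.{u, w} A).toAlgHom.toLinearMap
      (FreeGradedComm.lift (fun _ => ⊥ : ℕ → Submodule ℚ PUnit.{w + 1})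
        (0 : PUnit.{w + 1} →ₗ[ℚ] CDGA.ulift.{u, w} A) (trivial_gen_mem A)).toLinearMap) :
      A ⊗[ℚ] FreeGradedComm (fun _ => ⊥ : ℕ → Submodule ℚ PUnit.{w + 1}) →ₗ[ℚ]
        CDGA.ulift.{u, w} A) := by
  have hbot : (⊥ : Subalgebra ℚ (FreeGradedComm (fun _ => ⊥ : ℕ → Submodule ℚ PUnit.{w + 1}))) =
      ⊤ := FreeGradedComm.eq_top_of_of_mem fun v => by
    rw [Subsingleton.elim v 0, map_zero]; exact zero_mem _
  have h1 : ∀ t : A ⊗[ℚ] FreeGradedComm (fun _ => ⊥ : ℕ → Submodule ℚ PUnit.{w + 1}),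
      ∃ a, t = a ⊗ₜ 1 := by
    intro t
    induction t with
    | zero => exact ⟨0, by simp⟩
    | add x y hx hy =>
      obtain ⟨a, rfl⟩ := hx
      obtain ⟨b, rfl⟩ := hy
      exact ⟨a + b, by rw [TensorProduct.add_tmul]⟩
    | tmul a g =>
      have hg : g ∈ (⊥ : Subalgebra ℚ _) := hbot ▸ trivial
      obtain ⟨r, rfl⟩ := Algebra.mem_bot.1 hg
      exact ⟨r • a, by rw [Algebra.algebraMap_eq_smul_one, TensorProduct.tmul_smul,
        TensorProduct.smul_tmul']⟩
  constructor
  · intro s t h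
    obtain ⟨a, rfl⟩ := h1 s
    obtain ⟨b, rfl⟩ := h1 t
    simp only [TensorProduct.lift.tmul, LinearMap.compl₁₂_apply, AlgHom.toLinearMap_apply, map_one,
      LinearMap.mul_apply', mul_one] at h
    rw [show a = b from congrArg ULift.down h]
  · intro x
    refine ⟨x.down ⊗ₜ 1, ?_⟩
    simp only [TensorProduct.lift.tmul, LinearMap.compl₁₂_apply, AlgHom.toLinearMap_apply, map_one,
      LinearMap.mul_apply', mul_one]
    rfl

/-- The fibration with `V = 0`. -/
def trivial : AlgebraicFibration.{u, w} A where
  V := PUnit.{w + 1}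
  degV _ := ⊥
  decomposition := decompositionOfProj _ (fun _ => 0) (fun _ _ => zero_mem _)
    (fun _ _ _ => Subsingleton.elim _ _) (fun _ _ _ _ _ => Subsingleton.elim _ _)
    (fun _ => ⟨∅, Subsingleton.elim _ _⟩)
  degV_zero := rfl
  total := CDGA.ulift.{u, w} A
  incl := CDGA.toULift.{u, w} A
  gen := 0
  gen_mem := trivial_gen_mem A
  bijective := trivial_bijective A
  filt _ := ⊤
  filt_mono _ _ _ := le_rfl
  filt_graded _ _ _ _ := Submodule.mem_top
  filt_exhausts _ := ⟨0, Submodule.mem_top⟩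
  d_filt_zero v _ := ⟨0, by simp⟩
  d_filt_succ n v _ := by simp [zero_mem]

theorem trivial_isBounded : (trivial.{u, w} A).IsBounded := by
  refine ⟨0, fun k hk x hx => ?_⟩
  have h := (trivial.{u, w} A).incl_mul_mem_baseIdeal hk (a := ULift.down x) hx 1
  rw [mul_one] at h
  exact h

end AlgebraicFibration

/-! ### The differential graded Lie algebra `A ⊗ L` -/

namespace DGLA

variable (A : CDGA.{u}) (L : DGLA.{v})

/-- The elements of total degree `n` of `A ⊗ L`. -/
def tensorDeg (n : ℤ) : Submodule ℚ (A ⊗[ℚ] L) :=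
  Submodule.span ℚ {x | ∃ (i : ℕ) (j : ℤ) (b : A) (w : L), (i : ℤ) + j = n ∧
    b ∈ A.deg i ∧ w ∈ L.deg j ∧ x = b ⊗ₜ[ℚ] w}

variable {L} in
/-- The subspace `A ⊗ W` of `A ⊗ L`. -/
def tens (W : Submodule ℚ L) : Submodule ℚ (A ⊗[ℚ] L) :=
  Submodule.map₂ (TensorProduct.mk ℚ A L) ⊤ W

variable {A L}

theorem posTensorDeg_le (n : ℤ) : posTensorDeg A L n ≤ tensorDeg A L n :=
  Submodule.span_mono fun _ ⟨i, j, b, w, _, h, hb, hw, e⟩ => ⟨i, j, b, w, h, hb, hw, e⟩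

theorem tmul_mem_tensorDeg {i : ℕ} {j n : ℤ} {b : A} {w : L} (hb : b ∈ A.deg i) (hw : w ∈ L.deg j)
    (h : (i : ℤ) + j = n) : b ⊗ₜ[ℚ] w ∈ tensorDeg A L n :=
  Submodule.subset_span ⟨i, j, b, w, h, hb, hw, rfl⟩

theorem tmul_mem_tens {W : Submodule ℚ L} (b : A) {w : L} (hw : w ∈ W) : b ⊗ₜ[ℚ] w ∈ tens A W :=
  Submodule.apply_mem_map₂ _ Submodule.mem_top hw

theorem tens_mono {W W' : Submodule ℚ L} (h : W ≤ W') : tens A W ≤ tens A W' :=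
  Submodule.map₂_le_map₂_right h

theorem tens_bot : tens A (⊥ : Submodule ℚ L) = ⊥ := Submodule.map₂_bot_right _ _

theorem tens_top (x : A ⊗[ℚ] L) : x ∈ tens A (⊤ : Submodule ℚ L) := by
  induction x with
  | zero => exact zero_mem _
  | add x y hx hy => exact add_mem hx hy
  | tmul b w => exact tmul_mem_tens b Submodule.mem_top

/-- Induction on `A ⊗ L`, through tensors of homogeneous elements. -/
@[elab_as_elim]
theorem tensor_induction {p : A ⊗[ℚ] L → Prop} (x : A ⊗[ℚ] L) (h0 : p 0)
    (ht : ∀ (i : ℕ) (j : ℤ) (b : A) (w : L), b ∈ A.deg i → w ∈ L.deg j → p (b ⊗ₜ w))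
    (ha : ∀ x y, p x → p y → p (x + y)) : p x := by
  induction x with
  | zero => exact h0
  | add x y hx hy => exact ha x y hx hy
  | tmul b w =>
    refine graded_induction A.deg b ?_ (fun i b hb => ?_) (fun x y hx hy => ?_)
    · rw [TensorProduct.zero_tmul]; exact h0
    · refine graded_induction L.deg w ?_ (fun j w hw => ?_) (fun x y hx hy => ?_)
      · rw [TensorProduct.tmul_zero]; exact h0
      · exact ht i j b w hb hw
      · rw [TensorProduct.tmul_add]; exact ha _ _ hx hy
    · rw [TensorProduct.add_tmul]; exact ha _ _ hx hy

@[elab_as_elim]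
theorem tensorDeg_induction {n : ℤ} {p : A ⊗[ℚ] L → Prop} (x : A ⊗[ℚ] L)
    (hx : x ∈ tensorDeg A L n) (h0 : p 0)
    (ht : ∀ (i : ℕ) (j : ℤ) (b : A) (w : L), (i : ℤ) + j = n → b ∈ A.deg i → w ∈ L.deg j →
      p (b ⊗ₜ w))
    (ha : ∀ x y, p x → p y → p (x + y)) : p x := by
  refine Submodule.closure_induction (p := fun x _ => p x) h0 (fun x y _ _ => ha x y) ?_ hx
  rintro r x ⟨i, j, b, w, h, hb, hw, rfl⟩
  rw [TensorProduct.smul_tmul']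
  exact ht i j _ w h (Submodule.smul_mem _ r hb) hw

@[elab_as_elim]
theorem tens_induction {W : Submodule ℚ L} {p : A ⊗[ℚ] L → Prop} (x : A ⊗[ℚ] L)
    (hx : x ∈ tens A W) (h0 : p 0) (ht : ∀ (i : ℕ) (b : A), b ∈ A.deg i → ∀ w ∈ W, p (b ⊗ₜ w))
    (ha : ∀ x y, p x → p y → p (x + y)) : p x := by
  rw [tens, Submodule.map₂_eq_span_image2] at hx
  refine Submodule.closure_induction (p := fun x _ => p x) h0 (fun x y _ _ => ha x y) ?_ hx
  · rintro r _ ⟨b, -, w, hw, rfl⟩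
    change p (r • (b ⊗ₜ[ℚ] w))
    rw [TensorProduct.smul_tmul']
    generalize r • b = b
    refine graded_induction A.deg b ?_ (fun i b hb => ht i b hb w hw) (fun x y hx hy => ?_)
    · simpa using h0
    · simpa [TensorProduct.add_tmul] using ha _ _ hx hy

theorem tensorBracket_mem_tensorDeg {m n : ℤ} {x y : A ⊗[ℚ] L} (hx : x ∈ tensorDeg A L m)
    (hy : y ∈ tensorDeg A L n) : tensorBracket A L x y ∈ tensorDeg A L (m + n) := by
  refine tensorDeg_induction x hx ?_ (fun i j b w h hb hw => ?_) (fun x x' hx hx' => ?_)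
  · simp
  · refine tensorDeg_induction y hy ?_ (fun i' j' b' w' h' hb' hw' => ?_) (fun x x' hx hx' => ?_)
    · simp
    · rw [tensorBracket_tmul A L b w' hw hb']
      exact Submodule.smul_mem _ _ (tmul_mem_tensorDeg (CDGA.mul_mem_deg hb hb' rfl)
        (L.bracket_mem hw hw') (by push_cast; omega))
    · rw [map_add]; exact add_mem hx hx'
  · rw [map_add, LinearMap.add_apply]; exact add_mem hx hx'

theorem tensorD_mem_tensorDeg {n : ℤ} {x : A ⊗[ℚ] L} (hx : x ∈ tensorDeg A L n) :
    tensorD A L x ∈ tensorDeg A L (n + 1) := by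
  refine tensorDeg_induction x hx ?_ (fun i j b w h hb hw => ?_) (fun x x' hx hx' => ?_)
  · simp
  · rw [tensorD_tmul A L w hb]
    exact add_mem (tmul_mem_tensorDeg (A.d_mem hb) hw (by push_cast; omega))
      (Submodule.smul_mem _ _ (tmul_mem_tensorDeg hb (L.d_mem hw) (by omega)))
  · rw [map_add]; exact add_mem hx hx'

theorem tensorD_tensorD (x : A ⊗[ℚ] L) : tensorD A L (tensorD A L x) = 0 := by
  refine tensor_induction x (by simp) (fun i j b w hb hw => ?_) (fun x y hx hy => ?_)
  · rw [tensorD_tmul A L w hb, map_add, map_smul, tensorD_tmul A L w (A.d_mem hb),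
      tensorD_tmul A L _ hb, A.d_d, L.d_d, pow_succ]
    simp only [TensorProduct.zero_tmul, TensorProduct.tmul_zero, smul_zero, add_zero, zero_add,
      mul_neg_one]
    module
  · rw [map_add, map_add, hx, hy, add_zero]

theorem tensorBracket_symm {x y : A ⊗[ℚ] L} (hx : x ∈ tensorDeg A L 1)
    (hy : y ∈ tensorDeg A L 1) : tensorBracket A L x y = tensorBracket A L y x := by
  refine tensorDeg_induction x hx (by simp) (fun i j b w h hb hw => ?_) (fun x x' hx hx' => ?_)
  · refine tensorDeg_induction y hy (by simp) (fun i' j' b' w' h' hb' hw' => ?_)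
      (fun x x' hx hx' => ?_)
    · rw [tensorBracket_tmul A L b w' hw hb', tensorBracket_tmul A L b' w hw' hb,
        L.antisymm hw' hw, A.comm hb' hb, ← zpow_natCast, TensorProduct.tmul_neg,
        TensorProduct.tmul_smul, ← TensorProduct.smul_tmul', smul_neg, smul_smul, smul_smul,
        ← neg_smul]
      congr 1
      obtain rfl : j = 1 - i := by omega
      obtain rfl : j' = 1 - i' := by omega
      rw [← zpow_add₀ (by norm_num : (-1 : ℚ) ≠ 0), ← zpow_add₀ (by norm_num : (-1 : ℚ) ≠ 0)]
      exact neg_one_zpow_eq_neg (i' - i * i' - 1) (by push_cast; ring)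
    · rw [map_add, hx, hx']; simp
  · rw [map_add, LinearMap.add_apply, hx, hx', map_add]

theorem tensorBracket_jacobi {g : A ⊗[ℚ] L} (hg : g ∈ tensorDeg A L 0) (x y : A ⊗[ℚ] L) :
    tensorBracket A L g (tensorBracket A L x y) =
      tensorBracket A L (tensorBracket A L g x) y +
        tensorBracket A L x (tensorBracket A L g y) := by
  refine tensorDeg_induction g hg (by simp) (fun i₀ j₀ b₀ w₀ h₀ hb₀ hw₀ => ?_)
    (fun g g' hg hg' => ?_)
  · refine tensor_induction x (by simp) (fun i₁ j₁ b₁ w₁ hb₁ hw₁ => ?_) (fun x x' hx hx' => ?_)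
    · refine tensor_induction y (by simp) (fun i₂ j₂ b₂ w₂ hb₂ hw₂ => ?_)
        (fun x x' hx hx' => ?_)
      · obtain rfl : j₀ = -i₀ := by omega
        rw [tensorBracket_tmul A L b₁ w₂ hw₁ hb₂, tensorBracket_tmul A L b₀ w₁ hw₀ hb₁,
          tensorBracket_tmul A L b₀ w₂ hw₀ hb₂]
        simp only [map_smul, LinearMap.smul_apply]
        rw [tensorBracket_tmul A L b₀ _ hw₀ (CDGA.mul_mem_deg hb₁ hb₂ rfl),
          tensorBracket_tmul A L _ w₂ (L.bracket_mem hw₀ hw₁) hb₂,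
          tensorBracket_tmul A L b₁ _ hw₁ (CDGA.mul_mem_deg hb₀ hb₂ rfl),
          L.jacobi w₂ hw₀ hw₁, ← mul_assoc b₁, A.comm hb₁ hb₀, ← zpow_natCast,
          TensorProduct.tmul_add, TensorProduct.tmul_smul, smul_mul_assoc,
          ← TensorProduct.smul_tmul', smul_add, smul_add, mul_assoc]
        simp only [smul_smul, ← zpow_add₀ (show (-1 : ℚ) ≠ 0 by norm_num)]
        congr 2
        · exact neg_one_zpow_eq 0 (by push_cast; ring)
        · exact neg_one_zpow_eq (-(i₀ * i₁) - i₀ * j₁) (by push_cast; ring)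
      · simp only [map_add, hx, hx']; abel
    · simp only [map_add, LinearMap.add_apply, hx, hx']; abel
  · simp only [map_add, LinearMap.add_apply, hg, hg']; abel

theorem tensorD_tensorBracket {g : A ⊗[ℚ] L} (hg : g ∈ tensorDeg A L 0) (x : A ⊗[ℚ] L) :
    tensorD A L (tensorBracket A L g x) =
      tensorBracket A L (tensorD A L g) x + tensorBracket A L g (tensorD A L x) := by
  refine tensorDeg_induction g hg (by simp) (fun i₀ j₀ b₀ w₀ h₀ hb₀ hw₀ => ?_)
    (fun g g' hg hg' => ?_)
  · refine tensor_induction x (by simp) (fun i₁ j₁ b₁ w₁ hb₁ hw₁ => ?_) (fun x x' hx hx' => ?_)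
    · obtain rfl : j₀ = -i₀ := by omega
      rw [tensorBracket_tmul A L b₀ w₁ hw₀ hb₁, map_smul,
        tensorD_tmul A L _ (CDGA.mul_mem_deg hb₀ hb₁ rfl), tensorD_tmul A L w₀ hb₀,
        tensorD_tmul A L w₁ hb₁]
      simp only [map_add, LinearMap.add_apply, map_smul, LinearMap.smul_apply]
      rw [tensorBracket_tmul A L _ w₁ hw₀ hb₁, tensorBracket_tmul A L b₀ w₁ (L.d_mem hw₀) hb₁,
        tensorBracket_tmul A L b₀ w₁ hw₀ (A.d_mem hb₁), tensorBracket_tmul A L b₀ _ hw₀ hb₁,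
        A.leibniz b₁ hb₀, L.leibniz w₁ hw₀]
      simp only [TensorProduct.tmul_add, TensorProduct.tmul_smul, TensorProduct.add_tmul,
        ← TensorProduct.smul_tmul', smul_add, smul_smul, ← zpow_natCast,
        ← zpow_add₀ (show (-1 : ℚ) ≠ 0 by norm_num)]
      have e1 : (-1 : ℚ) ^ (-(i₀ : ℤ) * i₁ + i₀) = (-1) ^ (-(i₀ : ℤ) * ((i₁ + 1 : ℕ) : ℤ)) :=
        neg_one_zpow_eq i₀ (by push_cast; ring)
      have e2 : (-1 : ℚ) ^ (-(i₀ : ℤ) * i₁ + ((i₀ + i₁ : ℕ) : ℤ)) =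
          (-1) ^ ((i₀ : ℤ) + (-(i₀ : ℤ) + 1) * i₁) :=
        neg_one_zpow_eq 0 (by push_cast; ring)
      have e3 : (-1 : ℚ) ^ (-(i₀ : ℤ) * i₁ + (((i₀ + i₁ : ℕ) : ℤ) + -(i₀ : ℤ))) =
          (-1) ^ ((i₁ : ℤ) + -(i₀ : ℤ) * i₁) :=
        neg_one_zpow_eq 0 (by push_cast; ring)
      rw [e1, e2, e3]
      abel
    · simp only [map_add, hx, hx']; abel
  · simp only [map_add, LinearMap.add_apply, hg, hg']; abel

/-- If `[L, W] ⊆ W'`, then `[A ⊗ L, A ⊗ W] ⊆ A ⊗ W'`. -/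
theorem tensorBracket_mem_tens {W W' : Submodule ℚ L} (h : ∀ x, ∀ w ∈ W, L.bracket x w ∈ W')
    (x : A ⊗[ℚ] L) {y : A ⊗[ℚ] L} (hy : y ∈ tens A W) : tensorBracket A L x y ∈ tens A W' := by
  refine tensor_induction x (by simp) (fun i j b w hb hw => ?_) (fun x x' hx hx' => ?_)
  · refine tens_induction y hy (by simp) (fun i' b' hb' w' hw' => ?_) (fun x x' hx hx' => ?_)
    · rw [tensorBracket_tmul A L b w' hw hb']
      exact Submodule.smul_mem _ _ (tmul_mem_tens _ (h w w' hw'))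
    · rw [map_add]; exact add_mem hx hx'
  · rw [map_add, LinearMap.add_apply]; exact add_mem hx hx'

theorem bracket_mem_lowerCentralSeries (n : ℕ) (x : L) {w : L} (hw : w ∈ L.lowerCentralSeries n) :
    L.bracket x w ∈ L.lowerCentralSeries (n + 1) :=
  Submodule.apply_mem_map₂ _ Submodule.mem_top hw

theorem tensorBracket_pow_mem (g x : A ⊗[ℚ] L) (n : ℕ) :
    ((tensorBracket A L g) ^ n) x ∈ tens A (L.lowerCentralSeries n) := by
  induction n with
  | zero => exact tens_top _
  | succ n ih =>
    rw [pow_succ', Module.End.mul_apply]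
    exact tensorBracket_mem_tens (fun x w hw => bracket_mem_lowerCentralSeries n x hw) g ih

end DGLA

/-! ### Gauge transformations -/

/-- The exponential of a nilpotent derivation of a bilinear map is compatible with the map. -/
theorem exp_apply_of_derivation {M N : Type*} [AddCommGroup M] [Module ℚ M] [AddCommGroup N]
    [Module ℚ N] (μ : M →ₗ[ℚ] M →ₗ[ℚ] N) (D : Module.End ℚ M) (D' : Module.End ℚ N)
    (hD : IsNilpotent D) (hD' : IsNilpotent D')
    (h : ∀ x y, D' (μ x y) = μ (D x) y + μ x (D y)) (x y : M) :
    IsNilpotent.exp D' (μ x y) = μ (IsNilpotent.exp D x) (IsNilpotent.exp D y) := by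
  let DL : Module.End ℚ (M ⊗[ℚ] M) := D.lTensor M
  let DR : Module.End ℚ (M ⊗[ℚ] M) := D.rTensor M
  have hL : IsNilpotent DL := hD.map <| Module.End.lTensorAlgHom ℚ M M
  have hR : IsNilpotent DR := hD.map <| Module.End.rTensorAlgHom ℚ M M
  have hc : Commute DL DR := by ext; simp [DL, DR]
  have h1 : IsNilpotent.exp D' (μ x y) =
      TensorProduct.lift μ (IsNilpotent.exp (DL + DR) (x ⊗ₜ[ℚ] y)) := by
    have : IsNilpotent.exp D' ∘ₗ TensorProduct.lift μ =
        TensorProduct.lift μ ∘ₗ IsNilpotent.exp (DL + DR) := by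
      apply Module.End.commute_exp_left_of_commute (hc.isNilpotent_add hL hR) hD'
      ext
      simp [DL, DR, h, add_comm]
    simpa using LinearMap.congr_fun this (x ⊗ₜ[ℚ] y)
  have h2 : IsNilpotent.exp DL = (IsNilpotent.exp D).lTensor M :=
    (hD.map_exp (Module.End.lTensorAlgHom ℚ M M)).symm
  have h3 : IsNilpotent.exp DR = (IsNilpotent.exp D).rTensor M :=
    (hD.map_exp (Module.End.rTensorAlgHom ℚ M M)).symm
  simp [h1, IsNilpotent.exp_add_of_commute hc hL hR, h2, h3]

namespace DGLA

variable {A : CDGA.{u}} {L : DGLA.{v}}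

/-- The space `ℚ δ ⊕ (A ⊗ L)¹`, where `δ` stands for the differential. -/
def ExtSpace (A : CDGA.{u}) (L : DGLA.{v}) : Type (max u v) := ℚ × tensorDeg A L 1

instance : AddCommGroup (ExtSpace A L) := inferInstanceAs (AddCommGroup (ℚ × tensorDeg A L 1))
instance : Module ℚ (ExtSpace A L) := inferInstanceAs (Module ℚ (ℚ × tensorDeg A L 1))

/-- The coefficient of `δ`. -/
def ExtSpace.fst : ExtSpace A L →ₗ[ℚ] ℚ := LinearMap.fst ℚ ℚ (tensorDeg A L 1)

/-- The component in `A ⊗ L`. -/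
def ExtSpace.snd : ExtSpace A L →ₗ[ℚ] A ⊗[ℚ] L :=
  (tensorDeg A L 1).subtype ∘ₗ LinearMap.snd ℚ ℚ (tensorDeg A L 1)

theorem ExtSpace.snd_mem (x : ExtSpace A L) : x.snd ∈ tensorDeg A L 1 :=
  (show ℚ × tensorDeg A L 1 from x).2.2

theorem ExtSpace.ext {x y : ExtSpace A L} (h1 : x.fst = y.fst) (h2 : x.snd = y.snd) : x = y :=
  Prod.ext h1 (Subtype.ext h2)

/-- The bilinear map on `ℚ δ ⊕ (A ⊗ L)¹` that polarizes twice the curvature: with `[δ, x] = d x`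
and `[δ, δ] = 0` it is the bracket. -/
def extBracket (A : CDGA.{u}) (L : DGLA.{v}) :
    ExtSpace A L →ₗ[ℚ] ExtSpace A L →ₗ[ℚ] (A ⊗[ℚ] L) :=
  LinearMap.mk₂ ℚ (fun x y => tensorBracket A L x.snd y.snd + x.fst • tensorD A L y.snd +
      y.fst • tensorD A L x.snd)
    (by intro x x' y; simp [add_smul]; abel)
    (by intro r x y; simp [smul_smul, mul_comm r])
    (by intro x y y'; simp [add_smul]; abel)
    (by intro r x y; simp [smul_smul, mul_comm r])

theorem extBracket_apply (x y : ExtSpace A L) : extBracket A L x y =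
    tensorBracket A L x.snd y.snd + x.fst • tensorD A L y.snd + y.fst • tensorD A L x.snd := rfl

/-- The derivation `[g, -]` of `ℚ δ ⊕ (A ⊗ L)¹`, for `g` of degree zero. -/
def extAd (g : A ⊗[ℚ] L) (hg : g ∈ tensorDeg A L 0) : Module.End ℚ (ExtSpace A L) :=
  LinearMap.inr ℚ ℚ (tensorDeg A L 1) ∘ₗ
    LinearMap.codRestrict (tensorDeg A L 1)
      (tensorBracket A L g ∘ₗ ExtSpace.snd -
        (LinearMap.toSpanSingleton ℚ _ (tensorD A L g)) ∘ₗ ExtSpace.fst)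
      (fun x => sub_mem
        (by simpa using tensorBracket_mem_tensorDeg hg x.snd_mem)
        (Submodule.smul_mem _ _ (by simpa using tensorD_mem_tensorDeg hg)))

theorem extAd_fst (g : A ⊗[ℚ] L) (hg : g ∈ tensorDeg A L 0) (x : ExtSpace A L) :
    (extAd g hg x).fst = 0 := rfl

theorem extAd_snd (g : A ⊗[ℚ] L) (hg : g ∈ tensorDeg A L 0) (x : ExtSpace A L) :
    (extAd g hg x).snd = tensorBracket A L g x.snd - x.fst • tensorD A L g := rfl

theorem extAd_pow_fst (g : A ⊗[ℚ] L) (hg : g ∈ tensorDeg A L 0) (x : ExtSpace A L)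
    (n : ℕ) : (((extAd g hg) ^ (n + 1)) x).fst = 0 := by
  rw [pow_succ', Module.End.mul_apply, extAd_fst]

theorem extAd_pow_snd (g : A ⊗[ℚ] L) (hg : g ∈ tensorDeg A L 0) (x : ExtSpace A L)
    (n : ℕ) : (((extAd g hg) ^ (n + 1)) x).snd =
      ((tensorBracket A L g) ^ n) (tensorBracket A L g x.snd - x.fst • tensorD A L g) := by
  induction n with
  | zero => rw [zero_add, pow_one, extAd_snd]; rfl
  | succ n ih =>
    rw [pow_succ', Module.End.mul_apply, extAd_snd, ih, extAd_pow_fst, zero_smul, sub_zero,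
      pow_succ' _ n, Module.End.mul_apply]

theorem isNilpotent_tensorBracket (hL : L.IsNilpotent) (g : A ⊗[ℚ] L) :
    ∃ n, (tensorBracket A L g) ^ n = 0 := by
  obtain ⟨n, hn⟩ := hL
  refine ⟨n, LinearMap.ext fun x => ?_⟩
  have := tensorBracket_pow_mem g x n
  rw [hn, tens_bot] at this
  simpa using this

theorem extAd_derivation (g : A ⊗[ℚ] L) (hg : g ∈ tensorDeg A L 0)
    (x y : ExtSpace A L) : tensorBracket A L g (extBracket A L x y) =
      extBracket A L (extAd g hg x) y + extBracket A L x (extAd g hg y) := by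
  have hDg : tensorD A L g ∈ tensorDeg A L 1 := by simpa using tensorD_mem_tensorDeg hg
  simp only [extBracket_apply, extAd_fst, extAd_snd, map_add, map_sub, map_smul,
    LinearMap.sub_apply, LinearMap.smul_apply, tensorBracket_jacobi hg, tensorD_tensorBracket hg,
    tensorD_tensorD]
  rw [tensorBracket_symm hDg x.snd_mem]
  module

/-- A gauge transformation by an element `g` of degree zero that commutes with the curvature of `α`
moves `α` within the set of elements with the same curvature.  To first order in `g` it is
`α ↦ α + [g, α] - d g`; the remaining terms arise from `[g, [g, α] - d g]` by applying `[g, -]`. -/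
theorem exists_gauge (hL : L.IsNilpotent) {g : A ⊗[ℚ] L} (hg : g ∈ tensorDeg A L 0)
    {α : A ⊗[ℚ] L} (hα : α ∈ tensorDeg A L 1)
    (hc : tensorBracket A L g (curvature A L α) = 0) :
    ∃ β ∈ tensorDeg A L 1, curvature A L β = curvature A L α ∧
      ∀ S : Submodule ℚ (A ⊗[ℚ] L),
        tensorBracket A L g (tensorBracket A L g α - tensorD A L g) ∈ S →
        (∀ x ∈ S, tensorBracket A L g x ∈ S) →
        β - α - (tensorBracket A L g α - tensorD A L g) ∈ S := by
  obtain ⟨n, hn⟩ := isNilpotent_tensorBracket hL g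
  set G := extAd g hg with hG
  let a : ExtSpace A L := ((1, ⟨α, hα⟩) : ℚ × tensorDeg A L 1)
  have ha1 : a.fst = 1 := rfl
  have ha2 : a.snd = α := rfl
  have hGn : G ^ (n + 2) = 0 := by
    refine LinearMap.ext fun x => ExtSpace.ext ?_ ?_
    · exact extAd_pow_fst g hg x (n + 1)
    · rw [hG, extAd_pow_snd, pow_succ', hn]; simp
  have hexp : IsNilpotent.exp G a =
      ∑ i ∈ Finset.range n, ((i + 1 + 1).factorial : ℚ)⁻¹ • (G ^ (i + 1 + 1)) a + G a + a := by
    rw [IsNilpotent.exp_eq_sum hGn, LinearMap.sum_apply, Finset.sum_range_succ',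
      Finset.sum_range_succ']
    simp
  have hfst : (IsNilpotent.exp G a).fst = 1 := by
    rw [hexp, map_add, map_add, map_sum, Finset.sum_eq_zero]
    · rw [hG, extAd_fst, ha1]; simp
    · intro i _
      rw [map_smul, hG, extAd_pow_fst, smul_zero]
  have hcurv : ∀ y : ExtSpace A L, y.fst = 1 →
      extBracket A L y y = (2 : ℚ) • curvature A L y.snd := by
    intro y hy
    rw [extBracket_apply, hy, curvature]
    module
  have key := exp_apply_of_derivation (extBracket A L) G (tensorBracket A L g) ⟨_, hGn⟩ ⟨n, hn⟩
    (fun x y => extAd_derivation g hg x y) a a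
  rw [hcurv _ hfst, hcurv a ha1, ha2] at key
  refine ⟨(IsNilpotent.exp G a).snd, (IsNilpotent.exp G a).snd_mem, ?_, ?_⟩
  · have e : IsNilpotent.exp (tensorBracket A L g) ((2 : ℚ) • curvature A L α) =
        (2 : ℚ) • curvature A L α := by
      rcases n with _ | n
      · have h1 : (1 : Module.End ℚ (A ⊗[ℚ] L)) = 0 := by simpa using hn
        have h2 : ∀ x : A ⊗[ℚ] L, x = 0 := fun x => by
          simpa using LinearMap.congr_fun h1 x
        rw [h2 ((2 : ℚ) • curvature A L α), map_zero]
      · rw [IsNilpotent.exp_eq_sum hn, LinearMap.sum_apply, Finset.sum_range_succ',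
          Finset.sum_eq_zero]
        · simp
        · intro i _
          rw [LinearMap.smul_apply, pow_succ, Module.End.mul_apply, map_smul, hc]
          simp
    rw [e] at key
    exact (smul_right_injective _ (two_ne_zero (α := ℚ)) key).symm
  · intro S h1 h2
    have hp : ∀ i, ((tensorBracket A L g) ^ (i + 1))
        (tensorBracket A L g α - tensorD A L g) ∈ S := by
      intro i
      induction i with
      | zero => simpa using h1
      | succ i ih => rw [pow_succ', Module.End.mul_apply]; exact h2 _ ih
    rw [hexp, map_add, map_add, map_sum, ha2, hG, extAd_snd, ha1, ha2, one_smul,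
      add_sub_cancel_right,
      add_sub_cancel_right]
    refine sum_mem fun i _ => ?_
    rw [map_smul, extAd_pow_snd, ha1, ha2, one_smul]
    exact Submodule.smul_mem _ _ (hp i)

end DGLA

/-! ### Subspaces of tensor products -/

section TensorSubspaces

variable {M N : Type*} [AddCommGroup M] [Module ℚ M] [AddCommGroup N] [Module ℚ N]

/-- The subspace `U ⊗ W` of `M ⊗ N`. -/
def tensorBox (U : Submodule ℚ M) (W : Submodule ℚ N) : Submodule ℚ (M ⊗[ℚ] N) :=
  Submodule.map₂ (TensorProduct.mk ℚ M N) U W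

theorem tmul_mem_tensorBox {U : Submodule ℚ M} {W : Submodule ℚ N} {m : M} {n : N} (hm : m ∈ U)
    (hn : n ∈ W) : m ⊗ₜ[ℚ] n ∈ tensorBox U W :=
  Submodule.apply_mem_map₂ _ hm hn

theorem tensorBox_le {U : Submodule ℚ M} {W : Submodule ℚ N} {S : Submodule ℚ (M ⊗[ℚ] N)}
    (h : ∀ m ∈ U, ∀ n ∈ W, m ⊗ₜ[ℚ] n ∈ S) : tensorBox U W ≤ S :=
  Submodule.map₂_le.2 h

/-- A tensor lies in `U ⊗ N` if all its contractions with linear forms on `N` lie in `U`. -/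
theorem mem_tensorBox_of_forall_right {U : Submodule ℚ M} {x : M ⊗[ℚ] N}
    (h : ∀ ψ : N →ₗ[ℚ] ℚ, TensorProduct.rid ℚ M (ψ.lTensor M x) ∈ U) :
    x ∈ tensorBox U (⊤ : Submodule ℚ N) := by
  classical
  let b := Module.Free.chooseBasis ℚ N
  have hx := (TensorProduct.equivFinsuppOfBasisRight (M := M) b).symm_apply_apply x
  rw [TensorProduct.equivFinsuppOfBasisRight_symm_apply] at hx
  rw [← hx]
  refine Submodule.finsuppSum_mem _ _ _ _ fun i _ => tmul_mem_tensorBox ?_ Submodule.mem_top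
  rw [TensorProduct.equivFinsuppOfBasisRight_apply]
  exact h _

/-- A tensor lies in `M ⊗ W` if all its contractions with linear forms on `M` lie in `W`. -/
theorem mem_tensorBox_of_forall_left {W : Submodule ℚ N} {x : M ⊗[ℚ] N}
    (h : ∀ φ : M →ₗ[ℚ] ℚ, TensorProduct.lid ℚ N (φ.rTensor N x) ∈ W) :
    x ∈ tensorBox (⊤ : Submodule ℚ M) W := by
  classical
  let b := Module.Free.chooseBasis ℚ M
  have hx := (TensorProduct.equivFinsuppOfBasisLeft (N := N) b).symm_apply_apply x
  rw [TensorProduct.equivFinsuppOfBasisLeft_symm_apply] at hx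
  rw [← hx]
  refine Submodule.finsuppSum_mem _ _ _ _ fun i _ => tmul_mem_tensorBox Submodule.mem_top ?_
  rw [TensorProduct.equivFinsuppOfBasisLeft_apply]
  exact h _

theorem contract_right_mem {U : Submodule ℚ M} {W : Submodule ℚ N} {x : M ⊗[ℚ] N}
    (hx : x ∈ tensorBox U W) (ψ : N →ₗ[ℚ] ℚ) :
    TensorProduct.rid ℚ M (ψ.lTensor M x) ∈ U := by
  have : tensorBox U W ≤ U.comap
      ((TensorProduct.rid ℚ M).toLinearMap ∘ₗ ψ.lTensor M) := tensorBox_le fun m hm n _ => by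
    simpa using U.smul_mem _ hm
  exact this hx

theorem contract_left_mem {U : Submodule ℚ M} {W : Submodule ℚ N} {x : M ⊗[ℚ] N}
    (hx : x ∈ tensorBox U W) (φ : M →ₗ[ℚ] ℚ) :
    TensorProduct.lid ℚ N (φ.rTensor N x) ∈ W := by
  have : tensorBox U W ≤ W.comap
      ((TensorProduct.lid ℚ N).toLinearMap ∘ₗ φ.rTensor N) := tensorBox_le fun m _ n hn => by
    simpa using W.smul_mem _ hn
  exact this hx

theorem tensorBox_inf_left {U U' : Submodule ℚ M} {W W' : Submodule ℚ N} {x : M ⊗[ℚ] N}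
    (h : x ∈ tensorBox U W) (h' : x ∈ tensorBox U' W') :
    x ∈ tensorBox (U ⊓ U') (⊤ : Submodule ℚ N) :=
  mem_tensorBox_of_forall_right fun ψ => ⟨contract_right_mem h ψ, contract_right_mem h' ψ⟩

theorem tensorBox_inf_right {U U' : Submodule ℚ M} {W W' : Submodule ℚ N} {x : M ⊗[ℚ] N}
    (h : x ∈ tensorBox U W) (h' : x ∈ tensorBox U' W') :
    x ∈ tensorBox (⊤ : Submodule ℚ M) (W ⊓ W') :=
  mem_tensorBox_of_forall_left fun φ => ⟨contract_left_mem h φ, contract_left_mem h' φ⟩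

theorem tensorBox_inf {U U' : Submodule ℚ M} {W W' : Submodule ℚ N} {x : M ⊗[ℚ] N}
    (h : x ∈ tensorBox U W) (h' : x ∈ tensorBox U' W') : x ∈ tensorBox (U ⊓ U') (W ⊓ W') := by
  have h1 := tensorBox_inf_left h h'
  have h2 := tensorBox_inf_right h h'
  -- a projection onto `U ⊓ U'`, tensored with a projection onto `W ⊓ W'`, fixes `x`
  obtain ⟨e, he⟩ := Submodule.exists_isCompl (U ⊓ U')
  obtain ⟨f, hf⟩ := Submodule.exists_isCompl (W ⊓ W')
  let p := Submodule.projection _ _ he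
  let q := Submodule.projection _ _ hf
  have e1 : p.rTensor N x = x := by
    have : tensorBox (U ⊓ U') (⊤ : Submodule ℚ N) ≤
        LinearMap.eqLocus (p.rTensor N) LinearMap.id := tensorBox_le fun m hm n _ => by
      simp [LinearMap.mem_eqLocus, p, Submodule.projection_apply_of_mem_left he hm]
    exact this h1
  have e2 : q.lTensor M x = x := by
    have : tensorBox (⊤ : Submodule ℚ M) (W ⊓ W') ≤
        LinearMap.eqLocus (q.lTensor M) LinearMap.id := tensorBox_le fun m _ n hn => by
      simp [LinearMap.mem_eqLocus, q, Submodule.projection_apply_of_mem_left hf hn]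
    exact this h2
  rw [← e1, ← e2]
  generalize x = y
  induction y with
  | zero => simp
  | add x y hx hy => rw [map_add, map_add]; exact add_mem hx hy
  | tmul m n =>
    simp only [LinearMap.lTensor_tmul, LinearMap.rTensor_tmul]
    exact tmul_mem_tensorBox (Submodule.projection_apply_mem he m)
      (Submodule.projection_apply_mem hf n)

theorem mem_tensorBox_ker_of_rTensor_eq_zero {M' : Type*} [AddCommGroup M'] [Module ℚ M']
    {f : M →ₗ[ℚ] M'} {x : M ⊗[ℚ] N} (h : f.rTensor N x = 0) :
    x ∈ tensorBox (LinearMap.ker f) (⊤ : Submodule ℚ N) := by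
  refine mem_tensorBox_of_forall_right fun ψ => ?_
  have : ∀ y : M ⊗[ℚ] N, f (TensorProduct.rid ℚ M (ψ.lTensor M y)) =
      TensorProduct.rid ℚ M' (ψ.lTensor M' (f.rTensor N y)) := by
    intro y
    induction y with
    | zero => simp
    | add x y hx hy => simp only [map_add, hx, hy]
    | tmul m n => simp
  rw [LinearMap.mem_ker, this, h]
  simp

end TensorSubspaces

/-! ### Parity in `A ⊗ L` -/

namespace DGLA

variable {A : CDGA.{u}} {L : DGLA.{v}}

variable (A L) in
/-- The projection of `A ⊗ L` onto `A^{even} ⊗ L`. -/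
def evenPart : Module.End ℚ (A ⊗[ℚ] L) :=
  (gradedScale A.deg fun n => if Even n then 1 else 0).rTensor L

variable (A L) in
/-- The projection of `A ⊗ L` onto `A^{odd} ⊗ L`. -/
def oddPart : Module.End ℚ (A ⊗[ℚ] L) :=
  (gradedScale A.deg fun n => if Even n then 0 else 1).rTensor L

variable (A L) in
/-- The part `b ⊗ w ↦ d b ⊗ w` of the differential. -/
def dLeft : Module.End ℚ (A ⊗[ℚ] L) := A.d.rTensor L

variable (A L) in
/-- The part `b ⊗ w ↦ (-1)^{|b|} b ⊗ d w` of the differential. -/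
def dRight : Module.End ℚ (A ⊗[ℚ] L) := TensorProduct.map A.sgn L.d

theorem tensorD_eq (x : A ⊗[ℚ] L) : tensorD A L x = dLeft A L x + dRight A L x := rfl

theorem evenPart_tmul {i : ℕ} {b : A} (hb : b ∈ A.deg i) (w : L) :
    evenPart A L (b ⊗ₜ w) = if Even i then b ⊗ₜ w else 0 := by
  rw [evenPart, LinearMap.rTensor_tmul, gradedScale_apply _ _ hb]
  split_ifs <;> simp

theorem oddPart_tmul {i : ℕ} {b : A} (hb : b ∈ A.deg i) (w : L) :
    oddPart A L (b ⊗ₜ w) = if Even i then 0 else b ⊗ₜ w := by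
  rw [oddPart, LinearMap.rTensor_tmul, gradedScale_apply _ _ hb]
  split_ifs <;> simp

theorem dLeft_tmul (b : A) (w : L) : dLeft A L (b ⊗ₜ w) = A.d b ⊗ₜ w := rfl

theorem dRight_tmul {i : ℕ} {b : A} (hb : b ∈ A.deg i) (w : L) :
    dRight A L (b ⊗ₜ w) = ((-1 : ℚ) ^ i) • (b ⊗ₜ[ℚ] L.d w) := by
  rw [dRight, TensorProduct.map_tmul, CDGA.sgn_apply hb, TensorProduct.smul_tmul']

theorem evenPart_add_oddPart (x : A ⊗[ℚ] L) : evenPart A L x + oddPart A L x = x := by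
  refine tensor_induction x (by simp) (fun i j b w hb hw => ?_) (fun x y hx hy => ?_)
  · rw [evenPart_tmul hb, oddPart_tmul hb]
    split_ifs <;> simp
  · nth_rewrite 3 [← hx]
    nth_rewrite 3 [← hy]
    simp only [map_add]
    abel

theorem evenPart_eq_self {x : A ⊗[ℚ] L} (h : oddPart A L x = 0) : evenPart A L x = x := by
  have := evenPart_add_oddPart x
  rwa [h, add_zero] at this

theorem evenPart_dLeft (x : A ⊗[ℚ] L) :
    evenPart A L (dLeft A L x) = dLeft A L (oddPart A L x) := by
  refine tensor_induction x (by simp) (fun i j b w hb hw => ?_) (fun x y hx hy => ?_)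
  · rw [dLeft_tmul, evenPart_tmul (A.d_mem hb), oddPart_tmul hb]
    by_cases h : Even i <;> simp [h, Nat.even_add_one, dLeft_tmul]
  · simp only [map_add, hx, hy]

theorem oddPart_dLeft (x : A ⊗[ℚ] L) :
    oddPart A L (dLeft A L x) = dLeft A L (evenPart A L x) := by
  refine tensor_induction x (by simp) (fun i j b w hb hw => ?_) (fun x y hx hy => ?_)
  · rw [dLeft_tmul, oddPart_tmul (A.d_mem hb), evenPart_tmul hb]
    by_cases h : Even i <;> simp [h, Nat.even_add_one, dLeft_tmul]
  · simp only [map_add, hx, hy]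

theorem evenPart_dRight (x : A ⊗[ℚ] L) :
    evenPart A L (dRight A L x) = dRight A L (evenPart A L x) := by
  refine tensor_induction x (by simp) (fun i j b w hb hw => ?_) (fun x y hx hy => ?_)
  · rw [dRight_tmul hb, map_smul, evenPart_tmul hb, evenPart_tmul hb]
    split_ifs <;> simp [dRight_tmul hb]
  · simp only [map_add, hx, hy]

theorem oddPart_dRight (x : A ⊗[ℚ] L) :
    oddPart A L (dRight A L x) = dRight A L (oddPart A L x) := by
  refine tensor_induction x (by simp) (fun i j b w hb hw => ?_) (fun x y hx hy => ?_)
  · rw [dRight_tmul hb, map_smul, oddPart_tmul hb, oddPart_tmul hb]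
    split_ifs <;> simp [dRight_tmul hb]
  · simp only [map_add, hx, hy]

theorem evenPart_tensorBracket {g : A ⊗[ℚ] L} (hg : oddPart A L g = 0) (x : A ⊗[ℚ] L) :
    evenPart A L (tensorBracket A L g x) = tensorBracket A L g (evenPart A L x) := by
  rw [← evenPart_eq_self hg]
  generalize g = g
  refine tensor_induction g (by simp) (fun i j b w hb hw => ?_) (fun x y hx hy => ?_)
  · refine tensor_induction x (by simp) (fun i' j' b' w' hb' hw' => ?_) (fun x y hx hy => ?_)
    · rw [evenPart_tmul hb, evenPart_tmul hb']
      by_cases h : Even i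
      · rw [if_pos h, tensorBracket_tmul A L b w' hw hb', map_smul,
          evenPart_tmul (CDGA.mul_mem_deg hb hb' rfl)]
        by_cases h' : Even i' <;> simp [h, h', Nat.even_add, tensorBracket_tmul A L b w' hw hb']
      · simp [h]
    · simp only [map_add, hx, hy]
  · simp only [map_add, LinearMap.add_apply, hx, hy]

theorem oddPart_tensorBracket_oddPart (x y : A ⊗[ℚ] L) :
    oddPart A L (tensorBracket A L (oddPart A L x) (oddPart A L y)) = 0 := by
  refine tensor_induction x (by simp) (fun i j b w hb hw => ?_) (fun x x' hx hx' => ?_)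
  · refine tensor_induction y (by simp) (fun i' j' b' w' hb' hw' => ?_) (fun x y hx hy => ?_)
    · rw [oddPart_tmul hb, oddPart_tmul hb']
      by_cases h : Even i
      · simp [h]
      · by_cases h' : Even i'
        · simp [h']
        · rw [if_neg h, if_neg h', tensorBracket_tmul A L b w' hw hb', map_smul,
            oddPart_tmul (CDGA.mul_mem_deg hb hb' rfl)]
          simp [h, h', Nat.even_add]
    · simp only [map_add, hx, hy, add_zero]
  · simp only [map_add, LinearMap.add_apply, hx, hx', add_zero]

theorem tensorBracket_antisymm {g : A ⊗[ℚ] L} (hg : g ∈ tensorDeg A L 0) (x : A ⊗[ℚ] L) :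
    tensorBracket A L g x = -tensorBracket A L x g := by
  refine tensorDeg_induction g hg (by simp) (fun i j b w h hb hw => ?_) (fun x x' hx hx' => ?_)
  · refine tensor_induction x (by simp) (fun i' j' b' w' hb' hw' => ?_)
      (fun x x' hx hx' => ?_)
    · rw [tensorBracket_tmul A L b w' hw hb', tensorBracket_tmul A L b' w hw' hb,
        L.antisymm hw' hw, A.comm hb' hb, ← zpow_natCast, TensorProduct.tmul_neg,
        TensorProduct.tmul_smul, ← TensorProduct.smul_tmul', smul_neg, smul_smul, smul_smul,
        neg_neg]
      congr 1
      obtain rfl : j = -i := by omega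
      rw [← zpow_add₀ (by norm_num : (-1 : ℚ) ≠ 0), ← zpow_add₀ (by norm_num : (-1 : ℚ) ≠ 0)]
      exact neg_one_zpow_eq (-(i * i')) (by push_cast; ring)
    · rw [map_add, hx, hx', map_add, LinearMap.add_apply, neg_add]
  · rw [map_add, LinearMap.add_apply, hx, hx', map_add, neg_add]

/-- Operators on the left factor preserve `A ⊗ W`. -/
theorem rTensor_mem_tens {W : Submodule ℚ L} (f : A →ₗ[ℚ] A) {x : A ⊗[ℚ] L} (hx : x ∈ tens A W) :
    f.rTensor L x ∈ tens A W := by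
  refine tens_induction x hx (by simp) (fun i b hb w hw => ?_) (fun x y hx hy => ?_)
  · exact tmul_mem_tens _ hw
  · rw [map_add]; exact add_mem hx hy

theorem evenPart_mem_tens {W : Submodule ℚ L} {x : A ⊗[ℚ] L} (hx : x ∈ tens A W) :
    evenPart A L x ∈ tens A W := rTensor_mem_tens _ hx

theorem oddPart_mem_tens {W : Submodule ℚ L} {x : A ⊗[ℚ] L} (hx : x ∈ tens A W) :
    oddPart A L x ∈ tens A W := rTensor_mem_tens _ hx

theorem dLeft_mem_tens {W : Submodule ℚ L} {x : A ⊗[ℚ] L} (hx : x ∈ tens A W) :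
    dLeft A L x ∈ tens A W := rTensor_mem_tens _ hx

theorem dRight_mem_tens {W W' : Submodule ℚ L} (h : ∀ w ∈ W, L.d w ∈ W') {x : A ⊗[ℚ] L}
    (hx : x ∈ tens A W) : dRight A L x ∈ tens A W' := by
  refine tens_induction x hx (by simp) (fun i b hb w hw => ?_) (fun x y hx hy => ?_)
  · exact tmul_mem_tens _ (h w hw)
  · rw [map_add]; exact add_mem hx hy

theorem oddPart_mem_tensorDeg {n : ℤ} {x : A ⊗[ℚ] L} (hx : x ∈ tensorDeg A L n) :
    oddPart A L x ∈ tensorDeg A L n := by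
  refine tensorDeg_induction x hx (by simp) (fun i j b w h hb hw => ?_) (fun x y hx hy => ?_)
  · rw [oddPart_tmul hb]
    split_ifs
    · exact zero_mem _
    · exact tmul_mem_tensorDeg hb hw h
  · rw [map_add]; exact add_mem hx hy

theorem evenPart_mem_tensorDeg {n : ℤ} {x : A ⊗[ℚ] L} (hx : x ∈ tensorDeg A L n) :
    evenPart A L x ∈ tensorDeg A L n := by
  have := sub_mem hx (oddPart_mem_tensorDeg hx)
  rwa [sub_eq_of_eq_add (evenPart_add_oddPart x).symm] at this

/-- If `[L, P] ⊆ J` and the even part of `α` lies in `A ⊗ P`, then up to `A ⊗ J` the odd part of the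
curvature of `α` is linear in `α`. -/
theorem oddPart_curvature_sub_mem {P J : Submodule ℚ L} (h : ∀ x, ∀ w ∈ P, L.bracket x w ∈ J)
    {α : A ⊗[ℚ] L} (hα : α ∈ tensorDeg A L 1) (hP : evenPart A L α ∈ tens A P) :
    oddPart A L (curvature A L α) - dLeft A L (evenPart A L α) - dRight A L (oddPart A L α) ∈
      tens A J := by
  have e : curvature A L α = dLeft A L α + dRight A L α + (1 / 2 : ℚ) •
      (tensorBracket A L (oddPart A L α) (oddPart A L α) +
        tensorBracket A L α (evenPart A L α) +
        tensorBracket A L (oddPart A L α) (evenPart A L α)) := by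
    rw [curvature, tensorD_eq]
    congr 2
    have hs := tensorBracket_symm (oddPart_mem_tensorDeg hα) (evenPart_mem_tensorDeg hα)
    have ha := evenPart_add_oddPart α
    generalize evenPart A L α = a at *
    generalize oddPart A L α = b at *
    subst ha
    simp only [map_add, LinearMap.add_apply, hs]
    abel
  rw [e, map_add, map_add, map_smul, map_add, map_add, oddPart_tensorBracket_oddPart,
    oddPart_dLeft, oddPart_dRight, zero_add]
  have := Submodule.smul_mem _ (1 / 2 : ℚ) (add_mem
    (oddPart_mem_tens (tensorBracket_mem_tens h α hP))
    (oddPart_mem_tens (tensorBracket_mem_tens h (oddPart A L α) hP)))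
  convert this using 1
  abel

end DGLA

/-! ### Functoriality of `A ⊗ L` in `A` -/

namespace CDGA.Hom

open DGLA

variable {A : CDGA.{u}} {B : CDGA.{w}} (f : CDGA.Hom A B) (L : DGLA.{v})

/-- The linear map `A ⊗ L → B ⊗ L` induced by a morphism `A → B`. -/
def tensorMap : A ⊗[ℚ] L →ₗ[ℚ] B ⊗[ℚ] L := f.toAlgHom.toLinearMap.rTensor L

theorem tensorMap_tmul (b : A) (w : L) : f.tensorMap L (b ⊗ₜ w) = f.toAlgHom b ⊗ₜ w := rfl

variable {L}

theorem tensorMap_tensorBracket (x y : A ⊗[ℚ] L) :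
    f.tensorMap L (tensorBracket A L x y) =
      tensorBracket B L (f.tensorMap L x) (f.tensorMap L y) := by
  refine tensor_induction x (by simp) (fun i j b w hb hw => ?_) (fun x x' hx hx' => ?_)
  · refine tensor_induction y (by simp) (fun i' j' b' w' hb' hw' => ?_) (fun x y hx hy => ?_)
    · rw [tensorBracket_tmul A L b w' hw hb', map_smul, tensorMap_tmul, tensorMap_tmul,
        tensorMap_tmul, tensorBracket_tmul B L _ w' hw (f.map_deg hb'), map_mul]
    · simp only [map_add, hx, hy]
  · simp only [map_add, LinearMap.add_apply, hx, hx']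

theorem tensorMap_dLeft (x : A ⊗[ℚ] L) :
    f.tensorMap L (dLeft A L x) = dLeft B L (f.tensorMap L x) := by
  refine tensor_induction x (by simp) (fun i j b w hb hw => ?_) (fun x x' hx hx' => ?_)
  · rw [dLeft_tmul, tensorMap_tmul, tensorMap_tmul, dLeft_tmul, f.map_d]
  · simp only [map_add, hx, hx']

theorem tensorMap_dRight (x : A ⊗[ℚ] L) :
    f.tensorMap L (dRight A L x) = dRight B L (f.tensorMap L x) := by
  refine tensor_induction x (by simp) (fun i j b w hb hw => ?_) (fun x x' hx hx' => ?_)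
  · rw [dRight_tmul hb, map_smul, tensorMap_tmul, tensorMap_tmul, dRight_tmul (f.map_deg hb)]
  · simp only [map_add, hx, hx']

theorem tensorMap_curvature (x : A ⊗[ℚ] L) :
    f.tensorMap L (curvature A L x) = curvature B L (f.tensorMap L x) := by
  rw [curvature, curvature, tensorD_eq, tensorD_eq, map_add, map_add, map_smul,
    f.tensorMap_tensorBracket, f.tensorMap_dLeft, f.tensorMap_dRight]

theorem tensorMap_evenPart (x : A ⊗[ℚ] L) :
    f.tensorMap L (evenPart A L x) = evenPart B L (f.tensorMap L x) := by
  refine tensor_induction x (by simp) (fun i j b w hb hw => ?_) (fun x x' hx hx' => ?_)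
  · rw [evenPart_tmul hb, tensorMap_tmul, evenPart_tmul (f.map_deg hb)]
    split_ifs <;> simp [tensorMap_tmul]
  · simp only [map_add, hx, hx']

theorem tensorMap_oddPart (x : A ⊗[ℚ] L) :
    f.tensorMap L (oddPart A L x) = oddPart B L (f.tensorMap L x) := by
  refine tensor_induction x (by simp) (fun i j b w hb hw => ?_) (fun x x' hx hx' => ?_)
  · rw [oddPart_tmul hb, tensorMap_tmul, oddPart_tmul (f.map_deg hb)]
    split_ifs <;> simp [tensorMap_tmul]
  · simp only [map_add, hx, hx']

theorem tensorMap_mem_tensorDeg {n : ℤ} {x : A ⊗[ℚ] L} (hx : x ∈ tensorDeg A L n) :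
    f.tensorMap L x ∈ tensorDeg B L n := by
  refine tensorDeg_induction x hx (by simp) (fun i j b w h hb hw => ?_) (fun x y hx hy => ?_)
  · exact tmul_mem_tensorDeg (f.map_deg hb) hw h
  · rw [map_add]; exact add_mem hx hy

theorem tensorMap_mem_tens {W : Submodule ℚ L} {x : A ⊗[ℚ] L} (hx : x ∈ tens A W) :
    f.tensorMap L x ∈ tens B W := by
  refine tens_induction x hx (by simp) (fun i b hb w hw => ?_) (fun x y hx hy => ?_)
  · exact tmul_mem_tens _ hw
  · rw [map_add]; exact add_mem hx hy

theorem tensorMap_comp {C : CDGA.{w}} (g : CDGA.Hom B C) (x : A ⊗[ℚ] L) :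
    (g.comp f).tensorMap L x = g.tensorMap L (f.tensorMap L x) := by
  refine tensor_induction x (by simp) (fun i j b w hb hw => rfl) (fun x x' hx hx' => ?_)
  simp only [map_add, hx, hx']

end CDGA.Hom

/-! ### Splitting the even part of an element of degree one -/

namespace DGLA

variable {A : CDGA.{u}} {L : DGLA.{v}}

variable (A L) in
/-- The projection of `A ⊗ L` onto `Aⁱ ⊗ L`. -/
def leftProj (i : ℕ) : Module.End ℚ (A ⊗[ℚ] L) := (gradedProj A.deg i).rTensor L

theorem leftProj_tmul_same {i : ℕ} {b : A} (hb : b ∈ A.deg i) (w : L) :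
    leftProj A L i (b ⊗ₜ w) = b ⊗ₜ w := by
  rw [leftProj, LinearMap.rTensor_tmul, gradedProj_same _ hb]

theorem leftProj_tmul_ne {i k : ℕ} (h : k ≠ i) {b : A} (hb : b ∈ A.deg k) (w : L) :
    leftProj A L i (b ⊗ₜ w) = 0 := by
  rw [leftProj, LinearMap.rTensor_tmul, gradedProj_ne _ h hb, TensorProduct.zero_tmul]

theorem mem_of_leftProj_mem {S : Submodule ℚ (A ⊗[ℚ] L)} {x : A ⊗[ℚ] L}
    (h : ∀ i, leftProj A L i x ∈ S) : x ∈ S := by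
  have key : ∀ x : A ⊗[ℚ] L, ∃ s : Finset ℕ, ∀ t, s ⊆ t → x = ∑ i ∈ t, leftProj A L i x := by
    classical
    intro x
    induction x with
    | zero => exact ⟨∅, by simp⟩
    | tmul b w =>
      obtain ⟨s, hs⟩ := exists_sum_gradedProj_of_subset A.deg b
      refine ⟨s, fun t ht => ?_⟩
      conv_lhs => rw [hs t ht, TensorProduct.sum_tmul]
      rfl
    | add x y hx hy =>
      obtain ⟨s, hs⟩ := hx
      obtain ⟨s', hs'⟩ := hy
      refine ⟨s ∪ s', fun t ht => ?_⟩
      simp only [map_add, Finset.sum_add_distrib]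
      rw [← hs t (Finset.union_subset_left ht), ← hs' t (Finset.union_subset_right ht)]
  obtain ⟨s, hs⟩ := key x
  rw [hs s le_rfl]
  exact sum_mem fun i _ => h i

theorem leftProj_mem_tensorBox {i : ℕ} {j n : ℤ} (h : (i : ℤ) + j = n) {x : A ⊗[ℚ] L}
    (hx : x ∈ tensorDeg A L n) : leftProj A L i x ∈ tensorBox (A.deg i) (L.deg j) := by
  refine tensorDeg_induction x hx (by simp) (fun i' j' b w h' hb hw => ?_) (fun x y hx hy => ?_)
  · rcases eq_or_ne i' i with rfl | hi
    · obtain rfl : j' = j := by omega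
      rw [leftProj_tmul_same hb]
      exact tmul_mem_tensorBox hb hw
    · rw [leftProj_tmul_ne hi hb]; exact zero_mem _
  · rw [map_add]; exact add_mem hx hy

theorem leftProj_mem_tens (i : ℕ) {W : Submodule ℚ L} {x : A ⊗[ℚ] L} (hx : x ∈ tens A W) :
    leftProj A L i x ∈ tens A W := rTensor_mem_tens _ hx

theorem leftProj_evenPart (i : ℕ) (x : A ⊗[ℚ] L) :
    leftProj A L i (evenPart A L x) = if Even i then leftProj A L i x else 0 := by
  refine tensor_induction x (by simp) (fun i' j b w hb hw => ?_) (fun x x' hx hx' => ?_)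
  · rw [evenPart_tmul hb]
    rcases eq_or_ne i' i with rfl | hi
    · split_ifs <;> simp
    · split_ifs <;> simp [leftProj_tmul_ne hi hb]
  · simp only [map_add, hx, hx']
    split_ifs <;> simp

theorem leftProj_dLeft (i : ℕ) (x : A ⊗[ℚ] L) :
    leftProj A L (i + 1) (dLeft A L x) = dLeft A L (leftProj A L i x) := by
  refine tensor_induction x (by simp) (fun i' j b w hb hw => ?_) (fun x x' hx hx' => ?_)
  · rw [dLeft_tmul]
    rcases eq_or_ne i' i with rfl | hi
    · rw [leftProj_tmul_same (A.d_mem hb), leftProj_tmul_same hb, dLeft_tmul]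
    · rw [leftProj_tmul_ne (by omega) (A.d_mem hb), leftProj_tmul_ne hi hb, map_zero]
  · simp only [map_add, hx, hx']

theorem leftProj_dRight (i : ℕ) (x : A ⊗[ℚ] L) :
    leftProj A L i (dRight A L x) = dRight A L (leftProj A L i x) := by
  refine tensor_induction x (by simp) (fun i' j b w hb hw => ?_) (fun x x' hx hx' => ?_)
  · rw [dRight_tmul hb, map_smul]
    rcases eq_or_ne i' i with rfl | hi
    · rw [leftProj_tmul_same hb, leftProj_tmul_same hb, dRight_tmul hb]
    · rw [leftProj_tmul_ne hi hb, leftProj_tmul_ne hi hb, smul_zero, map_zero]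
  · simp only [map_add, hx, hx']

variable (A) in
/-- The span of the tensors `b ⊗ w` of total degree one with `b` a cocycle of positive even degree
and `w ∈ P`. -/
def closedEven (P : Submodule ℚ L) : Submodule ℚ (A ⊗[ℚ] L) :=
  Submodule.span ℚ {x | ∃ (i : ℕ) (b : A) (w : L), Even i ∧ 0 < i ∧ b ∈ A.deg i ∧ A.d b = 0 ∧
    w ∈ P ∧ w ∈ L.deg (1 - i) ∧ x = b ⊗ₜ w}

/-- If `[L, P] ⊆ J`, if the even part of `α` lies in `A ⊗ P` and the curvature in `A ⊗ J`, then
up to `A ⊗ J` the even part of `α` is the sum of an element of `A ⊗ d L` and a combination of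
cocycles.  To see this, one splits off the part of `P` that is in `J + d L`: on a complement
the curvature condition says that the coefficients are closed. -/
theorem exists_dRight_add_closedEven (hL : L.IsNonpositive) {P J : Submodule ℚ L}
    (h : ∀ x, ∀ w ∈ P, L.bracket x w ∈ J) {α : A ⊗[ℚ] L} (hα : α ∈ tensorDeg A L 1)
    (hP : evenPart A L α ∈ tens A P) (hF : curvature A L α ∈ tens A J) :
    ∃ g ∈ tensorDeg A L 0, oddPart A L g = 0 ∧ ∃ r ∈ closedEven A P,
      evenPart A L α - dRight A L g - r ∈ tens A J := by
  have key : evenPart A L α ∈ (Submodule.map (dRight A L) (tensorDeg A L 0 ⊓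
      LinearMap.ker (oddPart A L)) ⊔ closedEven A P) ⊔ tens A J := by
    refine mem_of_leftProj_mem fun i => ?_
    rw [leftProj_evenPart]
    split_ifs with hi
    swap
    · exact zero_mem _
    have hbox := leftProj_mem_tensorBox (show (i : ℤ) + (1 - i) = 1 by ring) hα
    rcases Nat.eq_zero_or_pos i with rfl | hi0
    · rw [hL _ (by norm_num), tensorBox, Submodule.map₂_bot_right, Submodule.mem_bot] at hbox
      rw [hbox]; exact zero_mem _
    have hbox' : leftProj A L i α ∈ tensorBox (A.deg i) (P ⊓ L.deg (1 - i)) := by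
      have h1 : leftProj A L i α ∈ tens A P := by
        have := leftProj_mem_tens i hP
        rwa [leftProj_evenPart, if_pos hi] at this
      have := tensorBox_inf (U := ⊤) (W := P) h1 hbox
      rwa [top_inf_eq] at this
    set K : Submodule ℚ L := J ⊔ (L.deg (-i)).map L.d with hK
    set P' := P ⊓ L.deg (1 - i) with hP'
    obtain ⟨C, hC⟩ := Submodule.exists_isCompl (P' ⊓ K)
    have hsup : P' = (P' ⊓ K) ⊔ (C ⊓ P') := by
      rw [← sup_inf_assoc_of_le C (inf_le_left : P' ⊓ K ≤ P'), hC.sup_eq_top, top_inf_eq]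
    rw [hsup, tensorBox, Submodule.map₂_sup_right, Submodule.mem_sup] at hbox'
    obtain ⟨q, hq, r, hr, hqr⟩ := hbox'
    -- `d r` has coefficients in `K` by the curvature condition and in the complement `C`
    have hdr : dLeft A L r = 0 := by
      have h1 : dLeft A L (leftProj A L i α) ∈ tens A K := by
        have h2 : dLeft A L (evenPart A L α) + dRight A L (oddPart A L α) ∈ tens A J := by
          have := sub_mem (oddPart_mem_tens hF) (oddPart_curvature_sub_mem h hα hP)
          convert this using 1
          abel
        have h3 := leftProj_mem_tens (i + 1) h2
        rw [map_add, leftProj_dLeft, leftProj_dRight, leftProj_evenPart, if_pos hi] at h3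
        have h4 : dRight A L (leftProj A L (i + 1) (oddPart A L α)) ∈
            tens A ((L.deg (-i)).map L.d) := by
          refine dRight_mem_tens (W := L.deg (-i)) (fun w hw => Submodule.mem_map_of_mem hw) ?_
          exact Submodule.map₂_le_map₂_left le_top (leftProj_mem_tensorBox
            (by push_cast; ring) (oddPart_mem_tensorDeg hα))
        have := sub_mem (tens_mono (le_sup_left : J ≤ K) h3) (tens_mono (le_sup_right : _ ≤ K) h4)
        rwa [add_sub_cancel_right] at this
      have h2 : dLeft A L r ∈ tens A K := by
        have h3 : dLeft A L q ∈ tens A K := dLeft_mem_tens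
          (Submodule.map₂_le_map₂ le_top inf_le_right hq)
        rw [← hqr, map_add] at h1
        exact (Submodule.add_mem_iff_right _ h3).1 h1
      have h3 : dLeft A L r ∈ tens A (C ⊓ P') := dLeft_mem_tens
          (Submodule.map₂_le_map₂_left le_top hr)
      have h4 := tensorBox_inf h2 h3
      have h5 : K ⊓ (C ⊓ P') = ⊥ := by
        rw [← hC.inf_eq_bot]; ac_rfl
      rwa [h5, tensorBox, Submodule.map₂_bot_right, Submodule.mem_bot] at h4
    rw [← hqr]
    refine add_mem ?_ (Submodule.mem_sup_left (Submodule.mem_sup_right ?_))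
    · refine tensorBox_le (fun b hb w hw => ?_) hq
      obtain ⟨j, hj, t, ht, e⟩ := Submodule.mem_sup.1 hw.2
      obtain ⟨η, hη, rfl⟩ := ht
      rw [← e, TensorProduct.tmul_add, add_comm]
      refine Submodule.add_mem_sup (Submodule.mem_sup_left ⟨b ⊗ₜ η, ⟨?_, ?_⟩, ?_⟩)
        (tmul_mem_tens b hj)
      · exact tmul_mem_tensorDeg hb hη (by ring)
      · change oddPart A L _ = 0
        rw [oddPart_tmul hb, if_pos hi]
      · rw [dRight_tmul hb, hi.neg_one_pow, one_smul]
    · have h1 := tensorBox_inf hr (mem_tensorBox_ker_of_rTensor_eq_zero hdr)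
      refine tensorBox_le (fun b hb w hw => ?_) h1
      exact Submodule.subset_span ⟨i, b, w, hi, hi0, hb.1, hb.2, hw.1.2.1, hw.1.2.2, rfl⟩
  obtain ⟨y, hy, t, ht, e⟩ := Submodule.mem_sup.1 key
  obtain ⟨_, ⟨g, hg, rfl⟩, r, hr, rfl⟩ := Submodule.mem_sup.1 hy
  refine ⟨g, hg.1, hg.2, r, hr, ?_⟩
  rw [← e]
  convert ht using 1
  abel

end DGLA

/-! ### Killing Maurer–Cartan products by fibrations -/

theorem eq_zero_of_tmul_eq_zero {M N : Type*} [AddCommGroup M] [Module ℚ M] [AddCommGroup N]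
    [Module ℚ N] {m : M} {n : N} (hn : n ≠ 0) (h : m ⊗ₜ[ℚ] n = 0) : m = 0 := by
  obtain ⟨ψ, hψ⟩ : ∃ ψ : Module.Dual ℚ N, ψ n ≠ 0 := by
    by_contra! hc
    exact hn ((Module.forall_dual_apply_eq_zero_iff ℚ n).1 hc)
  have := congrArg (fun t => TensorProduct.rid ℚ M (LinearMap.lTensor M ψ t)) h
  simpa [hψ] using this

namespace AlgebraicFibration

open DGLA

variable {A : CDGA.{u}} {L : DGLA.{v}}

theorem Over.comp_tensorMap {F F' F'' : AlgebraicFibration.{u, w} A} (g : Over F' F'')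
    (f : Over F F') (x : F.total ⊗[ℚ] L) :
    (g.comp f).hom.tensorMap L x = g.hom.tensorMap L (f.hom.tensorMap L x) :=
  f.hom.tensorMap_comp g.hom x

/-- In a larger bounded fibration, combinations of even cocycles become exact. -/
theorem IsBounded.exists_over_dLeft_eq {F : AlgebraicFibration.{u, w} A} (hF : F.IsBounded)
    {P : Submodule ℚ L} {x : F.total ⊗[ℚ] L} (hx : x ∈ closedEven F.total P) :
    ∃ (F' : AlgebraicFibration.{u, w} A) (f : Over F F'), F'.IsBounded ∧
      ∃ g ∈ tensorDeg F'.total L 0, g ∈ tens F'.total P ∧ evenPart F'.total L g = 0 ∧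
        dLeft F'.total L g = f.hom.tensorMap L x := by
  have key : ∀ (F₁ : AlgebraicFibration.{u, w} A) (h : Over F F₁), F₁.IsBounded →
      ∃ (F' : AlgebraicFibration.{u, w} A) (f : Over F₁ F'), F'.IsBounded ∧
        ∃ g ∈ tensorDeg F'.total L 0, g ∈ tens F'.total P ∧ evenPart F'.total L g = 0 ∧
          dLeft F'.total L g = (f.comp h).hom.tensorMap L x := by
    induction hx using Submodule.span_induction with
    | mem x hx =>
      obtain ⟨i, b, w, hi, hi0, hb, hdb, hwP, hw, rfl⟩ := hx
      intro F₁ h hF₁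
      obtain ⟨F', f, hF', p, hp, hdp⟩ := hF₁.exists_over_exact hi hi0 (h.hom.map_deg hb)
        (by rw [← h.hom.map_d, hdb, map_zero])
      refine ⟨F', f, hF', p ⊗ₜ w, tmul_mem_tensorDeg hp hw (by omega), tmul_mem_tens p hwP, ?_, ?_⟩
      · rw [evenPart_tmul hp, if_neg]
        obtain ⟨k, rfl⟩ := hi
        exact fun h => by obtain ⟨m, hm⟩ := h; omega
      · rw [dLeft_tmul, hdp]; rfl
    | zero =>
      intro F₁ h hF₁
      exact ⟨F₁, Over.id F₁, hF₁, 0, zero_mem _, zero_mem _, map_zero _, by simp⟩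
    | add x y _ _ hx hy =>
      intro F₁ h hF₁
      obtain ⟨F₂, f₂, hF₂, g₂, h1, h2, h3, h4⟩ := hx F₁ h hF₁
      obtain ⟨F₃, f₃, hF₃, g₃, h1', h2', h3', h4'⟩ := hy F₂ (f₂.comp h) hF₂
      refine ⟨F₃, f₃.comp f₂, hF₃, f₃.hom.tensorMap L g₂ + g₃,
        add_mem (f₃.hom.tensorMap_mem_tensorDeg h1) h1',
        add_mem (f₃.hom.tensorMap_mem_tens h2) h2', ?_, ?_⟩
      · rw [map_add, ← f₃.hom.tensorMap_evenPart, h3, h3', map_zero, add_zero]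
      · rw [map_add, ← f₃.hom.tensorMap_dLeft, h4, h4', map_add]
        simp only [Over.comp_tensorMap]
    | smul r x _ hx =>
      intro F₁ h hF₁
      obtain ⟨F₂, f₂, hF₂, g₂, h1, h2, h3, h4⟩ := hx F₁ h hF₁
      exact ⟨F₂, f₂, hF₂, r • g₂, Submodule.smul_mem _ _ h1, Submodule.smul_mem _ _ h2,
        by rw [map_smul, h3, smul_zero], by rw [map_smul, h4, map_smul]⟩
  exact key F (Over.id F) hF

/-- One step of pushing the even part of `α` down a central filtration: a gauge transformation
over a larger fibration moves the even part from `P` into `J ⊇ [L, P]`. -/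
theorem IsBounded.exists_over_evenPart_mem {F : AlgebraicFibration.{u, w} A} (hF : F.IsBounded)
    (hL : L.IsNilpotent) (hL' : L.IsNonpositive) {Z P J : Submodule ℚ L} (hZJ : Z ≤ J) (hJP : J ≤ P)
    (hZ : ∀ x, ∀ z ∈ Z, L.bracket x z = 0) (h : ∀ x, ∀ w ∈ P, L.bracket x w ∈ J)
    {α : F.total ⊗[ℚ] L} (hα : α ∈ tensorDeg F.total L 1)
    (hαP : evenPart F.total L α ∈ tens F.total P) (hαF : curvature F.total L α ∈ tens F.total Z) :
    ∃ (F' : AlgebraicFibration.{u, w} A) (f : Over F F'), F'.IsBounded ∧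
      ∃ β ∈ tensorDeg F'.total L 1, evenPart F'.total L β ∈ tens F'.total J ∧
        curvature F'.total L β = f.hom.tensorMap L (curvature F.total L α) := by
  -- `g₁` has even coefficients and removes the part in `A ⊗ d L`; `g₂` has odd coefficients and
  -- removes the combination of cocycles
  obtain ⟨g₁, hg₁, hg₁o, r, hr, hrem⟩ := exists_dRight_add_closedEven hL' h hα hαP
    (tens_mono hZJ hαF)
  obtain ⟨F', f, hF', g₂, hg₂, hg₂P, hg₂e, hg₂d⟩ := hF.exists_over_dLeft_eq hr
  refine ⟨F', f, hF', ?_⟩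
  replace hg₁ := f.hom.tensorMap_mem_tensorDeg hg₁
  replace hα := f.hom.tensorMap_mem_tensorDeg hα
  replace hαP := f.hom.tensorMap_mem_tens hαP
  replace hαF := f.hom.tensorMap_mem_tens hαF
  replace hrem := f.hom.tensorMap_mem_tens hrem
  replace hg₁o := congrArg (f.hom.tensorMap L) hg₁o
  rw [map_sub, map_sub, f.hom.tensorMap_evenPart, f.hom.tensorMap_dRight, ← hg₂d] at hrem
  rw [f.hom.tensorMap_oddPart, map_zero] at hg₁o
  rw [f.hom.tensorMap_evenPart] at hαP
  rw [f.hom.tensorMap_curvature] at hαF ⊢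
  generalize f.hom.tensorMap L α = α at *
  generalize f.hom.tensorMap L g₁ = g₁ at *
  have hg : g₁ + g₂ ∈ tensorDeg F'.total L 0 := add_mem hg₁ hg₂
  obtain ⟨β, hβ, hβF, hβS⟩ := exists_gauge hL hg hα (by
    have := tensorBracket_mem_tens (W' := ⊥) hZ (g₁ + g₂) hαF
    rwa [tens_bot, Submodule.mem_bot] at this)
  have hsplit : ∀ x : F'.total ⊗[ℚ] L, evenPart F'.total L x ∈ tens F'.total P →
      evenPart F'.total L (tensorBracket F'.total L (g₁ + g₂) x) ∈ tens F'.total J := fun x hx => by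
    rw [map_add, LinearMap.add_apply, map_add, evenPart_tensorBracket hg₁o,
      tensorBracket_antisymm hg₂ x]
    exact add_mem (tensorBracket_mem_tens h _ hx)
      (evenPart_mem_tens (neg_mem (tensorBracket_mem_tens h _ hg₂P)))
  have hD : evenPart F'.total L (tensorD F'.total L (g₁ + g₂)) =
      dRight F'.total L g₁ + dLeft F'.total L g₂ := by
    have e1 := evenPart_eq_self hg₁o
    have e2 : oddPart F'.total L g₂ = g₂ := by simpa [hg₂e] using evenPart_add_oddPart g₂
    rw [tensorD_eq, map_add, evenPart_dLeft, evenPart_dRight, map_add, map_add, map_add, hg₁o, e1,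
      e2, hg₂e, map_zero, zero_add, add_zero, add_comm]
  -- to first order the gauge transformation moves the even part of `α` into `A ⊗ J`
  have hv : evenPart F'.total L (tensorBracket F'.total L (g₁ + g₂) α -
      tensorD F'.total L (g₁ + g₂)) +
      evenPart F'.total L α ∈ tens F'.total J := by
    rw [map_sub, hD]
    convert add_mem (hsplit α hαP) hrem using 1
    abel
  refine ⟨β, hβ, ?_, hβF⟩
  -- the terms of higher order arise from brackets with elements of `A ⊗ P`
  have h1 := hβS ((tens F'.total J).comap (evenPart F'.total L))
    (hsplit _ (by
      have := sub_mem (tens_mono hJP hv) hαP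
      rwa [add_sub_cancel_right] at this))
    (fun x hx => hsplit x (tens_mono hJP hx))
  rw [Submodule.mem_comap, map_sub, map_sub] at h1
  convert add_mem h1 hv using 1
  abel

theorem lowerCentralSeries_succ_le (j : ℕ) :
    L.lowerCentralSeries (j + 1) ≤ L.lowerCentralSeries j := by
  induction j with
  | zero => exact le_top
  | succ j ih => exact Submodule.map₂_le_map₂_right ih

/-- If the curvature of `α` is central, the even part of `α` can be made central without changing
the curvature, by gauge transformations over a larger fibration. -/
theorem IsBounded.exists_over_evenPart_mem_center {F : AlgebraicFibration.{u, w} A}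
    (hF : F.IsBounded) (hL : L.IsNilpotent) (hL' : L.IsNonpositive) {Z : Submodule ℚ L}
    (hZ : ∀ x, ∀ z ∈ Z, L.bracket x z = 0) {α : F.total ⊗[ℚ] L} (hα : α ∈ tensorDeg F.total L 1)
    (hαF : curvature F.total L α ∈ tens F.total Z) :
    ∃ (F' : AlgebraicFibration.{u, w} A) (f : Over F F'), F'.IsBounded ∧
      ∃ β ∈ tensorDeg F'.total L 1, evenPart F'.total L β ∈ tens F'.total Z ∧
        curvature F'.total L β = f.hom.tensorMap L (curvature F.total L α) := by
  have key : ∀ j, ∃ (F' : AlgebraicFibration.{u, w} A) (f : Over F F'), F'.IsBounded ∧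
      ∃ β ∈ tensorDeg F'.total L 1,
        evenPart F'.total L β ∈ tens F'.total (L.lowerCentralSeries j ⊔ Z) ∧
        curvature F'.total L β = f.hom.tensorMap L (curvature F.total L α) := by
    intro j
    induction j with
    | zero =>
      refine ⟨F, Over.id F, hF, α, hα, tens_mono le_sup_left (tens_top _), ?_⟩
      simp [CDGA.Hom.tensorMap, Over.id, CDGA.Hom.id]
    | succ j ih =>
      obtain ⟨F₁, f₁, hF₁, α₁, hα₁, hα₁P, hα₁F⟩ := ih
      obtain ⟨F₂, f₂, hF₂, β, hβ, hβP, hβF⟩ := hF₁.exists_over_evenPart_mem hL hL'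
        (Z := Z) (P := L.lowerCentralSeries j ⊔ Z) (J := L.lowerCentralSeries (j + 1) ⊔ Z)
        le_sup_right (sup_le_sup_right (lowerCentralSeries_succ_le j) Z) hZ (fun x w hw => by
          obtain ⟨a, ha, z, hz, rfl⟩ := Submodule.mem_sup.1 hw
          rw [map_add, hZ x z hz, add_zero]
          exact Submodule.mem_sup_left (bracket_mem_lowerCentralSeries j x ha)) hα₁ hα₁P
        (by rw [hα₁F]; exact f₁.hom.tensorMap_mem_tens hαF)
      exact ⟨F₂, f₂.comp f₁, hF₂, β, hβ, hβP, by rw [hβF, hα₁F, Over.comp_tensorMap]⟩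
  obtain ⟨n, hn⟩ := hL
  obtain ⟨F', f, hF', β, hβ, hβZ, hβF⟩ := key n
  rw [hn, bot_sup_eq] at hβZ
  exact ⟨F', f, hF', β, hβ, hβZ, hβF⟩

/-- If `F(α) = z ⊗ ζ` with `z` of odd degree and `ζ` central and not in the image of `d`, then `z`
becomes exact in a larger fibration. -/
theorem IsBounded.exists_over_curvature_exact {F : AlgebraicFibration.{u, w} A}
    (hF : F.IsBounded) (hL : L.IsNilpotent) (hL' : L.IsNonpositive) {ζ : L} (hζ : ζ ≠ 0)
    (hζZ : ∀ x, L.bracket x ζ = 0) (hζd : LinearMap.range L.d ⊓ Submodule.span ℚ {ζ} = ⊥)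
    {α : F.total ⊗[ℚ] L} (hα : α ∈ tensorDeg F.total L 1) {n : ℕ} (hn : Odd n) {z : F.total}
    (hz : z ∈ F.total.deg n) (hαF : curvature F.total L α = z ⊗ₜ ζ) :
    ∃ (F' : AlgebraicFibration.{u, w} A) (f : Over F F'), F'.IsBounded ∧
      ∃ e, F'.total.d e = f.hom.toAlgHom z := by
  have hZ : ∀ x, ∀ y ∈ Submodule.span ℚ {ζ}, L.bracket x y = 0 := fun x y hy => by
    obtain ⟨r, rfl⟩ := Submodule.mem_span_singleton.1 hy
    rw [map_smul, hζZ, smul_zero]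
  obtain ⟨F', f, hF', β, hβ, hβZ, hβF⟩ := hF.exists_over_evenPart_mem_center hL hL' hZ hα
    (by rw [hαF]; exact tmul_mem_tens z (Submodule.mem_span_singleton_self ζ))
  refine ⟨F', f, hF', ?_⟩
  obtain ⟨e, he⟩ : ∃ e : F'.total, evenPart F'.total L β = e ⊗ₜ ζ := by
    refine tens_induction _ hβZ ⟨0, by simp⟩ (fun i b _ w hw => ?_) ?_
    · obtain ⟨r, rfl⟩ := Submodule.mem_span_singleton.1 hw
      exact ⟨r • b, by rw [TensorProduct.tmul_smul, TensorProduct.smul_tmul']⟩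
    · rintro x y ⟨e, rfl⟩ ⟨e', rfl⟩
      exact ⟨e + e', by rw [TensorProduct.add_tmul]⟩
  -- the odd part of the curvature is linear in `β`, since the even part of `β` is central
  have h1 := oddPart_curvature_sub_mem (J := ⊥) hZ hβ hβZ
  rw [tens_bot, Submodule.mem_bot, hβF, hαF, CDGA.Hom.tensorMap_tmul,
    oddPart_tmul (f.hom.map_deg hz), if_neg (Nat.not_even_iff_odd.2 hn), he, dLeft_tmul,
    ← TensorProduct.sub_tmul, sub_eq_zero] at h1
  have h2 : dRight F'.total L (oddPart F'.total L β) ∈ tens F'.total (LinearMap.range L.d) :=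
    dRight_mem_tens (W := ⊤) (fun w _ => LinearMap.mem_range_self L.d w) (tens_top _)
  have h3 : dRight F'.total L (oddPart F'.total L β) ∈ tens F'.total (Submodule.span ℚ {ζ}) := by
    rw [← h1]; exact tmul_mem_tens _ (Submodule.mem_span_singleton_self ζ)
  have h4 := tensorBox_inf h2 h3
  rw [hζd, tensorBox, Submodule.map₂_bot_right, Submodule.mem_bot, ← h1] at h4
  refine ⟨e, ?_⟩
  exact (sub_eq_zero.1 (eq_zero_of_tmul_eq_zero hζ h4)).symm

/-- A class of positive even degree vanishes in some bounded fibration over `A`, larger than a given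
one. -/
theorem IsBounded.exists_over_even_eq_zero {F : AlgebraicFibration.{u, w} A} (hF : F.IsBounded)
    {n : ℕ} (hn : Even n) (hn0 : 0 < n) {x : A.Cohomology} (hx : x ∈ A.H n) :
    ∃ (F' : AlgebraicFibration.{u, w} A) (_ : Over F F'), F'.IsBounded ∧
      F'.incl.onCohomology x = 0 := by
  obtain ⟨z, hz, rfl⟩ := CDGA.mem_H_iff.1 hx
  obtain ⟨F', f, hF', p, -, hp⟩ := hF.exists_over_exact hn hn0 (F.incl.map_deg hz)
    (by rw [← F.incl.map_d, show A.d z = 0 from z.2, map_zero])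
  exact ⟨F', f, hF', (CDGA.Hom.onCohomology_cls_eq_zero_iff _).2 ⟨p, by rw [hp, f.comm]⟩⟩

/-- A Maurer–Cartan product vanishes in some bounded fibration over `A`, larger than a given one. -/
theorem IsBounded.exists_over_MP_eq_zero {F : AlgebraicFibration.{u, w} A} (hF : F.IsBounded)
    (lam : MCProductData.{v}) {x : A.Cohomology} (hx : x ∈ MP lam A) :
    ∃ (F' : AlgebraicFibration.{u, w} A) (_ : Over F F'), F'.IsBounded ∧
      F'.incl.onCohomology x = 0 := by
  obtain ⟨_, -, α, hα, -, z, hz, hzF, rfl⟩ := hx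
  have hq := lam.q_nonpos
  rcases Nat.even_or_odd (2 - lam.q).toNat with h | h
  · exact hF.exists_over_even_eq_zero h (by omega) (CDGA.mem_H_iff.2 ⟨z, hz, rfl⟩)
  have hζ : (lam.isoZ 1 : lam.Ltilde) ≠ 0 := by
    rw [Ne, Submodule.coe_eq_zero, LinearEquiv.map_eq_zero_iff]
    exact one_ne_zero
  have hζZ : ∀ y, lam.Ltilde.bracket y (lam.isoZ 1 : lam.Ltilde) = 0 := fun y => by
    refine graded_induction lam.Ltilde.deg y (by simp) (fun i y hy => ?_)
      (fun y y' hy hy' => by rw [map_add, LinearMap.add_apply, hy, hy', add_zero])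
    rw [lam.Ltilde.antisymm hy lam.isoZ_mem, lam.central _ (lam.isoZ 1).2, smul_zero, neg_zero]
  have hζd : LinearMap.range lam.Ltilde.d ⊓ Submodule.span ℚ {(lam.isoZ 1 : lam.Ltilde)} = ⊥ := by
    rw [eq_bot_iff, ← lam.range_d_inf_Z]
    exact inf_le_inf_left _ ((Submodule.span_singleton_le_iff_mem _ _).2 (lam.isoZ 1).2)
  obtain ⟨F', f, hF', e, he⟩ := hF.exists_over_curvature_exact lam.nilpotent_Ltilde
    lam.nonpositive_Ltilde hζ hζZ hζd
    (F.incl.tensorMap_mem_tensorDeg (posTensorDeg_le 1 hα)) h (F.incl.map_deg hz)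
    (by rw [← F.incl.tensorMap_curvature, hzF, CDGA.Hom.tensorMap_tmul])
  exact ⟨F', f, hF', (CDGA.Hom.onCohomology_cls_eq_zero_iff _).2 ⟨e, by rw [he, f.comm]⟩⟩

/-- The classes that vanish in some bounded fibration larger than any given one form a subspace that
contains the even classes and the Maurer–Cartan products. -/
theorem span_even_union_MP_subset_ann (A : CDGA.{u}) {x : A.Cohomology}
    (hx : x ∈ Submodule.span ℚ ((A.evenCohomology : Set A.Cohomology) ∪
      ⋃ lam : MCProductData.{v}, MP lam A)) : x ∈ ann.{u, w} A := by
  -- enlarging the fibration at every step makes the condition additive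
  have key : ∀ F : AlgebraicFibration.{u, w} A, F.IsBounded →
      ∃ (F' : AlgebraicFibration.{u, w} A) (_ : Over F F'), F'.IsBounded ∧
        F'.incl.onCohomology x = 0 := by
    let Q : Submodule ℚ A.Cohomology :=
      { carrier := {x | ∀ F : AlgebraicFibration.{u, w} A, F.IsBounded →
          ∃ (F' : AlgebraicFibration.{u, w} A) (_ : Over F F'), F'.IsBounded ∧
            F'.incl.onCohomology x = 0}
        zero_mem' := fun F hF => ⟨F, Over.id F, hF, map_zero _⟩
        add_mem' := fun {x y} hx hy F hF => by
          obtain ⟨F₁, f₁, hF₁, h₁⟩ := hx F hF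
          obtain ⟨F₂, f₂, hF₂, h₂⟩ := hy F₁ hF₁
          exact ⟨F₂, f₂.comp f₁, hF₂, by rw [map_add, f₂.onCohomology_eq_zero h₁, h₂, add_zero]⟩
        smul_mem' := fun r x hx F hF => by
          obtain ⟨F₁, f₁, hF₁, h₁⟩ := hx F hF
          exact ⟨F₁, f₁, hF₁, by rw [map_smul, h₁, smul_zero]⟩ }
    refine (Submodule.span_le (p := Q)).2 (Set.union_subset ?_
      (Set.iUnion_subset fun lam x hx F hF => hF.exists_over_MP_eq_zero lam hx)) hx
    have : A.evenCohomology ≤ Q := iSup₂_le fun k hk x hx F hF =>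
      hF.exists_over_even_eq_zero (even_two_mul k) (by omega) hx
    exact this
  obtain ⟨F', -, hF', h⟩ := key (trivial.{u, w} A) (trivial_isBounded A)
  exact ⟨F', hF'.fiberHasFiniteCohomologicalDimension, h⟩

end AlgebraicFibration

/-! ### Constructions of differential graded Lie algebras -/

namespace DGLA

/-- The sub-DGLA carried by a graded subspace that is closed under the bracket and `d`. -/
def sub (L : DGLA.{v}) (W : Submodule ℚ L) (hW : ∀ w ∈ W, ∀ i, gradedProj L.deg i w ∈ W)
    (hb : ∀ x ∈ W, ∀ y ∈ W, L.bracket x y ∈ W) (hd : ∀ x ∈ W, L.d x ∈ W) : DGLA.{v} where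
  carrier := W
  deg i := (L.deg i).comap W.subtype
  decomposition := decompositionOfProj _
    (fun i => (gradedProj L.deg i).restrict (fun w hw => hW w hw i))
    (fun i x => gradedProj_mem L.deg i (x : L))
    (fun i x hx => Subtype.ext (gradedProj_same L.deg hx))
    (fun i j h x hx => Subtype.ext (gradedProj_ne L.deg h hx))
    (fun x => by
      obtain ⟨s, hs⟩ := exists_sum_gradedProj L.deg (x : L)
      refine ⟨s, Subtype.ext ?_⟩
      rw [AddSubmonoidClass.coe_finsetSum]
      exact hs)
  bracket := LinearMap.mk₂ ℚ (fun x y => ⟨L.bracket x y, hb x x.2 y y.2⟩)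
    (fun _ _ _ => Subtype.ext (by simp)) (fun _ _ _ => Subtype.ext (by simp))
    (fun _ _ _ => Subtype.ext (by simp)) (fun _ _ _ => Subtype.ext (by simp))
  d := L.d.restrict hd
  bracket_mem hx hy := L.bracket_mem hx hy
  d_mem hx := L.d_mem hx
  antisymm hx hy := Subtype.ext (L.antisymm hx hy)
  jacobi z hx hy := Subtype.ext (L.jacobi (z : L) hx hy)
  d_d x := Subtype.ext (L.d_d x)
  leibniz y hx := Subtype.ext (L.leibniz (y : L) hx)

section Sub

variable (L : DGLA.{v}) (W : Submodule ℚ L) (hW : ∀ w ∈ W, ∀ i, gradedProj L.deg i w ∈ W)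
    (hb : ∀ x ∈ W, ∀ y ∈ W, L.bracket x y ∈ W) (hd : ∀ x ∈ W, L.d x ∈ W)

/-- The inclusion of a sub-DGLA. -/
def subIncl : Hom (L.sub W hW hb hd) L where
  toLinearMap := W.subtype
  map_deg h := h
  map_bracket _ _ := rfl
  map_d _ := rfl

end Sub

/-- The quotient of a DGLA by a graded ideal that is closed under `d`. -/
def quotient (L : DGLA.{v}) (W : Submodule ℚ L) (hW : ∀ w ∈ W, ∀ i, gradedProj L.deg i w ∈ W)
    (hl : ∀ x ∈ W, ∀ y, L.bracket x y ∈ W) (hr : ∀ x, ∀ y ∈ W, L.bracket x y ∈ W)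
    (hd : W ≤ W.comap L.d) : DGLA.{v} where
  carrier := L ⧸ W
  deg i := (L.deg i).map W.mkQ
  decomposition := decompositionOfProj _
    (fun i => W.mapQ W (gradedProj L.deg i) (fun w hw => hW w hw i))
    (fun i x => by
      obtain ⟨x, rfl⟩ := W.mkQ_surjective x
      exact ⟨_, gradedProj_mem L.deg i x, rfl⟩)
    (fun i x hx => by
      obtain ⟨x, hx, rfl⟩ := hx
      exact congrArg W.mkQ (gradedProj_same L.deg hx))
    (fun i j h x hx => by
      obtain ⟨x, hx, rfl⟩ := hx
      exact congrArg W.mkQ (gradedProj_ne L.deg h hx))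
    (fun x => by
      obtain ⟨x, rfl⟩ := W.mkQ_surjective x
      obtain ⟨s, hs⟩ := exists_sum_gradedProj L.deg x
      refine ⟨s, ?_⟩
      conv_lhs => rw [hs, map_sum]
      rfl)
  bracket := (W.liftQ (W.liftQ (L.bracket.compr₂ W.mkQ) (fun x hx => by
      ext y; exact (Submodule.Quotient.mk_eq_zero W).2 (hl x hx y))).flip (fun y hy => by
      ext x; exact (Submodule.Quotient.mk_eq_zero W).2 (hr x y hy))).flip
  d := W.mapQ W L.d hd
  bracket_mem := by
    rintro i j _ _ ⟨x, hx, rfl⟩ ⟨y, hy, rfl⟩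
    exact ⟨_, L.bracket_mem hx hy, rfl⟩
  d_mem := by
    rintro i _ ⟨x, hx, rfl⟩
    exact ⟨_, L.d_mem hx, rfl⟩
  antisymm := by
    rintro i j _ _ ⟨x, hx, rfl⟩ ⟨y, hy, rfl⟩
    exact congrArg W.mkQ (L.antisymm hx hy)
  jacobi := by
    rintro i j _ _ z ⟨x, hx, rfl⟩ ⟨y, hy, rfl⟩
    obtain ⟨z, rfl⟩ := W.mkQ_surjective z
    exact congrArg W.mkQ (L.jacobi z hx hy)
  d_d := by
    intro x
    obtain ⟨x, rfl⟩ := W.mkQ_surjective x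
    exact congrArg W.mkQ (L.d_d x)
  leibniz := by
    rintro i _ y ⟨x, hx, rfl⟩
    obtain ⟨y, rfl⟩ := W.mkQ_surjective y
    exact congrArg W.mkQ (L.leibniz y hx)

section Quotient

variable (L : DGLA.{v}) (W : Submodule ℚ L) (hW : ∀ w ∈ W, ∀ i, gradedProj L.deg i w ∈ W)
    (hl : ∀ x ∈ W, ∀ y, L.bracket x y ∈ W) (hr : ∀ x, ∀ y ∈ W, L.bracket x y ∈ W)
    (hd : W ≤ W.comap L.d)

/-- The projection onto a quotient DGLA. -/
def quotientMk : Hom L (L.quotient W hW hl hr hd) where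
  toLinearMap := W.mkQ
  map_deg h := ⟨_, h, rfl⟩
  map_bracket _ _ := rfl
  map_d _ := rfl

end Quotient

/-- A surjective image of a nilpotent DGLA is nilpotent. -/
theorem IsNilpotent.of_surjective {L M : DGLA.{v}} (f : Hom L M)
    (hf : Function.Surjective f.toLinearMap) (hL : L.IsNilpotent) : M.IsNilpotent := by
  obtain ⟨n, hn⟩ := hL
  have key : ∀ n, M.lowerCentralSeries n ≤ (L.lowerCentralSeries n).map f.toLinearMap := by
    intro n
    induction n with
    | zero =>
      intro y _
      obtain ⟨x, rfl⟩ := hf y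
      exact ⟨x, Submodule.mem_top, rfl⟩
    | succ n ih =>
      refine Submodule.map₂_le.2 fun x _ y hy => ?_
      obtain ⟨x', rfl⟩ := hf x
      obtain ⟨y', hy', rfl⟩ := ih hy
      exact ⟨_, bracket_mem_lowerCentralSeries n x' hy', f.map_bracket x' y'⟩
  exact ⟨n, by simpa [hn] using key n⟩

section OfAlgebra

variable {R : Type v} [Ring R] [Algebra ℚ R] (𝒜 : ℤ → Submodule ℚ R) [GradedAlgebra 𝒜]

/-- The graded commutator `x y - (-1)^{|x||y|} y x` of a `ℤ`-graded algebra. -/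
def gradedCommutator : R →ₗ[ℚ] R →ₗ[ℚ] R := LinearMap.mul ℚ R -
  ((LinearMap.mul ℚ R).compl₁₂ (gradedScale 𝒜 fun n => if Even n then 1 else 0) LinearMap.id +
    (LinearMap.mul ℚ R).compl₁₂ (gradedScale 𝒜 fun n => if Even n then 0 else 1)
      (gradedScale 𝒜 fun n => (-1) ^ n)).flip

theorem gradedCommutator_apply {i j : ℤ} {x y : R} (hx : x ∈ 𝒜 i) (hy : y ∈ 𝒜 j) :
    gradedCommutator 𝒜 x y = x * y - ((-1 : ℚ) ^ (i * j)) • (y * x) := by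
  rcases Int.even_or_odd j with h | h
  · simp [gradedCommutator, gradedScale_apply _ _ hy, h, (h.mul_left i).neg_one_zpow]
  · have h' : ((-1 : ℚ) ^ (i * j)) = (-1) ^ i := by
      rw [mul_comm, zpow_mul, h.neg_one_zpow]
    simp [gradedCommutator, gradedScale_apply _ _ hx, gradedScale_apply _ _ hy,
      Int.not_even_iff_odd.2 h, h']

theorem gradedCommutator_mem {i j : ℤ} {x y : R} (hx : x ∈ 𝒜 i) (hy : y ∈ 𝒜 j) :
    gradedCommutator 𝒜 x y ∈ 𝒜 (i + j) := by
  rw [gradedCommutator_apply 𝒜 hx hy]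
  exact sub_mem (SetLike.mul_mem_graded hx hy)
    (Submodule.smul_mem _ _ (add_comm j i ▸ SetLike.mul_mem_graded hy hx))

theorem gradedCommutator_jacobi {i j : ℤ} {x y : R} (z : R) (hx : x ∈ 𝒜 i) (hy : y ∈ 𝒜 j) :
    gradedCommutator 𝒜 x (gradedCommutator 𝒜 y z) =
      gradedCommutator 𝒜 (gradedCommutator 𝒜 x y) z +
        ((-1 : ℚ) ^ (i * j)) • gradedCommutator 𝒜 y (gradedCommutator 𝒜 x z) := by
  refine graded_induction 𝒜 z (by simp) (fun k z hz => ?_)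
    (fun z z' h h' => by simp only [map_add, h, h', smul_add]; abel)
  rw [gradedCommutator_apply 𝒜 hx (gradedCommutator_mem 𝒜 hy hz),
    gradedCommutator_apply 𝒜 (gradedCommutator_mem 𝒜 hx hy) hz,
    gradedCommutator_apply 𝒜 hy (gradedCommutator_mem 𝒜 hx hz), gradedCommutator_apply 𝒜 hx hy,
    gradedCommutator_apply 𝒜 hy hz, gradedCommutator_apply 𝒜 hx hz]
  have e : ∀ a b : ℤ, (-1 : ℚ) ^ (a + b) = (-1) ^ a * (-1) ^ b :=
    fun a b => zpow_add₀ (by norm_num) a b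
  have e3 : (-1 : ℚ) ^ (i * j) * (-1) ^ (i * j) = 1 := by
    rw [← e]; exact Even.neg_one_zpow ⟨_, rfl⟩
  rw [mul_add, mul_add, add_mul, mul_comm j i, e, e, e]
  generalize (-1 : ℚ) ^ (i * j) = s at *
  generalize (-1 : ℚ) ^ (i * k) = t
  generalize (-1 : ℚ) ^ (j * k) = r
  have e4 : ∀ q, s * (s * q) = q := fun q => by rw [← mul_assoc, e3, one_mul]
  simp only [mul_sub, sub_mul, smul_sub, smul_smul, mul_smul_comm, smul_mul_assoc, mul_assoc]
  rw [show t * (r * s) = s * (t * r) by ring, show t * r = r * t by ring]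
  simp only [e4]
  abel

/-- The commutator DGLA of a `ℤ`-graded algebra, with the differential `[T, -]` for an element `T`
of degree one with `T² = 0`. -/
def ofAlgebra (T : R) (hT : T ∈ 𝒜 1) (hTT : T * T = 0) : DGLA.{v} where
  carrier := R
  deg := 𝒜
  bracket := gradedCommutator 𝒜
  d := gradedCommutator 𝒜 T
  bracket_mem := gradedCommutator_mem 𝒜
  d_mem hx := by rw [add_comm]; exact gradedCommutator_mem 𝒜 hT hx
  antisymm {i j x y} hx hy := by
    rw [gradedCommutator_apply 𝒜 hx hy, gradedCommutator_apply 𝒜 hy hx, smul_sub, smul_smul,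
      mul_comm j i, ← zpow_add₀ (by norm_num : (-1 : ℚ) ≠ 0), Even.neg_one_zpow ⟨_, rfl⟩, one_smul,
      neg_sub]
  jacobi := gradedCommutator_jacobi 𝒜
  d_d x := by
    have h := gradedCommutator_jacobi 𝒜 x hT hT
    have h0 : gradedCommutator 𝒜 T T = 0 := by rw [gradedCommutator_apply 𝒜 hT hT, hTT]; simp
    rw [h0, map_zero, LinearMap.zero_apply, zero_add] at h
    have h2 : (2 : ℚ) • gradedCommutator 𝒜 T (gradedCommutator 𝒜 T x) = 0 := by
      rw [two_smul]; nth_rewrite 1 [h]; simp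
    simpa using h2
  leibniz {i x} y hx := by
    have h := gradedCommutator_jacobi 𝒜 y hT hx
    rwa [one_mul] at h

end OfAlgebra

/-! ### Functoriality of `A ⊗ L` in `L` -/

variable {A : CDGA.{u}} {L M : DGLA.{v}}

namespace Hom

theorem lTensor_tensorBracket (f : Hom L M) (x y : A ⊗[ℚ] L) :
    f.toLinearMap.lTensor A (tensorBracket A L x y) =
      tensorBracket A M (f.toLinearMap.lTensor A x) (f.toLinearMap.lTensor A y) := by
  refine tensor_induction x (by simp) (fun i j b w hb hw => ?_) (fun x x' hx hx' => ?_)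
  · refine tensor_induction y (by simp) (fun i' j' b' w' hb' hw' => ?_) (fun x y hx hy => ?_)
    · rw [tensorBracket_tmul A L b w' hw hb', map_smul, LinearMap.lTensor_tmul,
        LinearMap.lTensor_tmul, LinearMap.lTensor_tmul,
        tensorBracket_tmul A M _ _ (f.map_deg hw) hb',
        f.map_bracket]
    · simp only [map_add, hx, hy]
  · simp only [map_add, LinearMap.add_apply, hx, hx']

theorem lTensor_tensorD (f : Hom L M) (x : A ⊗[ℚ] L) :
    f.toLinearMap.lTensor A (tensorD A L x) = tensorD A M (f.toLinearMap.lTensor A x) := by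
  refine tensor_induction x (by simp) (fun i j b w hb hw => ?_) (fun x x' hx hx' => ?_)
  · rw [tensorD_tmul A L w hb, LinearMap.lTensor_tmul, tensorD_tmul A M _ hb, map_add, map_smul,
      LinearMap.lTensor_tmul, LinearMap.lTensor_tmul, f.map_d]
  · simp only [map_add, hx, hx']

theorem lTensor_curvature (f : Hom L M) (x : A ⊗[ℚ] L) :
    f.toLinearMap.lTensor A (curvature A L x) = curvature A M (f.toLinearMap.lTensor A x) := by
  rw [curvature, curvature, map_add, map_smul, f.lTensor_tensorBracket, f.lTensor_tensorD]

theorem lTensor_mem_posTensorDeg (f : Hom L M) {n : ℤ} {x : A ⊗[ℚ] L}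
    (hx : x ∈ posTensorDeg A L n) : f.toLinearMap.lTensor A x ∈ posTensorDeg A M n := by
  have : posTensorDeg A L n ≤ (posTensorDeg A M n).comap (f.toLinearMap.lTensor A) := by
    refine Submodule.span_le.2 ?_
    rintro _ ⟨i, j, b, w, hi, h, hb, hw, rfl⟩
    exact Submodule.subset_span ⟨i, j, b, _, hi, h, hb, f.map_deg hw, rfl⟩
  exact this hx

end Hom

theorem mem_posTensorDeg_of_isNonpositive (hL : L.IsNonpositive) {x : A ⊗[ℚ] L}
    (hx : x ∈ tensorDeg A L 1) : x ∈ posTensorDeg A L 1 := by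
  refine tensorDeg_induction x hx (zero_mem _) (fun i j b w h hb hw => ?_)
    (fun x y hx hy => add_mem hx hy)
  rcases Nat.eq_zero_or_pos i with rfl | hi
  · rw [hL j (by omega), Submodule.mem_bot] at hw
    rw [hw, TensorProduct.tmul_zero]
    exact zero_mem _
  · exact Submodule.subset_span ⟨i, j, b, w, hi, h, hb, hw, rfl⟩

/-- An element of `A ⊗ W` of degree `n` comes from an element of degree `n` of the tensor product of
`A` with the sub-DGLA `W`. -/
theorem exists_lTensor_subIncl_eq (W : Submodule ℚ L) (hW : ∀ w ∈ W, ∀ i, gradedProj L.deg i w ∈ W)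
    (hb : ∀ x ∈ W, ∀ y ∈ W, L.bracket x y ∈ W) (hd : ∀ x ∈ W, L.d x ∈ W) {n : ℤ} {x : A ⊗[ℚ] L}
    (hx : x ∈ tensorDeg A L n) (hxW : x ∈ tens A W) :
    ∃ y ∈ tensorDeg A (L.sub W hW hb hd) n,
      (L.subIncl W hW hb hd).toLinearMap.lTensor A y = x := by
  have key : x ∈ Submodule.map ((L.subIncl W hW hb hd).toLinearMap.lTensor A)
      (tensorDeg A (L.sub W hW hb hd) n) := by
    refine mem_of_leftProj_mem fun i => ?_
    have h := tensorBox_inf (leftProj_mem_tensorBox (show (i : ℤ) + (n - i) = n by ring) hx)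
      (leftProj_mem_tens i hxW)
    refine tensorBox_le (fun b hb' w hw => ?_) h
    exact ⟨b ⊗ₜ (⟨w, hw.2⟩ : W), tmul_mem_tensorDeg hb'.1 hw.1 (by ring), rfl⟩
  obtain ⟨y, hy, rfl⟩ := key
  exact ⟨y, hy, rfl⟩

theorem lTensor_subIncl_injective (W : Submodule ℚ L)
    (hW : ∀ w ∈ W, ∀ i, gradedProj L.deg i w ∈ W)
    (hb : ∀ x ∈ W, ∀ y ∈ W, L.bracket x y ∈ W) (hd : ∀ x ∈ W, L.d x ∈ W) :
    Function.Injective ((L.subIncl W hW hb hd).toLinearMap.lTensor A) :=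
  Module.Flat.lTensor_preserves_injective_linearMap _ Subtype.val_injective

end DGLA

/-! ### Maurer–Cartan product data from graded algebras -/

namespace DGLA

section Truncation

variable {R : Type v} [Ring R] [Algebra ℚ R] (𝒜 : ℤ → Submodule ℚ R) [GradedAlgebra 𝒜]

theorem gradedCommutator_left_eq {T : R} (hT : T ∈ 𝒜 1) (x : R) :
    gradedCommutator 𝒜 T x = T * x - gradedScale 𝒜 (fun i => (-1) ^ i) x * T := by
  refine graded_induction 𝒜 x (by simp) (fun i x hx => ?_)
    (fun x y hx hy => by simp only [map_add, hx, hy, mul_add, add_mul]; abel)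
  rw [gradedCommutator_apply 𝒜 hT hx, gradedScale_apply 𝒜 _ hx, one_mul, smul_mul_assoc]

/-- A filtration of a graded algebra by graded subspaces that makes the first step a nilpotent
non-unital algebra. -/
structure NilFiltration (N : ℕ → Submodule ℚ R) : Prop where
  graded : ∀ k, ∀ x ∈ N k, ∀ i, gradedProj 𝒜 i x ∈ N k
  succ_le : ∀ k, N (k + 1) ≤ N k
  mul_left : ∀ k, ∀ x ∈ N 0, ∀ y ∈ N k, x * y ∈ N (k + 1)
  mul_right : ∀ k, ∀ x ∈ N 0, ∀ y ∈ N k, y * x ∈ N (k + 1)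
  eq_bot : ∃ n, N n = ⊥

variable {𝒜} {N : ℕ → Submodule ℚ R} {T : R}

theorem NilFiltration.commutator_mem (hN : NilFiltration 𝒜 N) {k : ℕ} {x y : R} (hx : x ∈ N 0)
    (hy : y ∈ N k) : gradedCommutator 𝒜 x y ∈ N (k + 1) := by
  obtain ⟨s, hs⟩ := exists_sum_gradedProj 𝒜 x
  obtain ⟨t, ht⟩ := exists_sum_gradedProj 𝒜 y
  rw [hs, ht, map_sum]
  refine sum_mem fun j _ => ?_
  rw [map_sum, LinearMap.sum_apply]
  refine sum_mem fun i _ => ?_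
  have hxi := hN.graded 0 x hx i
  have hyj := hN.graded k y hy j
  rw [gradedCommutator_apply 𝒜 (gradedProj_mem 𝒜 i x) (gradedProj_mem 𝒜 j y)]
  exact sub_mem (hN.mul_left k _ hxi _ hyj) (Submodule.smul_mem _ _ (hN.mul_right k _ hxi _ hyj))

variable (𝒜 N T) in
/-- The truncation of a subspace `N 0` of a graded algebra to nonpositive degrees: in degree zero
only the elements that commute with `T` are kept. -/
def truncation : Submodule ℚ R where
  carrier := {x | x ∈ N 0 ∧ (∀ i, 0 < i → gradedProj 𝒜 i x = 0) ∧
    T * gradedProj 𝒜 0 x = gradedProj 𝒜 0 x * T}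
  zero_mem' := ⟨zero_mem _, by simp, by simp⟩
  add_mem' hx hy := ⟨add_mem hx.1 hy.1, fun i hi => by rw [map_add, hx.2.1 i hi, hy.2.1 i hi,
      add_zero],
    by rw [map_add, mul_add, add_mul, hx.2.2, hy.2.2]⟩
  smul_mem' r x hx := ⟨Submodule.smul_mem _ _ hx.1, fun i hi => by rw [map_smul, hx.2.1 i hi,
      smul_zero],
    by rw [map_smul, mul_smul_comm, smul_mul_assoc, hx.2.2]⟩

theorem mem_truncation_of_neg {x : R} (hx : x ∈ N 0) {i : ℤ} (hi : i < 0) (hxi : x ∈ 𝒜 i) :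
    x ∈ truncation 𝒜 N T :=
  ⟨hx, fun j hj => gradedProj_ne 𝒜 (by omega) hxi, by
    rw [gradedProj_ne 𝒜 hi.ne hxi, mul_zero, zero_mul]⟩

theorem mem_truncation_of_zero {x : R} (hx : x ∈ N 0) (hx0 : x ∈ 𝒜 0) (h : T * x = x * T) :
    x ∈ truncation 𝒜 N T :=
  ⟨hx, fun j hj => gradedProj_ne 𝒜 (by omega) hx0, by rw [gradedProj_same 𝒜 hx0, h]⟩

theorem gradedProj_mem_truncation (hN : NilFiltration 𝒜 N) {x : R} (hx : x ∈ truncation 𝒜 N T)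
    (i : ℤ) : gradedProj 𝒜 i x ∈ truncation 𝒜 N T := by
  have hi := hN.graded 0 x hx.1 i
  rcases lt_trichotomy i 0 with h | rfl | h
  · exact mem_truncation_of_neg hi h (gradedProj_mem 𝒜 i x)
  · exact mem_truncation_of_zero hi (gradedProj_mem 𝒜 0 x) hx.2.2
  · rw [hx.2.1 i h]; exact zero_mem _

theorem commutator_mem_truncation (hN : NilFiltration 𝒜 N) {x y : R}
    (hx : x ∈ truncation 𝒜 N T) (hy : y ∈ truncation 𝒜 N T) :
    gradedCommutator 𝒜 x y ∈ truncation 𝒜 N T := by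
  obtain ⟨s, hs⟩ := exists_sum_gradedProj 𝒜 x
  obtain ⟨t, ht⟩ := exists_sum_gradedProj 𝒜 y
  rw [hs, ht, map_sum]
  refine sum_mem fun j _ => ?_
  rw [map_sum, LinearMap.sum_apply]
  refine sum_mem fun i _ => ?_
  rcases lt_or_ge 0 i with hi | hi
  · rw [hx.2.1 i hi, map_zero, LinearMap.zero_apply]; exact zero_mem _
  rcases lt_or_ge 0 j with hj | hj
  · rw [hy.2.1 j hj, map_zero]; exact zero_mem _
  have hm : gradedCommutator 𝒜 (gradedProj 𝒜 i x) (gradedProj 𝒜 j y) ∈ N 0 :=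
    hN.succ_le 0 (hN.commutator_mem (hN.graded 0 x hx.1 i) (hN.graded 0 y hy.1 j))
  have hd := gradedCommutator_mem 𝒜 (gradedProj_mem 𝒜 i x) (gradedProj_mem 𝒜 j y)
  rcases lt_or_eq_of_le (add_nonpos hi hj) with h | h
  · exact mem_truncation_of_neg hm h hd
  · obtain rfl : i = 0 := by omega
    obtain rfl : j = 0 := by omega
    refine mem_truncation_of_zero hm hd ?_
    rw [gradedCommutator_apply 𝒜 (gradedProj_mem 𝒜 0 x) (gradedProj_mem 𝒜 0 y)]
    have h1 := hx.2.2
    have h2 := hy.2.2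
    generalize gradedProj 𝒜 0 x = a at *
    generalize gradedProj 𝒜 0 y = b at *
    simp only [mul_zero, zpow_zero, one_smul, mul_sub, sub_mul]
    have e1 : T * (a * b) = a * b * T := by rw [← mul_assoc, h1, mul_assoc, h2, mul_assoc]
    have e2 : T * (b * a) = b * a * T := by rw [← mul_assoc, h2, mul_assoc, h1, mul_assoc]
    rw [e1, e2]

theorem d_mem_truncation (hN : NilFiltration 𝒜 N) (hT : T ∈ 𝒜 1) (hTT : T * T = 0) (hTN : T ∈ N 0)
    {x : R} (hx : x ∈ truncation 𝒜 N T) : gradedCommutator 𝒜 T x ∈ truncation 𝒜 N T := by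
  obtain ⟨s, hs⟩ := exists_sum_gradedProj 𝒜 x
  rw [hs, map_sum]
  refine sum_mem fun i _ => ?_
  have hm : gradedCommutator 𝒜 T (gradedProj 𝒜 i x) ∈ N 0 :=
    hN.succ_le 0 (hN.commutator_mem hTN (hN.graded 0 x hx.1 i))
  have hd := gradedCommutator_mem 𝒜 hT (gradedProj_mem 𝒜 i x)
  have he := gradedCommutator_apply 𝒜 hT (gradedProj_mem 𝒜 i x)
  rcases lt_trichotomy i 0 with h | rfl | h
  · rcases lt_or_eq_of_le (show 1 + i ≤ 0 by omega) with h' | h'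
    · exact mem_truncation_of_neg hm h' hd
    · refine mem_truncation_of_zero hm (h' ▸ hd) ?_
      rw [he, mul_sub, sub_mul, mul_smul_comm, smul_mul_assoc, ← mul_assoc, hTT, mul_assoc _ T T,
        hTT,
        zero_mul, mul_zero, smul_zero, zero_sub, sub_zero, ← mul_assoc]
      obtain rfl : i = -1 := by omega
      norm_num
  · rw [he, hx.2.2]
    simp
  · rw [hx.2.1 i h, map_zero]; exact zero_mem _

/-- The truncation as a DGLA. -/
def truncationDGLA (hN : NilFiltration 𝒜 N) (hT : T ∈ 𝒜 1) (hTT : T * T = 0) (hTN : T ∈ N 0) :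
    DGLA.{v} :=
  (ofAlgebra 𝒜 T hT hTT).sub (truncation (R := R) 𝒜 N T)
    (fun _ hx => gradedProj_mem_truncation hN hx)
    (fun _ hx _ hy => commutator_mem_truncation hN hx hy)
    (fun _ hx => d_mem_truncation hN hT hTT hTN hx)

/-- The inclusion of the truncation. -/
def truncationIncl (hN : NilFiltration 𝒜 N) (hT : T ∈ 𝒜 1) (hTT : T * T = 0) (hTN : T ∈ N 0) :
    Hom (truncationDGLA hN hT hTT hTN) (ofAlgebra 𝒜 T hT hTT) :=
  subIncl _ _ _ _ _

theorem lTensor_truncationIncl_injective {A : CDGA.{u}} (hN : NilFiltration 𝒜 N) (hT : T ∈ 𝒜 1)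
    (hTT : T * T = 0) (hTN : T ∈ N 0) :
    Function.Injective ((truncationIncl hN hT hTT hTN).toLinearMap.lTensor A) :=
  lTensor_subIncl_injective _ _ _ _

theorem exists_lTensor_truncationIncl_eq {A : CDGA.{u}} (hN : NilFiltration 𝒜 N) (hT : T ∈ 𝒜 1)
    (hTT : T * T = 0) (hTN : T ∈ N 0) {n : ℤ} {x : A ⊗[ℚ] ofAlgebra 𝒜 T hT hTT}
    (hx : x ∈ tensorDeg A (ofAlgebra 𝒜 T hT hTT) n)
    (hxW : x ∈ tens A (L := ofAlgebra 𝒜 T hT hTT) (truncation (R := R) 𝒜 N T)) :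
    ∃ y ∈ tensorDeg A (truncationDGLA hN hT hTT hTN) n,
      (truncationIncl hN hT hTT hTN).toLinearMap.lTensor A y = x :=
  exists_lTensor_subIncl_eq (L := ofAlgebra 𝒜 T hT hTT) _ _ _ _ hx hxW

theorem truncationDGLA_isNonpositive (hN : NilFiltration 𝒜 N) (hT : T ∈ 𝒜 1) (hTT : T * T = 0)
    (hTN : T ∈ N 0) : (truncationDGLA hN hT hTT hTN).IsNonpositive := fun i hi => by
  refine eq_bot_iff.2 fun x hx => Subtype.ext ?_
  have h1 := gradedProj_same 𝒜 hx
  have h2 : gradedProj 𝒜 i x.1 = 0 := x.2.2.1 i hi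
  exact h1.symm.trans h2

theorem truncationDGLA_isNilpotent (hN : NilFiltration 𝒜 N) (hT : T ∈ 𝒜 1) (hTT : T * T = 0)
    (hTN : T ∈ N 0) : (truncationDGLA hN hT hTT hTN).IsNilpotent := by
  have key : ∀ k, (truncationDGLA hN hT hTT hTN).lowerCentralSeries k ≤
      (N k).comap (truncation 𝒜 N T).subtype := by
    intro k
    induction k with
    | zero => exact fun x _ => x.2.1
    | succ k ih =>
      exact Submodule.map₂_le.2 fun x _ y hy => hN.commutator_mem x.2.1 (ih hy)
  obtain ⟨n, hn⟩ := hN.eq_bot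
  refine ⟨n, eq_bot_iff.2 fun x hx => Subtype.ext ?_⟩
  have := key n hx
  rw [hn] at this
  exact this

end Truncation

end DGLA

section ProductData

open DGLA

section

variable {Lt : DGLA.{v}} (hnil : Lt.IsNilpotent) (hnon : Lt.IsNonpositive) {e : Lt} {q : ℤ}
  (hq : q ≤ 0) (heq : e ∈ Lt.deg q) (hc : ∀ x, Lt.bracket x e = 0) (hd : Lt.d e = 0)
  (hne : ∀ x, Lt.d x ≠ e)

/-- The Maurer–Cartan product data given by a homogeneous central cocycle `e` that is not a
coboundary: the extension is `0 → ℚ e → Lt → Lt / ℚ e → 0`. -/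
def MCProductData.ofCentral : MCProductData.{v} :=
  let Z : Submodule ℚ Lt := Submodule.span ℚ {e}
  have he : e ≠ 0 := fun h => hne 0 (by rw [map_zero, h])
  have hleft : ∀ x, ∀ y ∈ Z, Lt.bracket x y = 0 := fun x y hy => by
    obtain ⟨r, rfl⟩ := Submodule.mem_span_singleton.1 hy
    rw [map_smul, hc, smul_zero]
  have hright : ∀ x ∈ Z, ∀ y, Lt.bracket x y = 0 := fun x hx y => by
    obtain ⟨r, rfl⟩ := Submodule.mem_span_singleton.1 hx
    refine graded_induction Lt.deg y (by simp) (fun i y hy => ?_)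
      (fun x y hx hy => by rw [map_add, hx, hy, add_zero])
    rw [map_smul, LinearMap.smul_apply, Lt.antisymm heq hy, hc, smul_zero, neg_zero, smul_zero]
  have hd : ∀ x ∈ Z, Lt.d x = 0 := fun x hx => by
    obtain ⟨r, rfl⟩ := Submodule.mem_span_singleton.1 hx
    rw [map_smul, hd, smul_zero]
  let L := Lt.quotient Z
    (fun x hx i => by
      obtain ⟨r, rfl⟩ := Submodule.mem_span_singleton.1 hx
      rw [map_smul]
      refine Submodule.smul_mem _ _ ?_
      rcases eq_or_ne q i with rfl | h
      · rw [gradedProj_same Lt.deg heq]; exact Submodule.mem_span_singleton_self e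
      · rw [gradedProj_ne Lt.deg h heq]; exact zero_mem _)
    (fun x hx y => by rw [hright x hx y]; exact zero_mem _)
    (fun x y hy => by rw [hleft x y hy]; exact zero_mem _)
    (fun x hx => by rw [Submodule.mem_comap, hd x hx]; exact zero_mem _)
  let π : DGLA.Hom Lt L := quotientMk Lt Z _ _ _ _
  have hker : LinearMap.ker π.toLinearMap = Z := Submodule.ker_mkQ Z
  { Ltilde := Lt
    L := L
    π := π
    surjective := Z.mkQ_surjective
    nilpotent_Ltilde := hnil
    nilpotent_L := hnil.of_surjective π Z.mkQ_surjective
    nonpositive_Ltilde := hnon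
    nonpositive_L := fun i hi => by
      change (Lt.deg i).map Z.mkQ = ⊥
      rw [hnon i hi, Submodule.map_bot]
    central := fun z hz x => hright z (hker ▸ hz) x
    Z_le_ker_d := fun z hz => hd z (hker ▸ hz)
    range_d_inf_Z := by
      rw [hker, eq_bot_iff]
      rintro _ ⟨⟨x, rfl⟩, hx⟩
      obtain ⟨r, hr'⟩ := Submodule.mem_span_singleton.1 hx
      rw [Submodule.mem_bot, ← hr', smul_eq_zero]
      left
      by_contra hr0
      exact hne (r⁻¹ • x) (by rw [map_smul, ← hr', smul_smul, inv_mul_cancel₀ hr0, one_smul])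
    q := q
    q_nonpos := hq
    isoZ := (LinearEquiv.toSpanNonzeroSingleton ℚ Lt e he).trans (LinearEquiv.ofEq _ _ hker.symm)
    isoZ_mem := by
      have : (((LinearEquiv.toSpanNonzeroSingleton ℚ Lt e he).trans
          (LinearEquiv.ofEq _ _ hker.symm) 1 : LinearMap.ker π.toLinearMap) : Lt) = e := by
        simp
      rw [this]
      exact heq }

/-- It suffices to exhibit the lift of a defining system. -/
theorem cls_mem_MP {A : CDGA.{u}} (lam : MCProductData.{v}) {y : A ⊗[ℚ] lam.Ltilde}
    (hy : y ∈ tensorDeg A lam.Ltilde 1) {z : A.cocycles} (hz : (z : A) ∈ A.deg (2 - lam.q).toNat)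
    (hF : curvature A lam.Ltilde y = (z : A) ⊗ₜ (lam.isoZ 1 : lam.Ltilde)) :
    A.cls z ∈ MP lam A := by
  have hyp := mem_posTensorDeg_of_isNonpositive lam.nonpositive_Ltilde hy
  refine ⟨lam.π.toLinearMap.lTensor A y, ⟨lam.π.lTensor_mem_posTensorDeg hyp, ?_⟩, y, hyp, rfl, z,
      hz,
    hF, rfl⟩
  rw [← lam.π.lTensor_curvature, hF, LinearMap.lTensor_tmul,
    show lam.π.toLinearMap (lam.isoZ 1 : lam.Ltilde) = 0 from (lam.isoZ 1).2,
        TensorProduct.tmul_zero]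

theorem cls_mem_MP_ofCentral {A : CDGA.{u}} {y : A ⊗[ℚ] Lt} (hy : y ∈ tensorDeg A Lt 1)
    {z : A.cocycles} (hz : (z : A) ∈ A.deg (2 - q).toNat)
    (hF : curvature A Lt y = (z : A) ⊗ₜ e) :
    A.cls z ∈ MP (MCProductData.ofCentral hnil hnon hq heq hc hd hne) A :=
  cls_mem_MP (MCProductData.ofCentral hnil hnon hq heq hc hd hne) hy hz
    (hF.trans (congrArg (fun w : Lt => (z : A) ⊗ₜ[ℚ] w) (one_smul ℚ e).symm))

end

variable {R : Type v} [Ring R] [Algebra ℚ R] {𝒜 : ℤ → Submodule ℚ R} [GradedAlgebra 𝒜]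
  {N : ℕ → Submodule ℚ R} {T : R}

/-- Maurer–Cartan products from the truncation of a nilpotent graded algebra, for a homogeneous
element `ε` that is annihilated by the algebra and is not a commutator with `T`. -/
theorem exists_cls_mem_MP_of_nilFiltration {A : CDGA.{u}} (hN : NilFiltration 𝒜 N) (hT : T ∈ 𝒜 1)
    (hTT : T * T = 0) (hTN : T ∈ N 0) {ε : R} {q : ℤ} (hε : ε ∈ truncation 𝒜 N T) (hq : q ≤ 0)
    (hεq : ε ∈ 𝒜 q) (hl : ∀ x ∈ N 0, x * ε = 0) (hr : ∀ x ∈ N 0, ε * x = 0)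
    (hne : ∀ x, gradedCommutator 𝒜 T x ≠ ε) {x : A ⊗[ℚ] DGLA.ofAlgebra 𝒜 T hT hTT}
    (hx : x ∈ tensorDeg A (DGLA.ofAlgebra 𝒜 T hT hTT) 1)
    (hxW : x ∈ tens A (truncation (R := R) 𝒜 N T))
    {z : A.cocycles} (hz : (z : A) ∈ A.deg (2 - q).toNat)
    (hF : curvature A (DGLA.ofAlgebra 𝒜 T hT hTT) x = (z : A) ⊗ₜ ε) :
    ∃ lam : MCProductData.{v}, A.cls z ∈ MP lam A := by
  obtain ⟨y, hy, hyx⟩ := exists_lTensor_truncationIncl_eq hN hT hTT hTN hx hxW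
  set f := truncationIncl hN hT hTT hTN
  have hf : Function.Injective f.toLinearMap := Subtype.val_injective
  have hfN : ∀ x, f.toLinearMap x ∈ N 0 := fun x => x.2.1
  obtain ⟨e, he, heq⟩ : ∃ e, f.toLinearMap e = ε ∧ e ∈ (truncationDGLA hN hT hTT hTN).deg q :=
    ⟨(⟨ε, hε⟩ : truncation (R := R) 𝒜 N T), rfl, hεq⟩
  have hyF : curvature A (truncationDGLA hN hT hTT hTN) y = (z : A) ⊗ₜ[ℚ] e := by
    refine lTensor_truncationIncl_injective hN hT hTT hTN ?_
    rw [LinearMap.lTensor_tmul]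
    refine (f.lTensor_curvature y).trans ?_
    rw [hyx, hF, ← he]
    rfl
  have hz' : ∀ (w : R) (i : ℤ), w ∈ N 0 → w ∈ 𝒜 i → gradedCommutator 𝒜 w ε = 0 :=
    fun w i hw hwi => by
      rw [gradedCommutator_apply 𝒜 hwi hεq, hl w hw, hr w hw, smul_zero, sub_zero]
  refine ⟨_, cls_mem_MP_ofCentral (truncationDGLA_isNilpotent hN hT hTT hTN)
    (truncationDGLA_isNonpositive hN hT hTT hTN) hq heq (fun x => hf ?_) (hf ?_)
    (fun x h => hne (f.toLinearMap x) ?_) hy hz hyF⟩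
  · refine graded_induction (truncationDGLA hN hT hTT hTN).deg x (by simp) (fun i x hx => ?_)
      (fun x y hx hy => by rw [map_add, LinearMap.add_apply, map_add, hx, hy, map_zero, add_zero])
    rw [f.map_bracket, he, map_zero]
    exact hz' _ i (hfN x) hx
  · rw [f.map_d, he, map_zero]
    exact hz' T 1 hTN hT
  · rw [← he, ← h, f.map_d]
    rfl

end ProductData

/-! ### Maurer–Cartan products from matrices -/

section Matrices

variable {ι : Type v}

variable {A : CDGA.{u}}

/-- The matrix entries of an element of `A ⊗ Mat(ℚ)`. -/
def tensorEntry (A : CDGA.{u}) (a b : ι) : A ⊗[ℚ] Matrix ι ι ℚ →ₗ[ℚ] A :=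
  (TensorProduct.rid ℚ A).toLinearMap ∘ₗ (Matrix.entryLinearMap ℚ ℚ a b).lTensor A

theorem tensorEntry_tmul (a b : ι) (x : A) (φ : Matrix ι ι ℚ) :
    tensorEntry A a b (x ⊗ₜ φ) = φ a b • x := by
  simp [tensorEntry]

variable [Fintype ι] [DecidableEq ι]

/-- The grading on matrices for which the elementary matrix `E_ab` has degree `δ a - δ b`. -/
def matrixDeg (δ : ι → ℤ) (n : ℤ) : Submodule ℚ (Matrix ι ι ℚ) where
  carrier := {φ | ∀ a b, δ a - δ b ≠ n → φ a b = 0}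
  zero_mem' _ _ _ := rfl
  add_mem' hx hy a b h := by rw [Matrix.add_apply, hx a b h, hy a b h, add_zero]
  smul_mem' r x hx a b h := by rw [Matrix.smul_apply, hx a b h, smul_zero]

/-- The homogeneous component of degree `n` of a matrix. -/
def matrixProj (δ : ι → ℤ) (n : ℤ) : Matrix ι ι ℚ →ₗ[ℚ] Matrix ι ι ℚ where
  toFun φ := Matrix.of fun a b => if δ a - δ b = n then φ a b else 0
  map_add' x y := by ext a b; simp only [Matrix.of_apply, Matrix.add_apply]; split_ifs <;> simp
  map_smul' r x := by ext a b; simp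

instance (δ : ι → ℤ) : GradedAlgebra (matrixDeg δ) :=
  { decompositionOfProj (matrixDeg δ) (matrixProj δ)
      (fun n x a b h => by simp [matrixProj, h])
      (fun n x hx => by
        ext a b
        by_cases h : δ a - δ b = n
        · simp [matrixProj, h]
        · simp [matrixProj, h, hx a b h])
      (fun m n hmn x hx => by
        ext a b
        by_cases h : δ a - δ b = n
        · have := hx a b (by omega)
          simp [matrixProj, this]
        · simp [matrixProj, h])
      (fun x => by
        classical
        refine ⟨(Finset.univ : Finset (ι × ι)).image fun p => δ p.1 - δ p.2, ?_⟩
        ext a b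
        rw [Matrix.sum_apply]
        simp only [matrixProj, LinearMap.coe_mk, AddHom.coe_mk, Matrix.of_apply]
        rw [Finset.sum_ite_eq, if_pos]
        exact Finset.mem_image_of_mem (fun p : ι × ι => δ p.1 - δ p.2)
            (Finset.mem_univ (a, b))) with
    one_mem := fun a b h => Matrix.one_apply_ne (by rintro rfl; simp at h)
    mul_mem := fun m n x y hx hy a b h => by
      rw [Matrix.mul_apply]
      refine Finset.sum_eq_zero fun c _ => ?_
      by_cases h1 : δ a - δ c = m
      · rw [hy c b (by omega), mul_zero]
      · rw [hx a c h1, zero_mul] }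

theorem gradedProj_matrixDeg (δ : ι → ℤ) (n : ℤ) (φ : Matrix ι ι ℚ) (a b : ι) :
    gradedProj (matrixDeg δ) n φ a b = if δ a - δ b = n then φ a b else 0 := by
  refine graded_induction (matrixDeg δ) φ (by simp) (fun i x hx => ?_) (fun x y hx hy => ?_)
  · rcases eq_or_ne i n with rfl | h
    · rw [gradedProj_same _ hx]
      split_ifs with h
      · rfl
      · exact hx a b h
    · rw [gradedProj_ne _ h hx]
      split_ifs with h'
      · exact (hx a b (by omega)).symm
      · rfl
  · rw [map_add, Matrix.add_apply, hx, hy, Matrix.add_apply]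
    split_ifs <;> simp

/-- The matrices whose entry at `(a, b)` vanishes unless `ρ b > ρ a + k`. -/
def triangular (ρ : ι → ℕ) (k : ℕ) : Submodule ℚ (Matrix ι ι ℚ) where
  carrier := {φ | ∀ a b, ρ b ≤ ρ a + k → φ a b = 0}
  zero_mem' _ _ _ := rfl
  add_mem' hx hy a b h := by rw [Matrix.add_apply, hx a b h, hy a b h, add_zero]
  smul_mem' r x hx a b h := by rw [Matrix.smul_apply, hx a b h, smul_zero]

theorem triangular_nilFiltration (δ : ι → ℤ) (ρ : ι → ℕ) :
    DGLA.NilFiltration (matrixDeg δ) (triangular ρ) where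
  graded k x hx i a b h := by
    rw [gradedProj_matrixDeg, hx a b h, ite_self]
  succ_le k x hx a b h := hx a b (by omega)
  mul_left k x hx y hy a b h := by
    rw [Matrix.mul_apply]
    refine Finset.sum_eq_zero fun c _ => ?_
    by_cases h1 : ρ c ≤ ρ a
    · rw [hx a c h1, zero_mul]
    · rw [hy c b (by omega), mul_zero]
  mul_right k x hx y hy a b h := by
    rw [Matrix.mul_apply]
    refine Finset.sum_eq_zero fun c _ => ?_
    by_cases h1 : ρ c ≤ ρ a + k
    · rw [hy a c h1, zero_mul]
    · rw [hx c b (by omega), mul_zero]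
  eq_bot := by
    refine ⟨Finset.univ.sup ρ, eq_bot_iff.2 fun x hx => ?_⟩
    ext a b
    exact hx a b ((Finset.le_sup (Finset.mem_univ b)).trans (Nat.le_add_left _ _))

/-- The element of `A ⊗ Mat(ℚ)` with given entries. -/
def tensorOfEntries (X : ι → ι → A) : A ⊗[ℚ] Matrix ι ι ℚ :=
  ∑ a, ∑ b, X a b ⊗ₜ Matrix.single a b 1

theorem tensorEntry_tensorOfEntries (X : ι → ι → A) (a b : ι) :
    tensorEntry A a b (tensorOfEntries X) = X a b := by
  simp only [tensorOfEntries, map_sum, tensorEntry_tmul, Matrix.single_apply, ite_smul, one_smul,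
    zero_smul, ite_and]
  rw [Finset.sum_eq_single a]
  · simp
  · intro c _ hc; simp [hc]
  · simp

theorem tensorOfEntries_tensorEntry (x : A ⊗[ℚ] Matrix ι ι ℚ) :
    tensorOfEntries (fun a b => tensorEntry A a b x) = x := by
  induction x with
  | zero => simp [tensorOfEntries]
  | add x y hx hy =>
    rw [← hx, ← hy]
    simp only [hx, hy]
    simp only [tensorOfEntries, map_add, TensorProduct.add_tmul, Finset.sum_add_distrib] at *
    rw [hx, hy]
  | tmul b φ =>
    conv_rhs => rw [Matrix.matrix_eq_sum_single φ]
    simp only [tensorOfEntries, tensorEntry_tmul, TensorProduct.tmul_sum]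
    refine Finset.sum_congr rfl fun i _ => Finset.sum_congr rfl fun j _ => ?_
    rw [← TensorProduct.smul_tmul', ← TensorProduct.tmul_smul, Matrix.smul_single, smul_eq_mul,
      mul_one]

theorem tensor_ext {x y : A ⊗[ℚ] Matrix ι ι ℚ}
    (h : ∀ a b, tensorEntry A a b x = tensorEntry A a b y) : x = y := by
  rw [← tensorOfEntries_tensorEntry x, ← tensorOfEntries_tensorEntry y]
  simp only [h]

end Matrices

section MatrixCurvature

open DGLA

variable {ι : Type v} [Fintype ι] [DecidableEq ι] {A : CDGA.{u}} (δ : ι → ℤ) {T : Matrix ι ι ℚ}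
  (hT : T ∈ matrixDeg δ 1) (hTT : T * T = 0)

/-- The matrix entries of an element of `A ⊗ L`, for the commutator DGLA `L` of matrices. -/
def entry (a b : ι) : A ⊗[ℚ] ofAlgebra (matrixDeg δ) T hT hTT →ₗ[ℚ] A := tensorEntry A a b

/-- The entries of a matrix, as linear forms on the commutator DGLA of matrices. -/
def entryForm (a b : ι) : ofAlgebra (matrixDeg δ) T hT hTT →ₗ[ℚ] ℚ := Matrix.entryLinearMap ℚ ℚ a b

theorem entry_tmul (a b : ι) (x : A) (φ : ofAlgebra (matrixDeg δ) T hT hTT) :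
    entry δ hT hTT a b (x ⊗ₜ φ) = entryForm δ hT hTT a b φ • x :=
  tensorEntry_tmul a b x φ

theorem gradedCommutator_matrix_apply {i j : ℤ} {φ ψ : Matrix ι ι ℚ} (hφ : φ ∈ matrixDeg δ i)
    (hψ : ψ ∈ matrixDeg δ j) (a b : ι) : gradedCommutator (matrixDeg δ) φ ψ a b =
      ∑ c, (φ a c * ψ c b - (-1 : ℚ) ^ (i * j) * (ψ a c * φ c b)) := by
  rw [gradedCommutator_apply _ hφ hψ, Matrix.sub_apply, Matrix.smul_apply, Matrix.mul_apply,
    Matrix.mul_apply, smul_eq_mul, Finset.mul_sum, ← Finset.sum_sub_distrib]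

theorem entryForm_bracket {i j : ℤ} {φ ψ : ofAlgebra (matrixDeg δ) T hT hTT}
    (hφ : φ ∈ (ofAlgebra (matrixDeg δ) T hT hTT).deg i)
    (hψ : ψ ∈ (ofAlgebra (matrixDeg δ) T hT hTT).deg j) (a b : ι) :
    entryForm δ hT hTT a b ((ofAlgebra (matrixDeg δ) T hT hTT).bracket φ ψ) =
      ∑ c, (entryForm δ hT hTT a c φ * entryForm δ hT hTT c b ψ -
        (-1 : ℚ) ^ (i * j) * (entryForm δ hT hTT a c ψ * entryForm δ hT hTT c b φ)) :=
  gradedCommutator_matrix_apply δ hφ hψ a b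

theorem entryForm_d {j : ℤ} {φ : ofAlgebra (matrixDeg δ) T hT hTT}
    (hφ : φ ∈ (ofAlgebra (matrixDeg δ) T hT hTT).deg j) (a b : ι) :
    entryForm δ hT hTT a b ((ofAlgebra (matrixDeg δ) T hT hTT).d φ) =
      ∑ c, (T a c * entryForm δ hT hTT c b φ - (-1 : ℚ) ^ j * (entryForm δ hT hTT a c φ *
        T c b)) := by
  have := gradedCommutator_matrix_apply δ hT hφ a b
  rwa [one_mul] at this

theorem entry_tensorBracket {x y : A ⊗[ℚ] ofAlgebra (matrixDeg δ) T hT hTT}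
    (hx : x ∈ tensorDeg A (ofAlgebra (matrixDeg δ) T hT hTT) 1)
    (hy : y ∈ tensorDeg A (ofAlgebra (matrixDeg δ) T hT hTT) 1) (a b : ι) :
    entry δ hT hTT a b (tensorBracket A _ x y) =
      ∑ c, (A.sgn (entry δ hT hTT c b y) * entry δ hT hTT a c x +
        A.sgn (entry δ hT hTT c b x) * entry δ hT hTT a c y) := by
  refine tensorDeg_induction x hx (by simp) (fun i j β φ h hβ hφ => ?_) (fun x x' hx hx' => ?_)
  · refine tensorDeg_induction y hy (by simp) (fun i' j' β' ψ h' hβ' hψ => ?_)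
      (fun y y' hy hy' => ?_)
    · have e1 : (-1 : ℚ) ^ (j * (i' : ℤ)) = (-1) ^ i' * (-1) ^ (i' * i) := by
        rw [← pow_add, ← zpow_natCast]
        refine neg_one_zpow_eq (-(i * i' : ℤ)) ?_
        rw [show j = 1 - i by omega]; push_cast; ring
      have e2 : (-1 : ℚ) ^ (j * (i' : ℤ)) * (-1) ^ (j * j') = -(-1) ^ i := by
        rw [← zpow_add₀ (by norm_num : (-1 : ℚ) ≠ 0), ← mul_add, h', mul_one, ← zpow_natCast]
        exact neg_one_zpow_eq_neg (-i : ℤ) (by omega)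
      rw [tensorBracket_tmul A _ β ψ hφ hβ', map_smul]
      rw [entry_tmul, entryForm_bracket δ hT hTT hφ hψ, smul_smul, Finset.mul_sum, Finset.sum_smul]
      refine Finset.sum_congr rfl fun c _ => ?_
      rw [entry_tmul, entry_tmul, entry_tmul, entry_tmul, map_smul, map_smul, CDGA.sgn_apply hβ,
        CDGA.sgn_apply hβ', smul_smul, smul_smul, smul_mul_smul_comm, smul_mul_smul_comm,
        A.comm hβ' hβ, smul_smul]
      rw [← add_smul, mul_sub, ← mul_assoc _ ((-1 : ℚ) ^ (j * j')), e2, e1]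
      congr 1
      ring
    · simp only [map_add, hy, hy', add_mul, mul_add, ← Finset.sum_add_distrib]
      exact Finset.sum_congr rfl fun c _ => by abel
  · simp only [map_add, LinearMap.add_apply, hx, hx', add_mul, mul_add, ← Finset.sum_add_distrib]
    exact Finset.sum_congr rfl fun c _ => by abel

theorem entry_tensorD {x : A ⊗[ℚ] ofAlgebra (matrixDeg δ) T hT hTT}
    (hx : x ∈ tensorDeg A (ofAlgebra (matrixDeg δ) T hT hTT) 1) (a b : ι) :
    entry δ hT hTT a b (tensorD A _ x) = A.d (entry δ hT hTT a b x) +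
      ∑ c, (T a c • A.sgn (entry δ hT hTT c b x) + T c b • entry δ hT hTT a c x) := by
  refine tensorDeg_induction x hx (by simp) (fun i j β φ h hβ hφ => ?_) (fun x x' hx hx' => ?_)
  · have e1 : (-1 : ℚ) ^ i * (-1) ^ j = -1 := by
      rw [← zpow_natCast, ← zpow_add₀ (by norm_num : (-1 : ℚ) ≠ 0), h, zpow_one]
    rw [tensorD_tmul A _ φ hβ, map_add, map_smul, entry_tmul, entry_tmul, entry_tmul, map_smul,
      entryForm_d δ hT hTT hφ, smul_smul, Finset.mul_sum, Finset.sum_smul]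
    congr 1
    refine Finset.sum_congr rfl fun c _ => ?_
    rw [entry_tmul, entry_tmul, map_smul, CDGA.sgn_apply hβ, smul_smul, smul_smul, smul_smul,
      ← add_smul, mul_sub, ← mul_assoc _ ((-1 : ℚ) ^ j), e1]
    congr 1
    ring
  · simp only [map_add, hx, hx', smul_add, Finset.sum_add_distrib]
    abel

/-- The curvature of a matrix `x` of forms, when `d = [T, -]`, is that of `x + T`. -/
theorem entry_curvature {x : A ⊗[ℚ] ofAlgebra (matrixDeg δ) T hT hTT}
    (hx : x ∈ tensorDeg A (ofAlgebra (matrixDeg δ) T hT hTT) 1) (a b : ι) :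
    entry δ hT hTT a b (curvature A _ x) = A.d (entry δ hT hTT a b x) +
      ∑ c, A.sgn (entry δ hT hTT c b x + algebraMap ℚ A (T c b)) *
        (entry δ hT hTT a c x + algebraMap ℚ A (T a c)) := by
  have hsgn : ∀ r, A.sgn (algebraMap ℚ A r) = algebraMap ℚ A r := fun r => by
    rw [Algebra.algebraMap_eq_smul_one, map_smul, CDGA.sgn_one]
  have hzero : ∑ c, algebraMap ℚ A (T c b) * algebraMap ℚ A (T a c) = 0 := by
    have := congrFun (congrFun hTT a) b
    rw [Matrix.mul_apply] at this
    rw [← map_zero (algebraMap ℚ A), ← Matrix.zero_apply (m := ι) (n := ι) a b, ← this, map_sum]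
    exact Finset.sum_congr rfl fun c _ => by rw [← map_mul, mul_comm]
  rw [curvature, map_add, map_smul, entry_tensorBracket δ hT hTT hx hx, entry_tensorD δ hT hTT hx,
    add_assoc]
  congr 1
  have hr : ∀ (r : ℚ) (y : A), y * algebraMap ℚ A r = r • y := fun r y => by
    rw [← Algebra.commutes, Algebra.smul_def]
  have key : ∀ c, A.sgn (entry δ hT hTT c b x + algebraMap ℚ A (T c b)) *
      (entry δ hT hTT a c x + algebraMap ℚ A (T a c)) =
      A.sgn (entry δ hT hTT c b x) * entry δ hT hTT a c x +
        (T a c • A.sgn (entry δ hT hTT c b x) + T c b • entry δ hT hTT a c x) +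
        algebraMap ℚ A (T c b) * algebraMap ℚ A (T a c) := fun c => by
    rw [map_add, hsgn, mul_add, add_mul, add_mul, hr (T a c) (A.sgn _), ← Algebra.smul_def]
    abel
  simp only [key]
  simp only [Finset.sum_add_distrib, hzero]
  module

theorem contract_tensorOfEntries (X : ι → ι → A) (φ : A →ₗ[ℚ] ℚ) :
    TensorProduct.lid ℚ (Matrix ι ι ℚ) (φ.rTensor (Matrix ι ι ℚ) (tensorOfEntries X)) =
      Matrix.of fun a b => φ (X a b) := by
  rw [Matrix.matrix_eq_sum_single (Matrix.of fun a b => φ (X a b))]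
  simp [tensorOfEntries]

/-- A matrix of forms whose curvature is concentrated in one corner exhibits the class in that
corner as a Maurer–Cartan product. The part `T` of the matrix that consists of rational numbers is
absorbed into the differential `[T, -]` of the DGLA. The last two conditions say that column `e` of
`T` vanishes and that the unit vector of `b` is not in the image of `T`; together they prevent the
elementary matrix `E_be` from being of the form `[T, y]`. -/
theorem exists_cls_mem_MP_of_matrix (hA : A.IsConnected) {n : ℕ} (hn : 2 ≤ n) {z : A.cocycles}
    (hz : (z : A) ∈ A.deg n) (ρ : ι → ℕ) (X : ι → ι → A)
    (hdeg : ∀ i j, ∀ k : ℕ, (k : ℤ) = δ j + 1 - δ i → X i j ∈ A.deg k)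
    (hneg : ∀ i j, δ j + 1 < δ i → X i j = 0) (htri : ∀ i j, ρ j ≤ ρ i → X i j = 0) {b e : ι}
    (hb : ∀ i, ρ b ≤ ρ i) (he : ∀ i, ρ i ≤ ρ e) (hbe : ρ b < ρ e) (hδ : δ b - δ e = 2 - n)
    (hX : ∀ i j, A.d (X i j) + ∑ l, A.sgn (X l j) * X i l = if i = b ∧ j = e then (z : A) else 0)
    (hcol : ∀ i, δ i = δ e + 1 → X i e = 0)
    (hrow : ∀ ξ : ι → ℚ, ¬ ∀ i, (∑ j, if δ i = δ j + 1 then ξ j • X i j else 0) =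
      if i = b then 1 else 0) :
    ∃ lam : MCProductData.{v}, A.cls z ∈ MP lam A := by
  have hinj : Function.Injective (algebraMap ℚ A) := by
    have := hA.1
    exact (algebraMap ℚ A).injective
  have hd0 : ∀ r, A.d (algebraMap ℚ A r) = 0 := fun r => by
    rw [Algebra.algebraMap_eq_smul_one, map_smul, A.d_one, smul_zero]
  obtain ⟨T, hTX, hT0⟩ : ∃ T : Matrix ι ι ℚ, (∀ i j,
      δ i = δ j + 1 → algebraMap ℚ A (T i j) = X i j) ∧
      ∀ i j, δ i ≠ δ j + 1 → T i j = 0 := by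
    have h : ∀ i j, ∃ r : ℚ, (δ i = δ j + 1 → algebraMap ℚ A r = X i j) ∧
        (δ i ≠ δ j + 1 → r = 0) := fun i j => by
      by_cases hij : δ i = δ j + 1
      · obtain ⟨r, hr⟩ := hA.2 _ (hdeg i j 0 (by push_cast; omega))
        exact ⟨r, fun _ => hr, fun h => absurd hij h⟩
      · exact ⟨0, fun h => absurd h hij, fun _ => rfl⟩
    choose t ht1 ht2 using h
    exact ⟨Matrix.of t, ht1, ht2⟩
  have hT : T ∈ matrixDeg δ 1 := fun i j h => hT0 i j (by omega)
  have hTN : T ∈ triangular ρ 0 := fun i j h => by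
    by_cases hij : δ i = δ j + 1
    · exact hinj (by rw [hTX i j hij, htri i j h, map_zero])
    · exact hT0 i j hij
  -- this is the part of the curvature equation in degree zero
  have hTT : T * T = 0 := by
    ext i j
    rw [Matrix.mul_apply, Matrix.zero_apply]
    by_cases hij : δ i = δ j + 2
    · have h := hX i j
      rw [hneg i j (by omega), map_zero, zero_add, if_neg (by rintro ⟨rfl, rfl⟩; omega)] at h
      refine hinj ?_
      rw [map_sum, map_zero, ← h]
      refine Finset.sum_congr rfl fun l _ => ?_
      rcases lt_trichotomy (δ l) (δ j + 1) with hl | hl | hl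
      · rw [hT0 l j hl.ne, mul_zero, map_zero, hneg i l (by omega), mul_zero]
      · rw [← hTX l j hl, ← hTX i l (by omega), CDGA.sgn_apply
          (SetLike.algebraMap_mem_graded A.deg _), pow_zero, one_smul, ← map_mul, mul_comm]
      · rw [hT0 l j hl.ne', mul_zero, map_zero, hneg l j hl, map_zero, zero_mul]
    · refine Finset.sum_eq_zero fun l _ => ?_
      by_cases hl : δ i = δ l + 1
      · rw [hT0 l j (by omega), mul_zero]
      · rw [hT0 i l hl, zero_mul]
  -- the part of the matrix in positive degrees
  set X' : ι → ι → A := fun i j => X i j - algebraMap ℚ A (T i j) with hX'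
  have hX'1 : ∀ i j, δ j + 1 ≤ δ i → X' i j = 0 := fun i j h => by
    rcases h.lt_or_eq with h | h
    · simp only [hX', hneg i j h, hT0 i j h.ne', map_zero, sub_zero]
    · simp only [hX', hTX i j h.symm, sub_self]
  have hX'2 : ∀ i j, δ i < δ j + 1 → X' i j = X i j := fun i j h => by
    simp only [hX', hT0 i j h.ne, map_zero, sub_zero]
  let x : A ⊗[ℚ] ofAlgebra (matrixDeg δ) T hT hTT := tensorOfEntries X'
  have hxe : ∀ i j, entry δ hT hTT i j x = X' i j := tensorEntry_tensorOfEntries X'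
  have hx : x ∈ tensorDeg A (ofAlgebra (matrixDeg δ) T hT hTT) 1 := by
    refine sum_mem fun i _ => sum_mem fun j _ => ?_
    rcases lt_or_ge (δ i) (δ j + 1) with h | h
    · rw [hX'2 i j h]
      refine tmul_mem_tensorDeg (L := ofAlgebra (matrixDeg δ) T hT hTT)
        (hdeg i j (δ j + 1 - δ i).toNat (by omega))
        (show Matrix.single i j 1 ∈ matrixDeg δ (δ i - δ j) from fun k l hkl => ?_) (by omega)
      rw [Matrix.single_apply, if_neg]
      rintro ⟨rfl, rfl⟩
      exact hkl rfl
    · rw [hX'1 i j h, TensorProduct.zero_tmul]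
      exact zero_mem _
  have hxW : x ∈ tens A (L := ofAlgebra (matrixDeg δ) T hT hTT)
      (truncation (R := Matrix ι ι ℚ) (matrixDeg δ) (triangular ρ) T) := by
    refine mem_tensorBox_of_forall_left fun φ => ?_
    have hφ : TensorProduct.lid ℚ (Matrix ι ι ℚ) (φ.rTensor (Matrix ι ι ℚ) (tensorOfEntries X')) ∈
        truncation (R := Matrix ι ι ℚ) (matrixDeg δ) (triangular ρ) T := by
      rw [contract_tensorOfEntries]
      refine ⟨fun i j h => ?_, fun k hk => ?_, ?_⟩
      · rw [Matrix.of_apply]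
        simp only [hX', htri i j h, hTN i j h, map_zero, sub_zero]
      · ext i j
        rw [gradedProj_matrixDeg, Matrix.of_apply, Matrix.zero_apply]
        split_ifs with h
        · rw [hX'1 i j (by omega), map_zero]
        · rfl
      · -- `T` commutes with the coefficients of degree one by the curvature equation
        ext i j
        rw [Matrix.mul_apply, Matrix.mul_apply, ← sub_eq_zero, ← Finset.sum_sub_distrib]
        simp only [gradedProj_matrixDeg, Matrix.of_apply]
        by_cases hij : δ i = δ j + 1
        · have h := congrArg φ (hX i j)
          rw [← hTX i j hij, hd0, zero_add, if_neg (by rintro ⟨rfl, rfl⟩; omega), map_zero, map_sum,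
            ← neg_eq_zero, ← Finset.sum_neg_distrib] at h
          refine Eq.trans ?_ h
          refine Finset.sum_congr rfl fun l _ => ?_
          by_cases h1 : δ l = δ j
          · rw [if_pos (by omega), if_neg (by omega), hX'2 l j (by omega), ← hTX i l (by omega),
              CDGA.sgn_apply (hdeg l j 1 (by omega)), ← Algebra.commutes, ← Algebra.smul_def]
            simp
          by_cases h2 : δ l = δ j + 1
          · rw [if_neg (by omega), if_pos (by omega), hX'2 i l (by omega), ← hTX l j h2,
              CDGA.sgn_apply (SetLike.algebraMap_mem_graded A.deg _), pow_zero, one_smul,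
              ← Algebra.smul_def, map_smul, smul_eq_mul]
            ring
          · rw [if_neg (by omega), if_neg (by omega), mul_zero, zero_mul, sub_zero, zero_eq_neg]
            rcases lt_or_ge (δ l) (δ j) with h3 | h3
            · rw [hneg i l (by omega), mul_zero, map_zero]
            · rw [hneg l j (by omega), map_zero, zero_mul, map_zero]
        · refine Finset.sum_eq_zero fun l _ => ?_
          have h1 : (T i l * if δ l - δ j = 0 then φ (X' l j) else 0) = 0 := by
            split_ifs with h
            · rw [hT0 i l (by omega), zero_mul]
            · rw [mul_zero]
          have h2 : (if δ i - δ l = 0 then φ (X' i l) else 0) * T l j = 0 := by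
            split_ifs with h
            · rw [hT0 l j (by omega), mul_zero]
            · rw [zero_mul]
          rw [h1, h2, sub_zero]
    exact hφ
  have hl : ∀ y ∈ triangular ρ 0, y * Matrix.single b e (1 : ℚ) = 0 := fun y hy => by
    ext i j
    rw [Matrix.mul_apply, Matrix.zero_apply]
    refine Finset.sum_eq_zero fun l _ => ?_
    rw [Matrix.single_apply]
    split_ifs with h
    · rw [← h.1, hy i b (by simpa using hb i), zero_mul]
    · rw [mul_zero]
  have hr : ∀ y ∈ triangular ρ 0, Matrix.single b e (1 : ℚ) * y = 0 := fun y hy => by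
    ext i j
    rw [Matrix.mul_apply, Matrix.zero_apply]
    refine Finset.sum_eq_zero fun l _ => ?_
    rw [Matrix.single_apply]
    split_ifs with h
    · rw [← h.2, hy e j (by simpa using he j), mul_zero]
    · rw [zero_mul]
  have hεN : Matrix.single b e (1 : ℚ) ∈ triangular ρ 0 := fun i j h => by
    rw [Matrix.single_apply, if_neg]
    rintro ⟨rfl, rfl⟩
    omega
  have hεq : Matrix.single b e (1 : ℚ) ∈ matrixDeg δ (2 - n) := fun i j h => by
    rw [Matrix.single_apply, if_neg]
    rintro ⟨rfl, rfl⟩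
    exact h hδ
  have hε : Matrix.single b e (1 : ℚ) ∈ truncation (matrixDeg δ) (triangular ρ) T := by
    rcases hn.lt_or_eq with h | rfl
    · exact mem_truncation_of_neg hεN (by omega : (2 - n : ℤ) < 0) hεq
    · exact mem_truncation_of_zero hεN (by simpa using hεq) (by rw [hl T hTN, hr T hTN])
  refine exists_cls_mem_MP_of_nilFiltration (triangular_nilFiltration δ ρ) hT hTT hTN hε
    (by omega : (2 - n : ℤ) ≤ 0) hεq hl hr (fun y hy => ?_) hx hxW
    (by rw [show (2 - (2 - n : ℤ)).toNat = n by omega]; exact hz) ?_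
  · refine hrow (fun j => y j e) fun i => ?_
    have h := congrFun (congrFun hy i) e
    rw [gradedCommutator_left_eq _ hT, Matrix.sub_apply, Matrix.mul_apply, Matrix.mul_apply,
      Matrix.single_apply, Finset.sum_eq_zero (s := Finset.univ) (f := fun j =>
        gradedScale (matrixDeg δ) (fun i => (-1) ^ i) y i j * T j e) (fun j _ => ?_), sub_zero] at h
    · have h2 := congrArg (algebraMap ℚ A) h
      rw [map_sum] at h2
      convert h2 using 1
      · refine Finset.sum_congr rfl fun j _ => ?_
        split_ifs with hij
        · rw [← hTX i j hij, mul_comm, map_mul, Algebra.smul_def]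
        · rw [hT0 i j hij, zero_mul, map_zero]
      · by_cases hi : b = i
        · simp [hi]
        · simp [hi, Ne.symm hi]
    · have : T j e = 0 := by
        by_cases hj : δ j = δ e + 1
        · exact hinj (by rw [hTX j e hj, hcol j hj, map_zero])
        · exact hT0 j e hj
      rw [this, mul_zero]
  · refine tensor_ext fun i j => ?_
    refine (entry_curvature δ hT hTT hx i j).trans ?_
    refine Eq.trans ?_ (tensorEntry_tmul i j (z : A) _).symm
    simp only [hxe, hX', sub_add_cancel]
    rw [map_sub, hd0, sub_zero, hX i j, Matrix.single_apply]
    by_cases h : i = b ∧ j = e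
    · rw [if_pos h, if_pos ⟨h.1.symm, h.2.symm⟩, one_smul]
    · rw [if_neg h, if_neg (fun h' => h ⟨h'.1.symm, h'.2.symm⟩), zero_smul]

end MatrixCurvature

/-! ### Finite triangular frames of an algebraic fibration -/

theorem mem_mul_of_le {E : Type*} [Ring E] [Algebra ℚ E] {M N N' : Submodule ℚ E} (h : N ≤ N')
    {x : E} (hx : x ∈ M * N) : x ∈ M * N' :=
  Submodule.mul_le.2 (fun _ hm _ hn => Submodule.mul_mem_mul hm (h hn)) hx

namespace CDGA

variable {A : CDGA.{u}}

theorem gradedProj_mul_right {m n : ℕ} {a : A} (ha : a ∈ A.deg m) (b : A) :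
    gradedProj A.deg (n + m) (b * a) = gradedProj A.deg n b * a := by
  refine graded_induction A.deg b (by simp) (fun k b hb => ?_)
    (fun x y hx hy => by simp only [add_mul, map_add, hx, hy])
  rcases eq_or_ne k n with rfl | h
  · rw [gradedProj_same _ hb, gradedProj_same _ (SetLike.mul_mem_graded hb ha)]
  · rw [gradedProj_ne _ h hb,
      gradedProj_ne _ (m := k + m) (by omega) (SetLike.mul_mem_graded hb ha),
      zero_mul]

theorem gradedProj_mul_right_of_lt {m n : ℕ} (h : n < m) {a : A} (ha : a ∈ A.deg m) (b : A) :
    gradedProj A.deg n (b * a) = 0 := by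
  refine graded_induction A.deg b (by simp) (fun k b hb => ?_)
    (fun x y hx hy => by simp only [add_mul, map_add, hx, hy, add_zero])
  exact gradedProj_ne _ (by omega : k + m ≠ n) (SetLike.mul_mem_graded hb ha)

theorem gradedProj_zero_mul (a b : A) :
    gradedProj A.deg 0 (a * b) = gradedProj A.deg 0 a * gradedProj A.deg 0 b := by
  refine graded_induction A.deg a (by simp) (fun k a ha => ?_)
    (fun x y hx hy => by simp only [add_mul, map_add, hx, hy])
  rcases Nat.eq_zero_or_pos k with rfl | h
  · rw [gradedProj_same _ ha]
    exact gradedProj_mul_left (n := 0) ha b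
  · rw [gradedProj_mul_left_of_lt h ha, gradedProj_ne _ h.ne' ha, zero_mul]

theorem gradedProj_zero_d (a : A) : gradedProj A.deg 0 (A.d a) = 0 := by
  refine graded_induction A.deg a (by simp) (fun k a ha => ?_)
    (fun x y hx hy => by simp only [map_add, hx, hy, add_zero])
  exact gradedProj_ne _ (Nat.succ_ne_zero k) (A.d_mem ha)

variable (A) in
/-- The augmentation ideal `A⁺`, as a subspace of `A`. -/
def positive : Submodule ℚ A := LinearMap.ker (gradedProj A.deg 0)

theorem mem_positive {a : A} : a ∈ A.positive ↔ gradedProj A.deg 0 a = 0 := LinearMap.mem_ker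

theorem mul_mem_positive {a : A} (ha : a ∈ A.positive) (b : A) : a * b ∈ A.positive := by
  rw [mem_positive, gradedProj_zero_mul, mem_positive.1 ha, zero_mul]

theorem mem_positive_of_mem_deg {n : ℕ} (hn : 0 < n) {a : A} (ha : a ∈ A.deg n) :
    a ∈ A.positive := gradedProj_ne _ hn.ne' ha

end CDGA

theorem FreeGradedComm.one_ne_zero {V : Type w} [AddCommGroup V] [Module ℚ V]
    (𝒱 : ℕ → Submodule ℚ V) : (1 : FreeGradedComm 𝒱) ≠ 0 := fun h => by
  have := congrArg (augmentation 𝒱) h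
  simp at this

namespace AlgebraicFibration

variable {A : CDGA.{u}} (F : AlgebraicFibration.{u, w} A)

theorem mulMap_tmul (a : A) (g : FreeGradedComm F.degV) : F.mulMap (a ⊗ₜ g) =
    F.incl.toAlgHom a * FreeGradedComm.lift F.degV F.gen F.gen_mem g := rfl

theorem incl_injective : Function.Injective F.incl.toAlgHom := by
  rw [injective_iff_map_eq_zero]
  intro a ha
  refine eq_zero_of_tmul_eq_zero (FreeGradedComm.one_ne_zero F.degV) ?_
  apply F.bijective.1
  rw [map_zero]
  refine (F.mulMap_tmul a 1).trans ?_
  rw [ha, zero_mul]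

theorem gradedProj_zero_of_mem_baseIdeal {x : F.total} (hx : x ∈ F.baseIdeal) :
    gradedProj F.total.deg 0 x = 0 := by
  have : F.baseIdeal ≤ LinearMap.ker (gradedProj F.total.deg 0) := by
    refine Submodule.span_le.2 ?_
    rintro _ ⟨n, a, y, hn, ha, rfl⟩
    exact CDGA.gradedProj_mul_left_of_lt hn (F.incl.map_deg ha) y
  exact this hx

/-- Since `V` is concentrated in positive degrees, `(A ⊗ ΛV)⁰ = A⁰`. -/
theorem exists_algebraMap_eq_of_mem_deg_zero (hA : A.IsConnected) {y : F.total}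
    (hy : y ∈ F.total.deg 0) : ∃ r : ℚ, algebraMap ℚ F.total r = y := by
  let S : Subalgebra ℚ F.total :=
    { carrier := {x | gradedProj F.total.deg 0 x ∈ (⊥ : Subalgebra ℚ F.total)}
      mul_mem' := fun {a b} ha hb => by
        change gradedProj F.total.deg 0 (a * b) ∈ (⊥ : Subalgebra ℚ F.total)
        rw [CDGA.gradedProj_zero_mul]
        exact mul_mem ha hb
      add_mem' := fun {a b} ha hb => by
        change gradedProj F.total.deg 0 (a + b) ∈ (⊥ : Subalgebra ℚ F.total)
        rw [map_add]
        exact add_mem ha hb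
      algebraMap_mem' := fun r => by
        change gradedProj F.total.deg 0 _ ∈ (⊥ : Subalgebra ℚ F.total)
        rw [Algebra.algebraMap_eq_smul_one, map_smul, gradedProj_same _ CDGA.one_mem_deg]
        exact Subalgebra.smul_mem _ (one_mem _) r }
  have hι : ∀ a, F.incl.toAlgHom a ∈ S := fun a => by
    change gradedProj F.total.deg 0 _ ∈ (⊥ : Subalgebra ℚ F.total)
    obtain ⟨r, hr⟩ := hA.2 _ (gradedProj_mem A.deg 0 a)
    rw [F.incl.gradedProj_comm, ← hr, AlgHom.commutes]
    exact Subalgebra.algebraMap_mem _ r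
  have hΛ : S.comap (FreeGradedComm.lift F.degV F.gen F.gen_mem) = ⊤ :=
    FreeGradedComm.eq_top_of_of_mem fun v => by
      rw [Subalgebra.mem_comap, FreeGradedComm.lift_of]
      refine graded_induction F.degV v ?_ (fun k v hv => ?_) (fun x y hx hy => ?_)
      · rw [map_zero]; exact zero_mem _
      · rcases Nat.eq_zero_or_pos k with rfl | h
        · rw [F.degV_zero, Submodule.mem_bot] at hv
          rw [hv, map_zero]; exact zero_mem _
        · change gradedProj F.total.deg 0 _ ∈ (⊥ : Subalgebra ℚ F.total)
          rw [gradedProj_ne _ h.ne' (F.gen_mem hv)]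
          exact zero_mem _
      · rw [map_add]; exact add_mem hx hy
  have hS : ∀ x, x ∈ S := fun x => by
    obtain ⟨t, rfl⟩ := F.bijective.2 x
    induction t with
    | zero => rw [map_zero]; exact zero_mem _
    | add x y hx hy => rw [map_add]; exact add_mem hx hy
    | tmul a g =>
      refine mul_mem (hι a) ?_
      have hg : g ∈ S.comap (FreeGradedComm.lift F.degV F.gen F.gen_mem) := hΛ ▸ _root_.trivial
      exact hg
  have h : gradedProj F.total.deg 0 y ∈ (⊥ : Subalgebra ℚ F.total) := hS y
  rw [gradedProj_same _ hy] at h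
  exact Algebra.mem_bot.1 h

/-- The image in the total space of a subspace `D` of `A`. -/
abbrev base (D : Submodule ℚ A) : Submodule ℚ F.total := D.map F.incl.toAlgHom.toLinearMap

theorem base_mul_base_top {D : Submodule ℚ A} (hD : ∀ a ∈ D, ∀ b, a * b ∈ D) :
    F.base D * F.base ⊤ ≤ F.base D := by
  refine Submodule.mul_le.2 ?_
  rintro _ ⟨a, ha, rfl⟩ _ ⟨b, -, rfl⟩
  exact ⟨a * b, hD a ha b, map_mul F.incl.toAlgHom a b⟩

/-- A finite-dimensional graded subspace of `ΛV ⊆ A ⊗ ΛV` that is obtained by successively adjoining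
homogeneous elements `x` for which `d x` is an `A`-linear combination of the elements already
there. -/
inductive IsTriangular : Submodule ℚ F.total → Prop
  | bot : IsTriangular ⊥
  | step {W : Submodule ℚ F.total} {x : F.total} {k : ℕ} (hW : IsTriangular W)
      (hx : x ∈ (FreeGradedComm.lift F.degV F.gen F.gen_mem).range)
      (hk : x ∈ F.total.deg k) (hd : F.total.d x ∈ F.base ⊤ * W) :
      IsTriangular (W ⊔ ℚ ∙ x)

namespace IsTriangular

variable {F}

theorem sup {W W' : Submodule ℚ F.total} (hW : F.IsTriangular W) (hW' : F.IsTriangular W') :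
    F.IsTriangular (W ⊔ W') := by
  induction hW' with
  | bot => simpa using hW
  | step h hx hk hd ih =>
    rw [← sup_assoc]
    exact ih.step hx hk (mem_mul_of_le le_sup_right hd)

theorem mul_base_le {W : Submodule ℚ F.total} (hW : F.IsTriangular W) :
    W * F.base ⊤ ≤ F.base ⊤ * W := by
  induction hW with
  | bot => simp
  | @step W x k h hx hk hd ih =>
    rw [Submodule.sup_mul, Submodule.mul_sup]
    refine sup_le_sup ih (Submodule.mul_le.2 ?_)
    rintro y hy _ ⟨a, -, rfl⟩
    obtain ⟨r, rfl⟩ := Submodule.mem_span_singleton.1 hy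
    rw [smul_mul_assoc]
    refine Submodule.smul_mem _ _ ?_
    rcases Nat.even_or_odd k with he | ho
    · rw [CDGA.mul_comm_of_even he hk]
      exact Submodule.mul_mem_mul ⟨a, _root_.trivial, rfl⟩ (Submodule.mem_span_singleton_self x)
    · rw [CDGA.mul_comm_of_odd ho hk]
      exact Submodule.mul_mem_mul ⟨A.sgn a, _root_.trivial, (F.incl.sgn_comm a).symm⟩
        (Submodule.mem_span_singleton_self x)

theorem mul {W W' : Submodule ℚ F.total} (hW : F.IsTriangular W) (hW' : F.IsTriangular W') :
    F.IsTriangular (W * W') := by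
  induction hW' with
  | bot => simpa using IsTriangular.bot
  | @step W' x k h hx hk hd ih =>
    have key : ∀ W₁, F.IsTriangular W₁ → W₁ ≤ W → F.IsTriangular (W * W' ⊔ W₁ * (ℚ ∙ x)) := by
      intro W₁ hW₁
      induction hW₁ with
      | bot => intro _; simpa using ih
      | @step W₁ y l h₁ hy hl hdy ih₁ =>
        intro hle
        rw [Submodule.sup_mul, Submodule.span_mul_span, Set.singleton_mul_singleton, ← sup_assoc]
        have hyW : y ∈ W := hle (Submodule.mem_sup_right (Submodule.mem_span_singleton_self y))
        refine (ih₁ (le_sup_left.trans hle)).step (mul_mem hy hx)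
          (CDGA.mul_mem_deg hl hk rfl) ?_
        rw [F.total.leibniz x hl, Submodule.mul_sup]
        refine add_mem (Submodule.mem_sup_right ?_) (Submodule.mem_sup_left
          (Submodule.smul_mem _ _ ?_))
        · rw [← mul_assoc]
          exact Submodule.mul_mem_mul hdy (Submodule.mem_span_singleton_self x)
        · have := Submodule.mul_mem_mul hyW hd
          rw [← mul_assoc] at this ⊢
          exact mul_le_mul' hW.mul_base_le le_rfl this
    rw [Submodule.mul_sup]
    exact key W hW le_rfl

variable (F) in
theorem one : F.IsTriangular (⊥ ⊔ ℚ ∙ (1 : F.total)) :=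
  bot.step (one_mem _) CDGA.one_mem_deg (by rw [CDGA.d_one]; exact zero_mem _)

end IsTriangular

/-- The subalgebra of all elements of `ΛV` that lie in a triangular subspace. -/
def triangularPart : Subalgebra ℚ F.total where
  carrier := {x | ∃ W, F.IsTriangular W ∧ x ∈ W}
  mul_mem' := by
    rintro a b ⟨W, hW, ha⟩ ⟨W', hW', hb⟩
    exact ⟨_, hW.mul hW', Submodule.mul_mem_mul ha hb⟩
  add_mem' := by
    rintro a b ⟨W, hW, ha⟩ ⟨W', hW', hb⟩
    exact ⟨_, hW.sup hW', add_mem (Submodule.mem_sup_left ha) (Submodule.mem_sup_right hb)⟩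
  algebraMap_mem' r := by
    refine ⟨_, .one F, Submodule.mem_sup_right ?_⟩
    rw [Algebra.algebraMap_eq_smul_one]
    exact Submodule.smul_mem _ _ (Submodule.mem_span_singleton_self _)

/-- The subalgebra of all `A`-linear combinations of elements of triangular subspaces. -/
def triangularSpan : Subalgebra ℚ F.total where
  carrier := {x | ∃ W, F.IsTriangular W ∧ x ∈ F.base ⊤ * W}
  mul_mem' := by
    rintro a b ⟨W, hW, ha⟩ ⟨W', hW', hb⟩
    refine ⟨_, hW.mul hW', ?_⟩
    have h := Submodule.mul_mem_mul ha hb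
    rw [mul_assoc, ← mul_assoc W] at h
    have h2 : F.base ⊤ * (W * F.base ⊤ * W') ≤ F.base ⊤ * (W * W') := by
      calc F.base ⊤ * (W * F.base ⊤ * W') ≤ F.base ⊤ * (F.base ⊤ * W * W') :=
            mul_le_mul' le_rfl (mul_le_mul' hW.mul_base_le le_rfl)
        _ = (F.base ⊤ * F.base ⊤) * (W * W') := by simp only [mul_assoc]
        _ ≤ F.base ⊤ * (W * W') :=
            mul_le_mul' (F.base_mul_base_top fun _ _ _ => _root_.trivial) le_rfl
    exact h2 h
  add_mem' := by
    rintro a b ⟨W, hW, ha⟩ ⟨W', hW', hb⟩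
    exact ⟨_, hW.sup hW', add_mem (mem_mul_of_le le_sup_left ha)
      (mem_mul_of_le le_sup_right hb)⟩
  algebraMap_mem' r := by
    refine ⟨_, .one F, ?_⟩
    have := Submodule.mul_mem_mul (M := F.base ⊤) (N := ⊥ ⊔ ℚ ∙ (1 : F.total))
      ⟨algebraMap ℚ A r, _root_.trivial, AlgHom.commutes _ r⟩
      (Submodule.mem_sup_right (Submodule.mem_span_singleton_self (1 : F.total)))
    rwa [mul_one] at this

theorem incl_mem_triangularSpan (a : A) : F.incl.toAlgHom a ∈ F.triangularSpan := by
  refine ⟨_, .one F, ?_⟩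
  have := Submodule.mul_mem_mul (M := F.base ⊤) (N := ⊥ ⊔ ℚ ∙ (1 : F.total)) ⟨a, _root_.trivial,
      rfl⟩
    (Submodule.mem_sup_right (Submodule.mem_span_singleton_self (1 : F.total)))
  rwa [mul_one] at this

theorem triangularPart_le : F.triangularPart ≤ F.triangularSpan := by
  rintro x ⟨W, hW, hx⟩
  refine ⟨W, hW, ?_⟩
  have := Submodule.mul_mem_mul (M := F.base ⊤) ⟨(1 : A), _root_.trivial,
      map_one F.incl.toAlgHom⟩ hx
  rwa [one_mul] at this

/-- The filtration of `V` provides the order in which the elements of `ΛV` are adjoined. -/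
theorem gen_mem_triangularPart (n : ℕ) : ∀ v ∈ F.filt n, F.gen v ∈ F.triangularPart := by
  have key : ∀ n, (∀ v ∈ F.filt n, F.total.d (F.gen v) ∈ F.triangularSpan) →
      ∀ v ∈ F.filt n, F.gen v ∈ F.triangularPart := by
    intro n h v hv
    obtain ⟨s, hs⟩ := exists_sum_gradedProj F.degV v
    rw [hs, map_sum]
    refine sum_mem fun k _ => ?_
    have hk : gradedProj F.degV k v ∈ F.filt n := by
      rw [gradedProj_eq_decompose]; exact F.filt_graded n hv k
    obtain ⟨W, hW, hd⟩ := h _ hk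
    exact ⟨_, hW.step ⟨_, FreeGradedComm.lift_of _ _ _⟩ (F.gen_mem (gradedProj_mem _ k v)) hd,
      Submodule.mem_sup_right (Submodule.mem_span_singleton_self _)⟩
  induction n with
  | zero =>
    refine key 0 fun v hv => ?_
    obtain ⟨a, ha⟩ := F.d_filt_zero v hv
    rw [← ha]
    exact F.incl_mem_triangularSpan a
  | succ n ih =>
    refine key (n + 1) fun v hv => ?_
    refine Algebra.adjoin_le (S := F.triangularSpan) ?_ (F.d_filt_succ n v hv)
    rintro x (⟨a, rfl⟩ | ⟨v, hv, rfl⟩)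
    · exact F.incl_mem_triangularSpan a
    · exact F.triangularPart_le (ih v hv)

theorem mem_triangularSpan (x : F.total) : x ∈ F.triangularSpan := by
  have hΛ : F.triangularPart.comap (FreeGradedComm.lift F.degV F.gen F.gen_mem) = ⊤ :=
    FreeGradedComm.eq_top_of_of_mem fun v => by
      rw [Subalgebra.mem_comap, FreeGradedComm.lift_of]
      obtain ⟨n, hn⟩ := F.filt_exhausts v
      exact F.gen_mem_triangularPart n v hn
  obtain ⟨t, rfl⟩ := F.bijective.2 x
  induction t with
  | zero => rw [map_zero]; exact zero_mem _
  | add x y hx hy => rw [map_add]; exact add_mem hx hy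
  | tmul a g =>
    refine mul_mem (F.incl_mem_triangularSpan a) (F.triangularPart_le ?_)
    have hg : g ∈ F.triangularPart.comap (FreeGradedComm.lift F.degV F.gen F.gen_mem) :=
      hΛ ▸ _root_.trivial
    exact hg

theorem exists_isTriangular_of_finset {ι : Type*} (s : Finset ι) (x : ι → F.total) :
    ∃ W, F.IsTriangular W ∧ ∀ i ∈ s, x i ∈ F.base ⊤ * W := by
  classical
  induction s using Finset.induction_on with
  | empty => exact ⟨⊥, .bot, by simp⟩
  | insert i s hi ih =>
    obtain ⟨W, hW, h⟩ := ih
    obtain ⟨W', hW', h'⟩ := F.mem_triangularSpan (x i)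
    refine ⟨_, hW.sup hW', fun j hj => ?_⟩
    rcases Finset.mem_insert.1 hj with rfl | hj
    · exact mem_mul_of_le le_sup_right h'
    · exact mem_mul_of_le le_sup_left (h j hj)

theorem exists_isTriangular_of_mem_baseIdeal {x : F.total} (hx : x ∈ F.baseIdeal) :
    ∃ W, F.IsTriangular W ∧ x ∈ F.base A.positive * W := by
  induction hx using Submodule.span_induction with
  | mem x h =>
    obtain ⟨n, a, y, hn, ha, rfl⟩ := h
    obtain ⟨W, hW, hy⟩ := F.mem_triangularSpan y
    refine ⟨W, hW, ?_⟩
    have := Submodule.mul_mem_mul (M := F.base A.positive)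
      ⟨a, CDGA.mem_positive_of_mem_deg hn ha, rfl⟩ hy
    rw [← mul_assoc] at this
    exact mul_le_mul'
      (F.base_mul_base_top fun a ha b => CDGA.mul_mem_positive ha b) le_rfl this
  | zero => exact ⟨⊥, .bot, zero_mem _⟩
  | add x y _ _ hx hy =>
    obtain ⟨W, hW, h⟩ := hx
    obtain ⟨W', hW', h'⟩ := hy
    exact ⟨_, hW.sup hW', add_mem (mem_mul_of_le le_sup_left h)
      (mem_mul_of_le le_sup_right h')⟩
  | smul r x _ hx =>
    obtain ⟨W, hW, h⟩ := hx
    exact ⟨W, hW, Submodule.smul_mem _ r h⟩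

end AlgebraicFibration

namespace AlgebraicFibration

variable {A : CDGA.{u}} (F : AlgebraicFibration.{u, w} A)

/-- A finite family of homogeneous linearly independent elements of `ΛV ⊆ A ⊗ ΛV` such that the
differential of each of them is an `A`-linear combination of the preceding ones. -/
structure Frame where
  /-- the number of elements -/
  m : ℕ
  f : Fin m → F.total
  /-- the degrees of the elements -/
  δ : Fin m → ℕ
  mem_deg : ∀ i, f i ∈ F.total.deg (δ i)
  mem_range : ∀ i, f i ∈ (FreeGradedComm.lift F.degV F.gen F.gen_mem).range
  linearIndependent : LinearIndependent ℚ f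
  d_mem : ∀ j, F.total.d (f j) ∈ F.base ⊤ * Submodule.span ℚ (f '' Set.Iio j)

variable {F}

theorem IsTriangular.exists_frame {W : Submodule ℚ F.total} (hW : F.IsTriangular W) :
    ∃ Φ : F.Frame, Submodule.span ℚ (Set.range Φ.f) = W := by
  induction hW with
  | bot => exact ⟨⟨0, Fin.elim0, Fin.elim0, fun i => i.elim0, fun i => i.elim0,
      linearIndependent_empty_type, fun i => i.elim0⟩, by simp⟩
  | @step W x k h hx hk hd ih =>
    obtain ⟨Φ, rfl⟩ := ih
    by_cases hxW : x ∈ Submodule.span ℚ (Set.range Φ.f)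
    · exact ⟨Φ, (sup_eq_left.2 ((Submodule.span_singleton_le_iff_mem _ _).2 hxW)).symm⟩
    · refine ⟨⟨Φ.m + 1, Fin.snoc Φ.f x, Fin.snoc Φ.δ k, ?_, ?_, ?_, ?_⟩, ?_⟩
      · intro i
        induction i using Fin.lastCases with
        | last => simpa using hk
        | cast i => simpa using Φ.mem_deg i
      · intro i
        induction i using Fin.lastCases with
        | last => simpa using hx
        | cast i => simpa using Φ.mem_range i
      · exact linearIndependent_finSnoc.2 ⟨Φ.linearIndependent, hxW⟩
      · intro i
        induction i using Fin.lastCases with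
        | last =>
          rw [Fin.snoc_last]
          refine mem_mul_of_le (Submodule.span_mono ?_) hd
          rintro _ ⟨i, rfl⟩
          exact ⟨i.castSucc, Fin.castSucc_lt_last i, by simp⟩
        | cast i =>
          rw [Fin.snoc_castSucc]
          refine mem_mul_of_le (Submodule.span_mono ?_) (Φ.d_mem i)
          rintro _ ⟨j, hj, rfl⟩
          exact ⟨j.castSucc, Fin.castSucc_lt_castSucc_iff.2 hj, by simp⟩
      · rw [Fin.range_snoc, Submodule.span_insert, sup_comm]

namespace Frame

variable (Φ : F.Frame)

/-- `A ⊗ ΛV` is a free `A`-module, and a frame is linearly independent over `A`. -/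
theorem eq_zero_of_sum_eq_zero {a : Fin Φ.m → A}
    (h : ∑ i, F.incl.toAlgHom (a i) * Φ.f i = 0) (i : Fin Φ.m) : a i = 0 := by
  choose g hg using Φ.mem_range
  have hg' : ∀ i, FreeGradedComm.lift F.degV F.gen F.gen_mem (g i) = Φ.f i := hg
  have hli : LinearIndependent ℚ g := by
    refine LinearIndependent.of_comp
      (FreeGradedComm.lift F.degV F.gen F.gen_mem).toLinearMap ?_
    convert Φ.linearIndependent using 1
    exact funext hg'
  have h0 : ∑ i, a i ⊗ₜ[ℚ] g i = 0 := by
    apply F.bijective.1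
    rw [map_zero, map_sum, ← h]
    refine Finset.sum_congr rfl fun j _ => ?_
    rw [← hg' j]
    rfl
  obtain ⟨φ, hφ⟩ := LinearMap.exists_extend (hli.repr)
  have h1 := congrArg ((TensorProduct.rid ℚ A).toLinearMap ∘ₗ
    (Finsupp.lapply i ∘ₗ φ).lTensor A) h0
  rw [map_sum, map_zero] at h1
  have h2 : ∀ j, φ (g j) = Finsupp.single j 1 := fun j => by
    have := LinearMap.congr_fun hφ ⟨g j, Submodule.subset_span ⟨j, rfl⟩⟩
    rw [LinearMap.comp_apply, Submodule.subtype_apply] at this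
    rw [this]
    exact hli.repr_eq_single j _ rfl
  simpa [h2, Finsupp.single_apply, ite_smul] using h1

theorem eq_of_sum_eq_sum {a b : Fin Φ.m → A}
    (h : ∑ i, F.incl.toAlgHom (a i) * Φ.f i = ∑ i, F.incl.toAlgHom (b i) * Φ.f i) (i : Fin Φ.m) :
    a i = b i := by
  refine sub_eq_zero.1 (Φ.eq_zero_of_sum_eq_zero (a := fun i => a i - b i) ?_ i)
  simp only [map_sub, sub_mul, Finset.sum_sub_distrib, h, sub_self]

theorem exists_coords {D : Submodule ℚ A} {s : Set (Fin Φ.m)} {y : F.total}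
    (hy : y ∈ F.base D * Submodule.span ℚ (Φ.f '' s)) :
    ∃ c : Fin Φ.m → A, y = ∑ i, F.incl.toAlgHom (c i) * Φ.f i ∧ (∀ i, c i ∈ D) ∧
      ∀ i ∉ s, c i = 0 := by
  induction hy using Submodule.mul_induction_on' with
  | mem_mul_mem b hb x hx =>
    obtain ⟨a, ha, rfl⟩ := hb
    induction hx using Submodule.span_induction with
    | mem x h =>
      obtain ⟨j, hj, rfl⟩ := h
      refine ⟨Pi.single j a, ?_, fun i => ?_, fun i hi => ?_⟩
      · rw [Finset.sum_eq_single j]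
        · simp
        · intro i _ hij
          rw [Pi.single_eq_of_ne hij, map_zero, zero_mul]
        · simp
      · rcases eq_or_ne i j with rfl | h
        · rwa [Pi.single_eq_same]
        · rw [Pi.single_eq_of_ne h]; exact zero_mem _
      · exact Pi.single_eq_of_ne (fun h => hi (by rwa [h])) _
    | zero => exact ⟨0, by simp, fun _ => zero_mem _, fun _ _ => rfl⟩
    | add x y _ _ hx hy =>
      obtain ⟨c, h1, h2, h3⟩ := hx
      obtain ⟨c', h1', h2', h3'⟩ := hy
      refine ⟨c + c', ?_, fun i => add_mem (h2 i) (h2' i), fun i hi => ?_⟩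
      · rw [mul_add, h1, h1', ← Finset.sum_add_distrib]
        simp only [Pi.add_apply, map_add, add_mul]
      · rw [Pi.add_apply, h3 i hi, h3' i hi, add_zero]
    | smul r x _ hx =>
      obtain ⟨c, h1, h2, h3⟩ := hx
      refine ⟨r • c, ?_, fun i => D.smul_mem r (h2 i), fun i hi => ?_⟩
      · rw [mul_smul_comm, h1, Finset.smul_sum]
        simp only [Pi.smul_apply, map_smul, smul_mul_assoc]
      · rw [Pi.smul_apply, h3 i hi, smul_zero]
  | add x _ y _ hx hy =>
    obtain ⟨c, h1, h2, h3⟩ := hx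
    obtain ⟨c', h1', h2', h3'⟩ := hy
    refine ⟨c + c', ?_, fun i => add_mem (h2 i) (h2' i), fun i hi => ?_⟩
    · rw [h1, h1', ← Finset.sum_add_distrib]
      simp only [Pi.add_apply, map_add, add_mul]
    · rw [Pi.add_apply, h3 i hi, h3' i hi, add_zero]

/-- The coordinates, with respect to a frame, of a homogeneous element can be chosen to be
homogeneous of the complementary degrees. -/
theorem exists_homogeneous_coords {D : Submodule ℚ A}
    (hD : ∀ n, ∀ a ∈ D, gradedProj A.deg n a ∈ D) {s : Set (Fin Φ.m)} {N : ℕ} {y : F.total}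
    (hy : y ∈ F.base D * Submodule.span ℚ (Φ.f '' s)) :
    ∃ c : Fin Φ.m → A,
      gradedProj F.total.deg N y = ∑ i, F.incl.toAlgHom (c i) * Φ.f i ∧ (∀ i, c i ∈ D) ∧
      (∀ i ∉ s, c i = 0) ∧ (∀ i k, k + Φ.δ i = N → c i ∈ A.deg k) ∧
      ∀ i, N < Φ.δ i → c i = 0 := by
  obtain ⟨c, h1, h2, h3⟩ := Φ.exists_coords hy
  refine ⟨fun i => if N < Φ.δ i then 0 else gradedProj A.deg (N - Φ.δ i) (c i), ?_, fun i => ?_,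
    fun i hi => ?_, fun i k hk => ?_, fun i hi => if_pos hi⟩
  · rw [h1, map_sum]
    refine Finset.sum_congr rfl fun i _ => ?_
    dsimp only
    split_ifs with h
    · rw [CDGA.gradedProj_mul_right_of_lt h (Φ.mem_deg i), map_zero, zero_mul]
    · rw [← F.incl.gradedProj_comm, ← CDGA.gradedProj_mul_right (Φ.mem_deg i),
        Nat.sub_add_cancel (not_lt.1 h)]
  · dsimp only
    split_ifs
    · exact zero_mem _
    · exact hD _ _ (h2 i)
  · simp [h3 i hi]
  · dsimp only
    rw [if_neg (by omega), show N - Φ.δ i = k by omega]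
    exact gradedProj_mem _ _ _

/-- The matrix of the differential with respect to a frame. -/
theorem exists_matrix : ∃ X : Fin Φ.m → Fin Φ.m → A,
    (∀ j, F.total.d (Φ.f j) = ∑ i, F.incl.toAlgHom (X i j) * Φ.f i) ∧
    (∀ i j, j ≤ i → X i j = 0) ∧
    (∀ i j k, k + Φ.δ i = Φ.δ j + 1 → X i j ∈ A.deg k) ∧
    (∀ i j, Φ.δ j + 1 < Φ.δ i → X i j = 0) ∧
    ∀ i j, A.d (X i j) + ∑ l, A.sgn (X l j) * X i l = 0 := by
  have key := fun j => Φ.exists_homogeneous_coords (fun _ _ _ => Submodule.mem_top)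
    (N := Φ.δ j + 1) (Φ.d_mem j)
  choose c h1 _ h3 h4 h5 using key
  have h1' : ∀ j, F.total.d (Φ.f j) = ∑ i, F.incl.toAlgHom (c j i) * Φ.f i := fun j => by
    rw [← h1, gradedProj_same _ (F.total.d_mem (Φ.mem_deg j))]
  refine ⟨fun i j => c j i, h1', fun i j h => h3 j i (not_lt.2 h), fun i j => h4 j i,
    fun i j => h5 j i, fun i j => ?_⟩
  refine Φ.eq_zero_of_sum_eq_zero
    (a := fun i => A.d (c j i) + ∑ l, A.sgn (c j l) * c l i) ?_ i
  have h := F.total.d_d (Φ.f j)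
  rw [h1' j, map_sum] at h
  rw [← h]
  simp only [map_add, map_sum, add_mul, map_mul, Finset.sum_add_distrib, CDGA.d_mul,
    F.incl.map_d, F.incl.sgn_comm, h1', Finset.mul_sum, Finset.sum_mul]
  congr 1
  rw [Finset.sum_comm]
  simp only [mul_assoc]

end Frame

end AlgebraicFibration

/-! ### Odd classes that die in a fibration are Maurer–Cartan higher products -/

/-- A version of `exists_cls_mem_MP_of_matrix` with free choice of the universe of `MCProductData`.
-/
theorem exists_cls_mem_MP_of_matrix_type {ι : Type} [Fintype ι] [DecidableEq ι] {A : CDGA.{u}}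
    (δ : ι → ℤ) (hA : A.IsConnected) {n : ℕ} (hn : 2 ≤ n) {z : A.cocycles} (hz : (z : A) ∈ A.deg n)
    (ρ : ι → ℕ) (X : ι → ι → A) (hdeg : ∀ i j, ∀ k : ℕ, (k : ℤ) = δ j + 1 - δ i → X i j ∈ A.deg k)
    (hneg : ∀ i j, δ j + 1 < δ i → X i j = 0) (htri : ∀ i j, ρ j ≤ ρ i → X i j = 0) {b e : ι}
    (hb : ∀ i, ρ b ≤ ρ i) (he : ∀ i, ρ i ≤ ρ e) (hbe : ρ b < ρ e) (hδ : δ b - δ e = 2 - n)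
    (hX : ∀ i j, A.d (X i j) + ∑ l, A.sgn (X l j) * X i l = if i = b ∧ j = e then (z : A) else 0)
    (hcol : ∀ i, δ i = δ e + 1 → X i e = 0)
    (hrow : ∀ ξ : ι → ℚ, ¬ ∀ i, (∑ j, if δ i = δ j + 1 then ξ j • X i j else 0) =
      if i = b then 1 else 0) :
    ∃ lam : MCProductData.{v}, A.cls z ∈ MP lam A := by
  refine exists_cls_mem_MP_of_matrix (ι := ULift.{v} ι) (fun i => δ i.down) hA hn hz
    (fun i => ρ i.down) (fun i j => X i.down j.down) (fun i j => hdeg _ _) (fun i j => hneg _ _)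
    (fun i j => htri _ _) (b := ⟨b⟩) (e := ⟨e⟩) (fun i => hb _) (fun i => he _) hbe hδ ?_
    (fun i => hcol _) ?_
  · rintro ⟨i⟩ ⟨j⟩
    have h := hX i j
    rw [← Equiv.ulift.{v}.sum_comp] at h
    simpa only [ULift.up_inj, Equiv.ulift_apply] using h
  · intro ξ h
    refine hrow (fun j => ξ ⟨j⟩) fun i => ?_
    rw [← Equiv.ulift.{v}.sum_comp]
    simpa only [ULift.up_inj, Equiv.ulift_apply] using h ⟨i⟩

namespace AlgebraicFibration

variable {A : CDGA.{u}} {F : AlgebraicFibration.{u, w} A} {n : ℕ} {z : A} {y : F.total}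

theorem d_pow_succ (hn : Odd n) (hy : y ∈ F.total.deg (n - 1))
    (hyz : F.total.d y = F.incl.toAlgHom z) (j : ℕ) :
    F.total.d (y ^ (j + 1)) = F.incl.toAlgHom ((j + 1 : ℚ) • z) * y ^ j := by
  have he : Even (n - 1) := by obtain ⟨k, rfl⟩ := hn; exact ⟨k, by omega⟩
  induction j with
  | zero => simp [hyz]
  | succ j ih =>
    have hp := CDGA.pow_mem_deg hy (j + 1)
    rw [pow_succ, CDGA.d_mul, ih, CDGA.sgn_apply hp, (he.mul_left _).neg_one_pow, one_smul,
      CDGA.mul_comm_of_even (he.mul_left _) hp, hyz, mul_assoc, ← pow_succ, ← add_mul, ← map_add]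
    congr 2
    push_cast
    module

/-- If the fiber has finite cohomological dimension, then a high power of `y` is exact in the
fiber. The exponent is `p + 1` for the largest `p` such that `yᵖ` is not exact there. -/
theorem exists_minimal_exact_pow (hA : A.IsConnected)
    (hF : F.FiberHasFiniteCohomologicalDimension) (hn : Odd n) (hn1 : 1 < n) (hz : z ∈ A.deg n)
    (hy : y ∈ F.total.deg (n - 1)) (hyz : F.total.d y = F.incl.toAlgHom z) :
    ∃ p : ℕ, (∀ t, y ^ p - F.total.d t ∉ F.baseIdeal) ∧
      ∃ t, y ^ (p + 1) - F.total.d t ∈ F.baseIdeal := by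
  classical
  have hex : ∃ k t, y ^ k - F.total.d t ∈ F.baseIdeal := by
    obtain ⟨N, hN⟩ := hF
    obtain ⟨s, hs⟩ := hN ((N + 1) * (n - 1)) (by
        calc N < (N + 1) * 1 := by omega
          _ ≤ (N + 1) * (n - 1) := Nat.mul_le_mul_left _ (by omega))
      (F.baseIdeal.mkQ (y ^ (N + 1))) ⟨_, CDGA.pow_mem_deg hy _, rfl⟩ (by
        change F.baseIdeal.mkQ (F.total.d (y ^ (N + 1))) = 0
        rw [d_pow_succ hn hy hyz, Submodule.mkQ_apply, Submodule.Quotient.mk_eq_zero]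
        exact F.incl_mul_mem_baseIdeal (by omega : 0 < n) (Submodule.smul_mem _ _ hz) _)
    obtain ⟨t, rfl⟩ := Submodule.mkQ_surjective _ s
    exact ⟨N + 1, t, (Submodule.Quotient.eq _).1 hs.symm⟩
  have h0 : Nat.find hex ≠ 0 := fun h => by
    obtain ⟨t, ht⟩ := Nat.find_spec hex
    rw [h, pow_zero] at ht
    have h1 := F.gradedProj_zero_of_mem_baseIdeal ht
    rw [map_sub, CDGA.gradedProj_zero_d, sub_zero, gradedProj_same _ CDGA.one_mem_deg,
      ← map_one F.incl.toAlgHom] at h1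
    have := hA.1
    exact one_ne_zero (F.incl_injective (h1.trans (map_zero _).symm))
  obtain ⟨p, hp⟩ := Nat.exists_eq_succ_of_ne_zero h0
  refine ⟨p, fun t ht => ?_, ?_⟩
  · exact Nat.find_min hex (by omega : p < Nat.find hex) ⟨t, ht⟩
  · have := Nat.find_spec hex
    rwa [hp] at this

theorem gradedProj_mem_positive (k : ℕ) {a : A} (ha : a ∈ A.positive) :
    gradedProj A.deg k a ∈ A.positive := by
  rcases Nat.eq_zero_or_pos k with rfl | h
  · rw [CDGA.mem_positive.1 ha]; exact zero_mem _
  · exact CDGA.mem_positive_of_mem_deg h (gradedProj_mem _ _ _)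

/-- A frame with coordinates of the powers `yʲ`, `j ≤ p`, and of an element of `A⁺ ⊗ ΛV` that
differs from `yᵖ⁺¹` by a coboundary. -/
theorem exists_frame_of_minimal (hn : Odd n) (hn1 : 1 < n) (hy : y ∈ F.total.deg (n - 1))
    (hyz : F.total.d y = F.incl.toAlgHom z) {p : ℕ} {t : F.total}
    (ht : y ^ (p + 1) - F.total.d t ∈ F.baseIdeal) :
    ∃ (Φ : F.Frame) (C : ℕ → Fin Φ.m → A),
      (∀ j i k, j ≤ p + 1 → k + Φ.δ i = j * (n - 1) → C j i ∈ A.deg k) ∧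
      (∀ j i, j ≤ p + 1 → j * (n - 1) < Φ.δ i → C j i = 0) ∧
      (∀ i, Φ.δ i = (p + 1) * (n - 1) → C (p + 1) i = 0) ∧
      (y ^ p = ∑ i, F.incl.toAlgHom (C p i) * Φ.f i) ∧
      (F.total.d (∑ i, F.incl.toAlgHom (C 0 i) * Φ.f i) = 0) ∧
      ∀ j, j ≤ p → F.total.d (∑ i, F.incl.toAlgHom (C (j + 1) i) * Φ.f i) =
        F.incl.toAlgHom ((j + 1 : ℚ) • z) * ∑ i, F.incl.toAlgHom (C j i) * Φ.f i := by
  obtain ⟨W, hW, hyW⟩ := F.exists_isTriangular_of_finset (Finset.range (p + 1)) fun j => y ^ j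
  obtain ⟨W', hW', htW'⟩ := F.exists_isTriangular_of_mem_baseIdeal ht
  obtain ⟨Φ, hΦ⟩ := (hW.sup hW').exists_frame
  rw [← Set.image_univ] at hΦ
  have h1 : ∀ j : ℕ, ∃ c : Fin Φ.m → A,
      (j ≤ p → y ^ j = ∑ i, F.incl.toAlgHom (c i) * Φ.f i) ∧
      (∀ i k, k + Φ.δ i = j * (n - 1) → c i ∈ A.deg k) ∧
      (∀ i, j * (n - 1) < Φ.δ i → c i = 0) := by
    intro j
    by_cases hj : j ≤ p
    · have := mem_mul_of_le (le_sup_left : W ≤ W ⊔ W')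
        (hyW j (Finset.mem_range.2 (Nat.lt_succ_of_le hj)))
      rw [← hΦ] at this
      obtain ⟨c, hc1, -, -, hc2, hc3⟩ := Φ.exists_homogeneous_coords
        (fun _ _ _ => Submodule.mem_top) (N := j * (n - 1)) this
      rw [gradedProj_same _ (CDGA.pow_mem_deg hy j)] at hc1
      exact ⟨c, fun _ => hc1, hc2, hc3⟩
    · exact ⟨0, fun h => absurd h hj, fun _ _ _ => zero_mem _, fun _ _ => rfl⟩
  choose c hc1 hc2 hc3 using h1
  have htW := mem_mul_of_le (le_sup_right : W' ≤ W ⊔ W') htW'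
  rw [← hΦ] at htW
  obtain ⟨c', h1', h2', -, h3', h4'⟩ := Φ.exists_homogeneous_coords
    (fun k _ => gradedProj_mem_positive k) (N := (p + 1) * (n - 1)) htW
  have hC : ∀ j ≤ p, (fun j => if j = p + 1 then c' else c j) j = c j := fun j hj =>
    if_neg (by omega)
  have hC' : (fun j => if j = p + 1 then c' else c j) (p + 1) = c' := if_pos rfl
  refine ⟨Φ, fun j => if j = p + 1 then c' else c j, ?_, ?_, ?_, ?_, ?_, ?_⟩
  · intro j i k hj hk
    rcases hj.lt_or_eq with hj | rfl
    · rw [hC j (by omega)]; exact hc2 j i k hk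
    · rw [hC']; exact h3' i k hk
  · intro j i hj hk
    rcases hj.lt_or_eq with hj | rfl
    · rw [hC j (by omega)]; exact hc3 j i hk
    · rw [hC']; exact h4' i hk
  · intro i hi
    rw [hC', ← gradedProj_same A.deg (h3' i 0 (by omega))]
    exact h2' i
  · rw [hC p le_rfl]; exact hc1 p le_rfl
  · rw [hC 0 (Nat.zero_le p), ← hc1 0 (Nat.zero_le p), pow_zero, CDGA.d_one]
  · intro j hj
    rw [hC j hj, ← hc1 j hj, ← d_pow_succ hn hy hyz]
    rcases hj.lt_or_eq with hj | rfl
    · rw [hC (j + 1) hj, ← hc1 (j + 1) hj]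
    · obtain ⟨M, hM⟩ : ∃ M, (j + 1) * (n - 1) = M + 1 :=
        Nat.exists_eq_succ_of_ne_zero (Nat.mul_pos j.succ_pos (by omega)).ne'
      rw [hC', ← h1', map_sub, gradedProj_same _ (CDGA.pow_mem_deg hy _), hM, CDGA.gradedProj_d,
        map_sub, CDGA.d_d, sub_zero]

/-- The matrix whose curvature is concentrated in one entry, where it is `z`. Its index set consists
of a frame of the total space, of one index for every power of `y` up to the exponent `p + 1`, and
of one further index. -/
def powerMatrix {m p : ℕ} (X : Fin m → Fin m → A) (C : ℕ → Fin m → A) (z : A) :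
    Fin m ⊕ Fin (p + 2) ⊕ Unit → Fin m ⊕ Fin (p + 2) ⊕ Unit → A
  | .inl i, .inl j => X i j
  | .inl i, .inr (.inl j) => C j i
  | .inr (.inl i), .inr (.inl j) => if (i : ℕ) + 1 = j then (j : ℚ) • z else 0
  | .inr (.inr _), .inr (.inl j) => if (j : ℕ) = p then algebraMap ℚ A (-(p + 1 : ℚ)⁻¹) else 0
  | .inr _, .inl _ => 0
  | _, .inr (.inr _) => 0

/-- If `d w' = b w` for elements with coordinates `c'` and `c`, then the coordinates satisfy the
corresponding equation. -/
theorem Frame.d_coords (Φ : F.Frame) {X : Fin Φ.m → Fin Φ.m → A}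
    (hX : ∀ j, F.total.d (Φ.f j) = ∑ i, F.incl.toAlgHom (X i j) * Φ.f i) {b : A}
    {c c' : Fin Φ.m → A} (h : F.total.d (∑ i, F.incl.toAlgHom (c' i) * Φ.f i) =
      F.incl.toAlgHom b * ∑ i, F.incl.toAlgHom (c i) * Φ.f i) (i : Fin Φ.m) :
    A.d (c' i) + ∑ l, A.sgn (c' l) * X i l = b * c i := by
  refine Φ.eq_of_sum_eq_sum
    (a := fun i => A.d (c' i) + ∑ l, A.sgn (c' l) * X i l) (b := fun i => b * c i) ?_ i
  simp only [map_mul, mul_assoc, ← Finset.mul_sum]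
  rw [← h, map_sum]
  simp only [map_add, map_sum, add_mul, map_mul, Finset.sum_add_distrib, CDGA.d_mul,
    F.incl.map_d, F.incl.sgn_comm, hX, Finset.mul_sum, Finset.sum_mul]
  congr 1
  rw [Finset.sum_comm]
  simp only [mul_assoc]

end AlgebraicFibration

namespace AlgebraicFibration

variable {A : CDGA.{u}} {F : AlgebraicFibration.{u, w} A} {n : ℕ} {y : F.total}

/-- Let `p` be maximal such that `yᵖ` is not exact in the fiber. The matrix `powerMatrix` is built
from the differentials of a frame, from the coordinates of `y⁰, …, yᵖ` and of an element of `A⁺ ⊗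
ΛV` that differs from `yᵖ⁺¹` by a coboundary, and from the coefficients in `d yʲ = j z yʲ⁻¹`. Its
curvature is `z` in the last column of the additional row. The condition on the fiber provides the
column condition of `exists_cls_mem_MP_of_matrix`, and the maximality of `p` provides the row
condition. -/
theorem exists_cls_mem_MP_of_odd (hA : A.IsConnected)
    (hF : F.FiberHasFiniteCohomologicalDimension) (hn : Odd n) (hn1 : 1 < n) {z : A.cocycles}
    (hz : (z : A) ∈ A.deg n) (hy : y ∈ F.total.deg (n - 1))
    (hyz : F.total.d y = F.incl.toAlgHom z) :
    ∃ lam : MCProductData.{v}, A.cls z ∈ MP lam A := by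
  obtain ⟨p, hp, t, ht⟩ := exists_minimal_exact_pow hA hF hn hn1 hz hy hyz
  obtain ⟨Φ, C, hC1, hC2, hC3, hyp, hC4, hC5⟩ := exists_frame_of_minimal hn hn1 hy hyz ht
  obtain ⟨X, hX, hXtri, hXdeg, hXneg, hXX⟩ := Φ.exists_matrix
  obtain ⟨r, rfl⟩ : ∃ r, n = r + 1 := ⟨n - 1, by omega⟩
  rw [Nat.add_sub_cancel] at *
  have hr : 0 < r := by omega
  have hzz : (z : A) * z = 0 := CDGA.mul_self_of_odd hn hz
  have hsz : A.sgn z = -z := by rw [CDGA.sgn_apply hz, hn.neg_one_pow, neg_one_smul]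
  have hdz : A.d z = 0 := z.2
  have hmem : ∀ j : Fin (p + 2), (j : ℕ) ≤ p + 1 := fun j => Nat.lt_succ_iff.1 j.2
  let δ : Fin Φ.m ⊕ Fin (p + 2) ⊕ Unit → ℤ :=
    Sum.elim (fun i => (Φ.δ i : ℤ)) (Sum.elim (fun j => (j : ℤ) * r - 1) fun _ => (p : ℤ) * r)
  let ρ : Fin Φ.m ⊕ Fin (p + 2) ⊕ Unit → ℕ :=
    Sum.elim (fun i => 1 + i) (Sum.elim (fun j => Φ.m + 1 + j) fun _ => 0)
  have hrow : ∀ ξ : Fin Φ.m ⊕ Fin (p + 2) ⊕ Unit → ℚ, ¬ ∀ i,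
      (∑ j, if δ i = δ j + 1 then ξ j • powerMatrix X C z i j else 0) =
        if i = .inr (.inr ()) then 1 else 0 := by
    intro ξ hξ
    -- row `b` of the system determines the coefficient of `yᵖ`
    set c : Fin (p + 2) := ⟨p, by omega⟩ with hc
    have hξ1 : ξ (.inr (.inl c)) = -(p + 1) := by
      have h := hξ (.inr (.inr ()))
      rw [Finset.sum_eq_single (.inr (.inl c)), if_pos (by simp [δ, hc]), if_pos rfl] at h
      · simp only [powerMatrix, hc, if_true, Algebra.algebraMap_eq_smul_one, smul_smul] at h
        have := hA.1
        have h2 : ξ (.inr (.inl c)) * -(p + 1 : ℚ)⁻¹ = 1 :=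
          smul_left_injective ℚ (one_ne_zero (α := A)) (h.trans (one_smul ℚ (1 : A)).symm)
        field_simp at h2
        linarith
      · rintro (j | j | j) _ hj <;> simp only [powerMatrix, smul_zero, ite_self]
        rw [if_neg (c := (j : ℕ) = p) (fun h => hj (by rw [hc]; congr; exact Fin.ext h)),
          smul_zero, ite_self]
      · simp
    -- the remaining equations say that `yᵖ` is exact in the fiber
    let t' : F.total := ∑ j, (if Φ.δ j + 1 = p * r then ξ (.inl j) else 0) • Φ.f j
    refine hp ((p + 1 : ℚ)⁻¹ • t') ?_
    have ht' : F.total.d t' - (p + 1 : ℚ) • y ^ p = ∑ i, F.incl.toAlgHom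
        ((∑ j, (if Φ.δ j + 1 = p * r then ξ (.inl j) else 0) • X i j) - (p + 1 : ℚ) • C p i) *
          Φ.f i := by
      simp only [t', hyp, map_sum, map_smul, map_sub, sub_mul, Finset.sum_sub_distrib, hX,
        Finset.smul_sum, Finset.sum_mul, smul_mul_assoc]
      congr 1
      exact Finset.sum_comm
    -- coefficients of positive degree do not matter in the fiber
    have hmemI : F.total.d t' - (p + 1 : ℚ) • y ^ p ∈ F.baseIdeal := by
      rw [ht']
      refine sum_mem fun i _ => ?_
      rcases lt_trichotomy (Φ.δ i) (p * r) with h | h | h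
      · obtain ⟨k, hk⟩ := Nat.exists_eq_add_of_lt h
        refine F.incl_mul_mem_baseIdeal k.succ_pos (sub_mem (sum_mem fun j _ => ?_)
          (Submodule.smul_mem _ _ (hC1 p i _ (by omega) (by omega)))) _
        split_ifs with hj
        · exact Submodule.smul_mem _ _ (hXdeg i j _ (by omega))
        · rw [zero_smul]; exact zero_mem _
      · -- the coefficient of `f i` in degree zero vanishes by row `f i` of the system
        have h1 := hξ (.inl i)
        rw [if_neg (by simp), Fintype.sum_sum_type, Fintype.sum_sum_type,
          Finset.sum_eq_single (s := Finset.univ (α := Fin (p + 2))) c] at h1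
        · simp only [powerMatrix, smul_zero, ite_self, Finset.sum_const_zero, add_zero, δ,
            Sum.elim_inl, Sum.elim_inr, hξ1] at h1
          rw [if_pos (by rw [h]; push_cast; ring)] at h1
          have h2 : (∑ j, (if Φ.δ j + 1 = p * r then ξ (.inl j) else 0) • X i j) -
              (p + 1 : ℚ) • C p i = 0 := by
            rw [← h1, neg_smul, ← sub_eq_add_neg]
            congr 1
            refine Finset.sum_congr rfl fun j _ => ?_
            rw [ite_smul, zero_smul]
            exact if_congr (by rw [h]; omega) rfl rfl
          rw [h2, map_zero, zero_mul]
          exact zero_mem _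
        · intro j _ hj
          rw [if_neg]
          intro h'
          refine hj (Fin.ext (Nat.eq_of_mul_eq_mul_right hr ?_))
          simp only [δ, Sum.elim_inl, Sum.elim_inr] at h'
          zify
          rw [hc]
          rw [h] at h'
          push_cast at h'
          linarith
        · simp
      · rw [hC2 p i (by omega) h, smul_zero, sub_zero, Finset.sum_eq_zero fun j _ => ?_, map_zero,
          zero_mul]
        · exact zero_mem _
        · split_ifs with hj
          · rw [hXneg i j (by omega), smul_zero]
          · rw [zero_smul]
    have h3 := F.baseIdeal.smul_mem (-(p + 1 : ℚ)⁻¹) hmemI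
    have hp0 : (p + 1 : ℚ) ≠ 0 := by positivity
    rwa [smul_sub, smul_smul, neg_mul, inv_mul_cancel₀ hp0, neg_smul, neg_smul, one_smul,
      sub_neg_eq_add, neg_add_eq_sub, ← map_smul] at h3
  refine exists_cls_mem_MP_of_matrix_type δ hA (by omega) hz ρ (powerMatrix X C z)
    ?_ ?_ ?_ (b := .inr (.inr ())) (e := .inr (.inl (Fin.last (p + 1)))) ?_ ?_ ?_ ?_ ?_ ?_ hrow
  · rintro (i | i | i) (j | j | j) k hk <;> simp only [powerMatrix, δ, Sum.elim_inl,
      Sum.elim_inr] at hk ⊢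
    · exact hXdeg i j k (by omega)
    · exact hC1 j i k (hmem j) (by zify; omega)
    · exact zero_mem _
    · exact zero_mem _
    · split_ifs with h
      · have hk' : k = r + 1 := by
          zify
          rw [hk, ← h]
          push_cast
          ring
        rw [hk']
        exact Submodule.smul_mem _ _ hz
      · exact zero_mem _
    · exact zero_mem _
    · exact zero_mem _
    · split_ifs with h
      · have hk' : k = 0 := by
          zify
          rw [hk, h]
          ring
        rw [hk']
        exact SetLike.algebraMap_mem_graded A.deg _
      · exact zero_mem _
    · exact zero_mem _
  · rintro (i | i | i) (j | j | j) hk <;> simp only [powerMatrix, δ, Sum.elim_inl,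
      Sum.elim_inr] at hk ⊢
    · exact hXneg i j (by omega)
    · exact hC2 j i (hmem j) (by zify; omega)
    · rw [if_neg]
      intro h
      rw [← h] at hk
      push_cast at hk
      nlinarith
    · rw [if_neg]
      intro h
      rw [h] at hk
      omega
  · rintro (i | i | i) (j | j | j) hk <;> simp only [powerMatrix, ρ, Sum.elim_inl,
      Sum.elim_inr] at hk ⊢
    · exact hXtri i j (Fin.le_def.2 (by omega))
    · omega
    · exact if_neg (by omega)
    · omega
  · exact fun i => Nat.zero_le _
  · rintro (i | i | i) <;> simp only [ρ, Sum.elim_inl, Sum.elim_inr, Fin.val_last] <;> omega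
  · simp only [ρ, Sum.elim_inl, Sum.elim_inr]; omega
  · simp only [δ, Sum.elim_inl, Sum.elim_inr, Fin.val_last]
    push_cast
    ring
  · rintro (i | i | i) (j | j | j) <;>
      simp only [Fintype.sum_sum_type, powerMatrix, map_zero, zero_mul, mul_zero,
        Finset.sum_const_zero, add_zero, zero_add, Sum.inr.injEq, reduceCtorEq, false_and,
        and_false, if_false, Sum.inl.injEq, true_and]
    · exact hXX i j
    · rw [← add_assoc]
      obtain ⟨j, hj⟩ := j
      rcases j with _ | j
      · rw [Φ.d_coords hX (b := 0) (c := C 0) (by rw [map_zero, zero_mul]; exact hC4), zero_mul,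
          zero_add]
        refine Finset.sum_eq_zero fun x _ => ?_
        rw [if_neg (Nat.succ_ne_zero _), map_zero, zero_mul]
      · rw [Φ.d_coords hX (hC5 j (by omega)), Finset.sum_eq_single ⟨j, by omega⟩]
        · rw [if_pos rfl, map_smul, hsz, smul_neg, neg_mul]
          push_cast
          exact add_neg_cancel _
        · intro x _ hx
          rw [if_neg (fun h => hx (Fin.ext (by simpa using h))), map_zero, zero_mul]
        · simp
    · rw [Finset.sum_eq_zero fun x _ => ?_, add_zero]
      · split_ifs
        · rw [map_smul, hdz, smul_zero]
        · exact map_zero _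
      · split_ifs
        · rw [map_smul, hsz, smul_mul_smul_comm, neg_mul, hzz, neg_zero, smul_zero]
        all_goals simp only [map_zero, zero_mul, mul_zero]
    · have hd : A.d (if (j : ℕ) = p then algebraMap ℚ A (-(p + 1 : ℚ)⁻¹) else 0) = 0 := by
        split_ifs
        · rw [Algebra.algebraMap_eq_smul_one, map_smul, A.d_one, smul_zero]
        · exact map_zero _
      rw [hd, zero_add, Finset.sum_eq_single ⟨p, by omega⟩]
      · by_cases hj : j = Fin.last (p + 1)
        · rw [if_pos hj, if_pos rfl, if_pos (by rw [hj]; rfl), map_smul, hsz, hj, Fin.val_last,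
            ← Algebra.commutes, ← Algebra.smul_def, smul_neg, smul_neg, neg_smul, neg_neg,
            smul_smul]
          push_cast
          rw [inv_mul_cancel₀ (by positivity), one_smul]
        · rw [if_neg hj, if_neg, map_zero, zero_mul]
          exact fun h => hj (Fin.ext h.symm)
      · intro x _ hx
        rw [if_neg (c := (x : ℕ) = p) (fun h => hx (Fin.ext h)), mul_zero]
      · simp
  · rintro (i | i | i) hi <;> simp only [powerMatrix, δ, Sum.elim_inl, Sum.elim_inr,
      Fin.val_last] at hi ⊢
    · exact hC3 i (by zify; push_cast at hi; linarith)
    · rw [if_neg]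
      intro h
      rw [show (i : ℕ) = p by omega] at hi
      push_cast at hi
      nlinarith
    · exact if_neg (by omega)

/-- The class `0` is a Maurer–Cartan higher product. -/
theorem _root_.exists_zero_mem_MP (hA : A.IsConnected) :
    ∃ lam : MCProductData.{v}, (0 : A.Cohomology) ∈ MP lam A :=
  exists_cls_mem_MP_of_odd (F := trivial.{u, 0} A) (n := 3) (y := 0) (z := 0) hA
    (trivial_isBounded A).fiberHasFiniteCohomologicalDimension (by decide) (by norm_num)
    (zero_mem _) (zero_mem _) (by rw [map_zero]; exact (map_zero _).symm)

theorem exists_primitive_mem_deg {z : A} (hz : z ∈ A.deg n) (hy : F.total.d y = F.incl.toAlgHom z) :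
    ∃ y' ∈ F.total.deg (n - 1), F.total.d y' = F.incl.toAlgHom z := by
  rcases n with _ | n
  · refine ⟨0, zero_mem _, ?_⟩
    rw [← gradedProj_same _ (F.incl.map_deg hz), ← hy, CDGA.gradedProj_zero_d, map_zero]
  · refine ⟨gradedProj F.total.deg n y, gradedProj_mem _ _ _, ?_⟩
    rw [← CDGA.gradedProj_d, hy, gradedProj_same _ (F.incl.map_deg hz)]

end AlgebraicFibration

/-! ### The annihilated classes -/

namespace CDGA

variable {A : CDGA.{u}}

theorem eq_zero_of_mem_ann_zero {a : A.Cohomology} (ha : a ∈ A.H 0) (h : a ∈ ann.{u, w} A) :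
    a = 0 := by
  obtain ⟨z, hz, rfl⟩ := mem_H_iff.1 ha
  obtain ⟨F, -, hF⟩ := h
  obtain ⟨y, hy⟩ := F.incl.onCohomology_cls_eq_zero_iff.1 hF
  refine cls_eq_zero_iff.2 ⟨0, ?_⟩
  have h0 : F.incl.toAlgHom z = 0 := by
    rw [← gradedProj_same _ (F.incl.map_deg hz), ← hy, gradedProj_zero_d]
  rw [map_zero]
  exact (F.incl_injective (h0.trans (map_zero _).symm)).symm

theorem exists_mem_MP_of_odd (hA : A.IsConnected) {n : ℕ} (hn : Odd n) {a : A.Cohomology}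
    (ha : a ∈ A.H n) (h : a ∈ ann.{u, w} A) : ∃ lam : MCProductData.{v}, a ∈ MP lam A := by
  obtain ⟨z, hz, rfl⟩ := mem_H_iff.1 ha
  obtain ⟨F, hfin, hF⟩ := h
  obtain ⟨y, hy⟩ := F.incl.onCohomology_cls_eq_zero_iff.1 hF
  obtain ⟨y', hy', hyz⟩ := AlgebraicFibration.exists_primitive_mem_deg hz hy
  rcases Nat.lt_or_ge 1 n with h1 | h1
  · exact AlgebraicFibration.exists_cls_mem_MP_of_odd hA hfin hn h1 hz hy' hyz
  · obtain rfl : n = 1 := by obtain ⟨k, rfl⟩ := hn; omega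
    -- in degree `0` the total space consists of scalars, so that nothing is hit in degree `1`
    obtain ⟨r, rfl⟩ := F.exists_algebraMap_eq_of_mem_deg_zero hA hy'
    have h0 : A.cls z = 0 := by
      refine cls_eq_zero_iff.2 ⟨0, ?_⟩
      rw [Algebra.algebraMap_eq_smul_one, map_smul, d_one, smul_zero] at hyz
      rw [map_zero]
      exact (F.incl_injective (hyz.symm.trans (map_zero _).symm)).symm
    rw [h0]
    exact exists_zero_mem_MP.{u, v} hA

theorem mem_even_or_MP_of_mem_ann (hA : A.IsConnected) {n : ℕ} {a : A.Cohomology}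
    (ha : a ∈ A.H n) (h : a ∈ ann.{u, w} A) :
    ∃ e ∈ A.evenCohomology, ∃ m ∈ ⋃ lam : MCProductData.{v}, MP lam A, a = e + m := by
  rcases Nat.even_or_odd n with he | ho
  · obtain ⟨lam, h0⟩ := exists_zero_mem_MP.{u, v} hA
    refine ⟨a, ?_, 0, Set.mem_iUnion.2 ⟨lam, h0⟩, (add_zero a).symm⟩
    rcases Nat.eq_zero_or_pos n with rfl | hpos
    · rw [eq_zero_of_mem_ann_zero ha h]; exact zero_mem _
    · obtain ⟨k, rfl⟩ := he.exists_two_nsmul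
      exact Submodule.mem_iSup_of_mem k (Submodule.mem_iSup_of_mem (by
        rw [smul_eq_mul] at hpos; omega) ha)
  · obtain ⟨lam, hm⟩ := exists_mem_MP_of_odd hA ho ha h
    exact ⟨0, zero_mem _, a, Set.mem_iUnion.2 ⟨lam, hm⟩, (zero_add a).symm⟩

/-- The homogeneous components of a class that dies in a fibration die in the same fibration. -/
theorem exists_sum_homogeneous_of_mem_ann {a : A.Cohomology} (h : a ∈ ann.{u, w} A) :
    ∃ (s : Finset ℕ) (c : ℕ → A.Cohomology), a = ∑ n ∈ s, c n ∧
      ∀ n, c n ∈ A.H n ∧ c n ∈ ann.{u, w} A := by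
  obtain ⟨z, rfl⟩ := Ideal.Quotient.mk_surjective a
  obtain ⟨F, hfin, hF⟩ := h
  obtain ⟨y, hy⟩ := F.incl.onCohomology_cls_eq_zero_iff.1 hF
  obtain ⟨s, hs⟩ := exists_sum_gradedProj A.deg (z : A)
  have hc : ∀ n, gradedProj A.deg n (z : A) ∈ A.cocycles := fun n => by
    rw [mem_cocycles, ← gradedProj_d, show A.d z = 0 from z.2, map_zero]
  refine ⟨s, fun n => A.cls ⟨_, hc n⟩, ?_, fun n => ⟨⟨⟨_, hc n⟩, gradedProj_mem _ _ _, rfl⟩, F,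
      hfin,
    F.incl.onCohomology_cls_eq_zero_iff.2 ?_⟩⟩
  · rw [← map_sum]
    congr 1
    refine Subtype.ext (hs.trans ?_)
    rw [AddSubmonoidClass.coe_finsetSum]
  · rw [← F.incl.gradedProj_comm, ← hy]
    rcases n with _ | n
    · exact ⟨0, by rw [gradedProj_zero_d, map_zero]⟩
    · exact ⟨_, (gradedProj_d n y).symm⟩

theorem ann_eq_span (hA : A.IsConnected) :
    ann.{u, w} A = (A.evenCohomology ⊔ Submodule.span ℚ (⋃ lam : MCProductData.{v}, MP lam A) :
      Submodule ℚ A.Cohomology) := by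
  refine Set.Subset.antisymm (fun a ha => ?_) (fun a ha => ?_)
  · obtain ⟨s, c, rfl, hc⟩ := exists_sum_homogeneous_of_mem_ann ha
    refine Submodule.sum_mem _ fun n _ => ?_
    obtain ⟨e, he, m, hm, h⟩ := mem_even_or_MP_of_mem_ann.{u, v, w} hA (hc n).1 (hc n).2
    rw [h]
    exact add_mem (Submodule.mem_sup_left he) (Submodule.mem_sup_right (Submodule.subset_span hm))
  · refine AlgebraicFibration.span_even_union_MP_subset_ann.{u, v, w} A ?_
    rwa [Submodule.span_union, Submodule.span_eq]

variable (A) in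
/-- The two-sided ideal `ann(A)` of the cohomology of a connected commutative DGA. It is closed
under multiplication since the kernel of `H(A) → H(A ⊗ ΛV)` is an ideal, and closed under addition
by `CDGA.ann_eq_span`. -/
def annIdeal (hA : A.IsConnected) : Ideal A.Cohomology where
  carrier := ann.{u, w} A
  add_mem' {a b} ha hb := by
    rw [ann_eq_span.{u, 0, w} hA] at *
    exact add_mem ha hb
  zero_mem' := by
    rw [ann_eq_span.{u, 0, w} hA]
    exact zero_mem _
  smul_mem' := by
    rintro c a ⟨F, hfin, hF⟩
    exact ⟨F, hfin, by rw [smul_eq_mul, map_mul, hF, mul_zero]⟩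

end CDGA

end

theorem theorem4p2 (A : CDGA.{u}) (hA : A.IsConnected) :
    -- `ann(A)` is a homogeneous (two-sided) ideal of the cohomology algebra, and as such it is the
    -- sum of the even positive cohomology and (the span of) all MC higher products
    (∃ I : Ideal A.Cohomology, I.IsTwoSided ∧ (I : Set A.Cohomology) = ann.{u, w} A ∧
      I.restrictScalars ℚ = ⨆ n, I.restrictScalars ℚ ⊓ A.H n ∧
      I.restrictScalars ℚ =
        A.evenCohomology ⊔ Submodule.span ℚ (⋃ lam : MCProductData.{v}, MP lam A)) ∧
    -- a homogeneous class is in `ann(A)` iff it is the sum of an even positive class and a single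
    -- MC higher product
    (∀ (n : ℕ), ∀ a ∈ A.H n, a ∈ ann.{u, w} A ↔
      ∃ e ∈ A.evenCohomology, ∃ m ∈ ⋃ lam : MCProductData.{v}, MP lam A, a = e + m) := by
  refine ⟨⟨CDGA.annIdeal.{u, w} A hA, ⟨fun {a} b ha => ?_⟩, rfl, le_antisymm (fun a ha => ?_)
    (iSup_le fun n => inf_le_left), SetLike.coe_injective (CDGA.ann_eq_span hA)⟩,
    fun n a ha => ⟨CDGA.mem_even_or_MP_of_mem_ann hA ha, ?_⟩⟩
  · obtain ⟨F, hfin, hF⟩ := ha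
    exact ⟨F, hfin, by rw [map_mul, hF, zero_mul]⟩
  · obtain ⟨s, c, rfl, hc⟩ := CDGA.exists_sum_homogeneous_of_mem_ann ha
    exact Submodule.sum_mem _ fun n _ => Submodule.mem_iSup_of_mem n ⟨(hc n).2, (hc n).1⟩
  · rintro ⟨e, he, m, hm, rfl⟩
    rw [CDGA.ann_eq_span.{u, v, w} hA]
    exact add_mem (Submodule.mem_sup_left he) (Submodule.mem_sup_right (Submodule.subset_span hm))
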